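/- Let $K$ be a field and let $\Delta$ be a simplicial complex on a finite nonempty vertex set $V$ (a family of subsets of $V$ closed under taking subsets and containing $\{v\}$ for every $v\in V$). Put $S=K[X_v : v\in V]$, let $I_\Delta\subseteq S$ be the Stanley–Reisner ideal, generated by the monomials $\prod_{v\in F}X_v$ with $F\subseteq V$, $F\notin\Delta$, and let $K[\Delta]=S/I_\Delta$. A complex $\Gamma$ is a complete intersection complex if $I_\Gamma$ is generated by a (possibly empty) regular sequence, and $\Delta$ is a locally complete intersection complex if, for every $v\in V$, the link $\{G\in\Delta : v\notin G,\ G\cup\{v\}\in\Delta\}$, regarded as a complex on its own vertices, is a complete intersection complex. Then $\Delta$ is a locally complete intersection complex if and only if it is a disjoint union of finitely many complexes $\Gamma_1,\dots,\Gamma_r$ (that is, $V=V_1\sqcup\dots\sqcup V_r$, each $\Gamma_i$ is a simplicial complex on $V_i$, and $\Delta=\Gamma_1\cup\dots\cup\Gamma_r$), each of which is of one of the following kinds: (a) a complete intersection complex of dimension $\ge 2$; (b) an $m$-gon with $m\ge 3$: after numbering the vertices, the facets are $\{1,2\},\{2,3\},\dots,\{m-1,m\},\{m,1\}$; (c) an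 $m$-pointed path with $m\ge 2$: after numbering the vertices, the facets are $\{1,2\},\{2,3\},\dots,\{m-1,m\}$; (d) a point. All complexes of the kinds (a)–(d) are connected. Moreover, if $\Delta$ is a locally complete intersection complex, then (i) $K[\Delta]$ is Cohen–Macaulay if and only if $\dim\Delta=0$ or $\Delta$ is connected; (ii) $K[\Delta]$ is Buchsbaum if and only if $\Delta$ is pure, that is, all facets of $\Delta$ have the same dimension. Here $A=K[\Delta]$, with homogeneous maximal ideal $\mathfrak m$ generated by the images $x_v$ of the variables, is called Buchsbaum if for every $i<\dim A$ the canonical map $H^i(\mathfrak m,A)\to H^i_{\mathfrak m}(A)$ from the Koszul cohomology of $A$ with respect to the $x_v$ to the local cohomology of $A$ is surjective. -/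

import Mathlib

noncomputable section

/-! ### Simplicial complexes

`AbstractSimplicialComplex V` is Mathlib's notion: a downward closed family of nonempty finite
subsets of `V` containing every singleton. The empty face, which belongs to every simplicial complex
in the usual convention, is left out there, so a complex on the empty vertex set is `{∅}` in the
usual convention. -/

namespace AbstractSimplicialComplex

variable {V : Type*}

/-- The dimension: the maximum of `#F - 1` over all faces `F` (here `V` is finite). -/
def dim (Δ : AbstractSimplicialComplex V) : ℤ :=
  ((sSup {n : ℕ | ∃ F ∈ Δ.faces, F.card = n} : ℕ) : ℤ) - 1

/-- A facet is a face that is maximal with respect to inclusion. -/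
def IsFacet (Δ : AbstractSimplicialComplex V) (F : Finset V) : Prop :=
  F ∈ Δ.faces ∧ ∀ G ∈ Δ.faces, F ⊆ G → F = G

/-- A complex is pure if all its facets have the same dimension. -/
def IsPure (Δ : AbstractSimplicialComplex V) : Prop :=
  ∀ F G : Finset V, Δ.IsFacet F → Δ.IsFacet G → F.card = G.card

/-- The underlying graph: two distinct vertices are adjacent if they form a face. -/
def graph [DecidableEq V] (Δ : AbstractSimplicialComplex V) : SimpleGraph V where
  Adj u v := u ≠ v ∧ {u, v} ∈ Δ.faces
  symm := ⟨fun u v h => ⟨h.1.symm, by rw [Finset.pair_comm]; exact h.2⟩⟩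
  loopless := ⟨fun _ h => h.1 rfl⟩

/-- A complex is connected if any two of its vertices are joined by a path of edges (and it has a
vertex). -/
def IsConnected [DecidableEq V] (Δ : AbstractSimplicialComplex V) : Prop :=
  Δ.graph.Connected

/-- The vertices of the link of the vertex `v`. -/
abbrev LinkVertex [DecidableEq V] (Δ : AbstractSimplicialComplex V) (v : V) : Type _ :=
  {w : V // w ≠ v ∧ {w, v} ∈ Δ.faces}

/-- The link of the vertex `v`, as a simplicial complex on its own set of vertices: its faces are
the sets `G` with `v ∉ G` and `G ∪ {v}` a face. -/
def link [DecidableEq V] (Δ : AbstractSimplicialComplex V) (v : V) :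
    AbstractSimplicialComplex (Δ.LinkVertex v) where
  faces := {G | G.Nonempty ∧ insert v (G.map (Function.Embedding.subtype _)) ∈ Δ.faces}
  isRelLowerSet_faces := by
    rintro G ⟨hG, hGf⟩
    refine ⟨hG, fun H hHG hH => ⟨hH, ?_⟩⟩
    exact (Δ.isRelLowerSet_faces hGf).2
      (Finset.insert_subset_insert _ (Finset.map_subset_map.2 hHG)) (Finset.insert_nonempty _ _)
  singleton_mem := by
    rintro ⟨w, hw, hwv⟩
    refine ⟨Finset.singleton_nonempty _, ?_⟩
    rw [Finset.map_singleton, Finset.pair_comm]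
    exact hwv

/-- `Δ` is the disjoint union of the complexes `Γ i`, where `V` is partitioned into the fibres of
`c : V → ι` and `Γ i` is a complex on the fibre over `i`. -/
def IsDisjointUnion {ι : Type*} (Δ : AbstractSimplicialComplex V) (c : V → ι)
    (Γ : (i : ι) → AbstractSimplicialComplex {v : V // c v = i}) : Prop :=
  ∀ F : Finset V, F ∈ Δ.faces ↔
    ∃ i, ∃ G ∈ (Γ i).faces, F = G.map (Function.Embedding.subtype _)

/-- The `m`-gon: after numbering the vertices `0, …, m - 1`, the facets are the sets `{i, i + 1}`
for `i + 1 < m` together with `{m - 1, 0}`. -/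
def IsGon [DecidableEq V] (Δ : AbstractSimplicialComplex V) (m : ℕ) : Prop :=
  ∃ e : Fin m ≃ V, ∀ F : Finset V, Δ.IsFacet F ↔
    ∃ i j : Fin m, (j.val = i.val + 1 ∨ (i.val + 1 = m ∧ j.val = 0)) ∧ F = {e i, e j}

/-- The `m`-pointed path: after numbering the vertices `0, …, m - 1`, the facets are the sets
`{i, i + 1}` for `i + 1 < m`. -/
def IsPointedPath [DecidableEq V] (Δ : AbstractSimplicialComplex V) (m : ℕ) : Prop :=
  ∃ e : Fin m ≃ V, ∀ F : Finset V, Δ.IsFacet F ↔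
    ∃ i j : Fin m, j.val = i.val + 1 ∧ F = {e i, e j}

/-- The complex is a point: it has exactly one vertex. -/
def IsPoint (_Δ : AbstractSimplicialComplex V) : Prop := Nat.card V = 1

section StanleyReisner

variable (K : Type*) [Field K]

/-- The Stanley–Reisner ideal, generated by the squarefree monomials of the non-faces. -/
def stanleyReisnerIdeal (Δ : AbstractSimplicialComplex V) : Ideal (MvPolynomial V K) :=
  Ideal.span {p | ∃ F : Finset V, F.Nonempty ∧ F ∉ Δ.faces ∧ p = ∏ v ∈ F, MvPolynomial.X v}

/-- The Stanley–Reisner ring `K[Δ]`. -/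
abbrev StanleyReisnerRing (Δ : AbstractSimplicialComplex V) : Type _ :=
  MvPolynomial V K ⧸ Δ.stanleyReisnerIdeal K

/-- The image in `K[Δ]` of the variable that belongs to the vertex `v`. -/
def stanleyReisnerVar (Δ : AbstractSimplicialComplex V) (v : V) : Δ.StanleyReisnerRing K :=
  Ideal.Quotient.mk _ (MvPolynomial.X v)

/-- A complete intersection complex: the Stanley–Reisner ideal is generated by a (possibly empty)
regular sequence. -/
def IsCompleteIntersection (Δ : AbstractSimplicialComplex V) : Prop :=
  ∃ fs : List (MvPolynomial V K),
    RingTheory.Sequence.IsRegular (MvPolynomial V K) fs ∧ Ideal.ofList fs = Δ.stanleyReisnerIdeal K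

/-- A locally complete intersection complex: the links of all vertices are complete intersection
complexes. -/
def IsLocallyCompleteIntersection [DecidableEq V] (Δ : AbstractSimplicialComplex V) : Prop :=
  ∀ v : V, (Δ.link v).IsCompleteIntersection K

/-- The building blocks: complete intersection complexes of dimension at least two, `m`-gons with
`m ≥ 3`, `m`-pointed paths with `m ≥ 2`, and points. -/
def IsBuildingBlock [DecidableEq V] (Γ : AbstractSimplicialComplex V) : Prop :=
  (Γ.IsCompleteIntersection K ∧ 2 ≤ Γ.dim) ∨ (∃ m : ℕ, 3 ≤ m ∧ Γ.IsGon m) ∨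
    (∃ m : ℕ, 2 ≤ m ∧ Γ.IsPointedPath m) ∨ Γ.IsPoint

end StanleyReisner

end AbstractSimplicialComplex

/-! ### Cohen–Macaulay rings -/

/-- The depth of a local ring: the supremum of the lengths of the regular sequences in its maximal
ideal. -/
def localDepth (R : Type*) [CommRing R] [IsLocalRing R] : ℕ∞ :=
  ⨆ (rs : List R) (_ : RingTheory.Sequence.IsRegular R rs ∧
    ∀ r ∈ rs, r ∈ IsLocalRing.maximalIdeal R), (rs.length : ℕ∞)

/-- A Cohen–Macaulay ring: a Noetherian ring all of whose localizations at maximal ideals have depth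
equal to their Krull dimension. -/
def IsCohenMacaulayRing (R : Type*) [CommRing R] : Prop :=
  IsNoetherianRing R ∧ ∀ (p : Ideal R) [p.IsMaximal],
    ((localDepth (Localization.AtPrime p) : ℕ∞) : WithBot ℕ∞) =
      ringKrullDim (Localization.AtPrime p)

/-! ### Koszul cohomology, local cohomology and the Buchsbaum property

The Koszul cochain complex and the Čech complex of a finite family `x` of elements of a ring `A` are
both built from modules `M F` indexed by the finite sets `F` of indices, with restriction maps
`M F → M G` for `F ⊆ G`. -/

section Cohomology

variable {A : Type*} [CommRing A] {V : Type*}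

section Localizations

variable (x : V → A)

/-- The localization `A_{x_F}`, where `x_F = ∏_{v ∈ F} x_v`. -/
abbrev CechModule (F : Finset V) : Type _ := Localization.Away (∏ v ∈ F, x v)

theorem isUnit_algebraMap_cechModule (F G : Finset V) (h : F ⊆ G) :
    IsUnit (algebraMap A (CechModule x G) (∏ v ∈ F, x v)) :=
  IsLocalization.Away.isUnit_of_dvd (x := ∏ v ∈ G, x v) (Finset.prod_dvd_prod_of_subset F G x h)

end Localizations

variable [LinearOrder V]

section Cochain

variable (M : Finset V → Type*) [∀ F, AddCommGroup (M F)] [∀ F, Module A (M F)]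
  (res : ∀ F G : Finset V, F ⊆ G → (M F →ₗ[A] M G))

/-- Cochains of degree `i`: a member of `M F` for every `F` with `i` elements. -/
abbrev SetCochain (i : ℕ) : Type _ := (F : {F : Finset V // F.card = i}) → M F.1

/-- The sign `(-1) ^ #{w ∈ F | w < v}`. -/
def setSign (F : Finset V) (v : V) : ℤ := (-1) ^ (F.filter (· < v)).card

/-- The differential `(d a)_G = ∑_{v ∈ G} ± a_{G ∖ {v}}|_G`. -/
def setCoboundary (i : ℕ) : SetCochain M i →ₗ[A] SetCochain M (i + 1) :=
  LinearMap.pi fun G => ∑ v : {v : V // v ∈ G.1}, setSign G.1 v.1 •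
    (res (G.1.erase v.1) G.1 (Finset.erase_subset v.1 G.1)).comp
      (LinearMap.proj (⟨G.1.erase v.1, by
        rw [Finset.card_erase_of_mem v.2, G.2, Nat.add_sub_cancel]⟩ :
        {F : Finset V // F.card = i}))

/-- The cocycles of degree `i`. -/
def setCocycles (i : ℕ) : Submodule A (SetCochain M i) := LinearMap.ker (setCoboundary M res i)

/-- The coboundaries of degree `i`. -/
def setCoboundaries : (i : ℕ) → Submodule A (SetCochain M i)
  | 0 => ⊥
  | i + 1 => LinearMap.range (setCoboundary M res i)

/-- The cohomology in degree `i`: cocycles modulo coboundaries. -/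
abbrev SetCohomology (i : ℕ) : Type _ :=
  setCocycles M res i ⧸ (setCoboundaries M res i).submoduleOf (setCocycles M res i)

end Cochain

section Map

variable {M N : Finset V → Type*} [∀ F, AddCommGroup (M F)] [∀ F, Module A (M F)]
  [∀ F, AddCommGroup (N F)] [∀ F, Module A (N F)]
  (resM : ∀ F G : Finset V, F ⊆ G → (M F →ₗ[A] M G))
  (resN : ∀ F G : Finset V, F ⊆ G → (N F →ₗ[A] N G))
  (φ : ∀ F, M F →ₗ[A] N F)

/-- The map on cochains induced by a family of linear maps. -/
def setCochainMap (i : ℕ) : SetCochain M i →ₗ[A] SetCochain N i :=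
  LinearMap.pi fun F => (φ F.1).comp (LinearMap.proj F)

theorem setCochainMap_coboundary
    (hφ : ∀ (F G : Finset V) (h : F ⊆ G) (a : M F), φ G (resM F G h a) = resN F G h (φ F a))
    (i : ℕ) (a : SetCochain M i) :
    setCochainMap φ (i + 1) (setCoboundary M resM i a) =
      setCoboundary N resN i (setCochainMap φ i a) := by
  funext G
  simp [setCochainMap, setCoboundary, hφ]

theorem setCochainMap_mem_cocycles
    (hφ : ∀ (F G : Finset V) (h : F ⊆ G) (a : M F), φ G (resM F G h a) = resN F G h (φ F a))
    (i : ℕ) (a : SetCochain M i) (ha : a ∈ setCocycles M resM i) :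
    setCochainMap φ i a ∈ setCocycles N resN i := by
  have h0 : setCoboundary M resM i a = 0 := ha
  change setCoboundary N resN i (setCochainMap φ i a) = 0
  rw [← setCochainMap_coboundary resM resN φ hφ, h0, map_zero]

theorem setCochainMap_mem_coboundaries
    (hφ : ∀ (F G : Finset V) (h : F ⊆ G) (a : M F), φ G (resM F G h a) = resN F G h (φ F a))
    (i : ℕ) (a : SetCochain M i) (ha : a ∈ setCoboundaries M resM i) :
    setCochainMap φ i a ∈ setCoboundaries N resN i := by
  cases i with
  | zero =>
    have h0 : a = 0 := ha
    rw [h0, map_zero]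
    exact Submodule.zero_mem _
  | succ i =>
    obtain ⟨b, rfl⟩ := ha
    exact ⟨setCochainMap φ i b, (setCochainMap_coboundary resM resN φ hφ i b).symm⟩

/-- The map on cohomology induced by a family of linear maps that commutes with the restriction
maps. -/
def setCohomologyMap
    (hφ : ∀ (F G : Finset V) (h : F ⊆ G) (a : M F), φ G (resM F G h a) = resN F G h (φ F a))
    (i : ℕ) : SetCohomology M resM i →ₗ[A] SetCohomology N resN i :=
  Submodule.mapQ _ _
    ((setCochainMap φ i).restrict fun a ha => setCochainMap_mem_cocycles resM resN φ hφ i a ha)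
    fun a ha => setCochainMap_mem_coboundaries resM resN φ hφ i a.1 ha

end Map

section KoszulCech

variable (x : V → A)

/-- The restriction maps `A → A` of the Koszul complex: multiplication by `∏_{v ∈ G ∖ F} x_v`. -/
def koszulRes (F G : Finset V) (_ : F ⊆ G) : A →ₗ[A] A := LinearMap.mulLeft A (∏ v ∈ G \ F, x v)

/-- The Koszul cohomology `H^i(x; A)`: the cohomology of the complex with terms `⨁_{#F = i} A` and
differential `(d a)_G = ∑_{v ∈ G} ± x_v a_{G ∖ {v}}`. -/
abbrev KoszulCohomology (i : ℕ) : Type _ := SetCohomology (fun _ : Finset V => A) (koszulRes x) i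

/-- The restriction maps of the Čech complex: the localization maps `A_{x_F} → A_{x_G}`. -/
def cechRes (F G : Finset V) (h : F ⊆ G) : CechModule x F →ₗ[A] CechModule x G :=
  (IsLocalization.Away.liftAlgHom (A := A) (∏ v ∈ F, x v)
    (f := Algebra.ofId A (CechModule x G)) (isUnit_algebraMap_cechModule x F G h)).toLinearMap

/-- The local cohomology `H^i_𝔞(A)` with respect to the ideal `𝔞` generated by the `x_v` (for `A`
Noetherian and `V` finite), computed by the Čech complex with terms `⨁_{#F = i} A_{x_F}`. -/
abbrev CechCohomology (i : ℕ) : Type _ := SetCohomology (CechModule x) (cechRes x) i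

/-- The map `A → A_{x_F}`, `a ↦ a / x_F`. The Čech complex is the direct limit over `ℓ` of the
Koszul complexes of the powers `x_v ^ ℓ`, where `a` in degree `F` of the `ℓ`-th complex goes to
`a / x_F ^ ℓ`; this is the structure map for `ℓ = 1`. -/
def koszulToCech (F : Finset V) : A →ₗ[A] CechModule x F :=
  LinearMap.toSpanSingleton A (CechModule x F) (IsLocalization.Away.invSelf (∏ v ∈ F, x v))

theorem koszulToCech_res (F G : Finset V) (h : F ⊆ G) (a : A) :
    koszulToCech x G (koszulRes x F G h a) = cechRes x F G h (koszulToCech x F a) := by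
  have hF := IsLocalization.Away.mul_invSelf (S := CechModule x F) (∏ v ∈ F, x v)
  have hG := IsLocalization.Away.mul_invSelf (S := CechModule x G) (∏ v ∈ G, x v)
  apply (isUnit_algebraMap_cechModule x G G subset_rfl).mul_left_cancel
  have hFG := congrArg (IsLocalization.Away.liftAlgHom (A := A) (∏ v ∈ F, x v)
    (f := Algebra.ofId A (CechModule x G)) (isUnit_algebraMap_cechModule x F G h)) hF
  rw [map_mul, map_one, AlgHom.commutes] at hFG
  have hp := congrArg (algebraMap A (CechModule x G)) (Finset.prod_sdiff (f := x) h)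
  rw [map_mul] at hp
  simp only [koszulToCech, koszulRes, cechRes, LinearMap.toSpanSingleton_apply,
    LinearMap.mulLeft_apply, AlgHom.toLinearMap_apply, map_smul]
  rw [mul_smul_comm, hG, mul_smul_comm, ← hp, mul_assoc]
  refine Eq.trans ?_ (congrArg (fun t => a • (algebraMap A (CechModule x G) (∏ v ∈ G \ F, x v) * t))
    hFG.symm)
  rw [mul_one, Algebra.smul_def, Algebra.smul_def, mul_one, map_mul, mul_comm]

/-- The canonical map from the Koszul cohomology `H^i(x; A)` to the local cohomology `H^i_𝔞(A)`. -/
def koszulToLocalCohomology (i : ℕ) : KoszulCohomology x i →ₗ[A] CechCohomology x i :=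
  setCohomologyMap (koszulRes x) (cechRes x) (koszulToCech x) (koszulToCech_res x) i

/-- `A`, a standard graded algebra whose homogeneous maximal ideal is generated by the `x_v`, is
Buchsbaum: for every `i < dim A` the canonical map from the Koszul cohomology to the local
cohomology is surjective. -/
def IsBuchsbaum : Prop :=
  ∀ i : ℕ, ((i : ℕ∞) : WithBot ℕ∞) < ringKrullDim A →
    Function.Surjective (koszulToLocalCohomology x i)

end KoszulCech

end Cohomology

end

/-! The minimal nonfaces of a complex are the supports of the minimal generators of its
Stanley–Reisner ideal. This ideal is generated by a regular sequence exactly if the minimal nonfaces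
are pairwise disjoint: disjoint monomials form a regular sequence, and the relation that comes from
the least common multiple of two monomials with a common variable has coefficients outside the ideal,
which is impossible for a complete intersection (`isCompleteIntersection_iff`). So the theorem is
about complexes in which the links of all vertices have pairwise disjoint minimal nonfaces
(`HasLocallyDisjointNonfaces`).

*Classification.* It suffices to treat connected complexes. If there is a face with three vertices,
two minimal nonfaces that meet can be traced, through the links of suitable vertices, to two minimal
nonfaces of one link that meet, so the complex is a complete intersection
(`HasLocallyDisjointNonfaces.hasDisjointNonfaces`). Otherwise the complex is a graph in which every
vertex has at most two neighbours, and a longest path shows that it is a polygon, a path or a point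
(`exists_hamiltonian_path`).

*Cohen–Macaulayness.* Where a variable `x_v` is invertible, the ring is a localization of the one of
the star of `v`, which is a complete intersection, and its depth is computed with the Rees theorem
(`localDepth_eq_ringKrullDim_of_ofList`). At the origin a connected complex is a complete
intersection or a graph; for a connected graph the sum of the variables and the sum of the products
of two variables form a regular sequence (`isWeaklyRegular_of_isConnected`). For a disconnected
complex the homogeneous maximal ideal is a sum of two nonzero ideals with product zero, so the depth
is at most one (`localDepth_le_one`).

*The Buchsbaum property.* A class of the Čech complex is represented by a cocycle of the Koszul
complex of the `k`-th powers of the variables, which splits into components indexed by exponent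
vectors with integral entries. The component of degree zero comes from the Koszul complex. The
component in a degree with nonempty positive support is the complex of a cone. In the remaining
degrees the component is the cochain complex of the link of a nonempty face `N`, the negative
support. Such a link is a complete intersection, so its cohomology vanishes below the top degree
(`isExactAt_of_card_lt`), and for a pure complex the top degree is the dimension of the ring. In
contrast, a facet `F` that is too small gives the cocycle `1 / x_F ^ 2`, which does not come from
Koszul cohomology (`not_surjective_of_isFacet`). -/

namespace AbstractSimplicialComplex

variable {V : Type*}

/-! ### Minimal nonfaces -/

section Nonfaces

variable {Δ : AbstractSimplicialComplex V} {F G : Finset V}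

theorem nonempty_of_mem_faces (h : F ∈ Δ.faces) : F.Nonempty := (Δ.isRelLowerSet_faces h).1

theorem mem_faces_of_subset (h : F ∈ Δ.faces) (hG : G ⊆ F) (hne : G.Nonempty) : G ∈ Δ.faces :=
  (Δ.isRelLowerSet_faces h).2 hG hne

/-- A minimal nonface: a nonempty set of vertices that is not a face although all of its nonempty
proper subsets are. -/
def IsMinNonface (Δ : AbstractSimplicialComplex V) (F : Finset V) : Prop :=
  F.Nonempty ∧ F ∉ Δ.faces ∧ ∀ G ⊂ F, G.Nonempty → G ∈ Δ.faces

/-- Any two distinct minimal nonfaces are disjoint: the combinatorial form of being a complete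
intersection complex. -/
def HasDisjointNonfaces (Δ : AbstractSimplicialComplex V) : Prop :=
  ∀ F G, Δ.IsMinNonface F → Δ.IsMinNonface G → F = G ∨ Disjoint F G

theorem exists_isMinNonface_subset (hne : F.Nonempty) (hF : F ∉ Δ.faces) :
    ∃ G ⊆ F, Δ.IsMinNonface G := by
  induction F using Finset.strongInduction with
  | H F ih =>
    by_cases h : ∀ G ⊂ F, G.Nonempty → G ∈ Δ.faces
    · exact ⟨F, subset_rfl, hne, hF, h⟩
    · push Not at h
      obtain ⟨G, hGF, hG, hG'⟩ := h
      obtain ⟨H, hHG, hH⟩ := ih G hGF hG hG'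
      exact ⟨H, hHG.trans hGF.subset, hH⟩

theorem IsMinNonface.eq_of_subset (hF : Δ.IsMinNonface F) (hG : Δ.IsMinNonface G) (h : F ⊆ G) :
    F = G := by
  by_contra hne
  exact hF.2.1 (hG.2.2 F (Finset.ssubset_iff_subset_ne.2 ⟨h, hne⟩) hF.1)

theorem IsMinNonface.two_le_card (hF : Δ.IsMinNonface F) : 2 ≤ F.card := by
  by_contra h
  have h1 : F.card = 1 := by have := hF.1.card_pos; omega
  obtain ⟨v, rfl⟩ := Finset.card_eq_one.1 h1
  exact hF.2.1 (Δ.singleton_mem v)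

end Nonfaces

variable [DecidableEq V] {Δ : AbstractSimplicialComplex V} {F G M N : Finset V} {a b c u v w : V}

/-- A minimal nonface of the link of `v`, regarded as a set of vertices of `Δ`. -/
def IsMinNonfaceAt (Δ : AbstractSimplicialComplex V) (v : V) (M : Finset V) : Prop :=
  M.Nonempty ∧ v ∉ M ∧ (∀ w ∈ M, ({v, w} : Finset V) ∈ Δ.faces) ∧ insert v M ∉ Δ.faces ∧
    ∀ G ⊂ M, insert v G ∈ Δ.faces

/-- In the link of every vertex, distinct minimal nonfaces are disjoint: the combinatorial form of
being a locally complete intersection complex. -/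
def HasLocallyDisjointNonfaces (Δ : AbstractSimplicialComplex V) : Prop :=
  ∀ v M N, Δ.IsMinNonfaceAt v M → Δ.IsMinNonfaceAt v N → M = N ∨ Disjoint M N

theorem isMinNonface_link_iff (v : V) (G : Finset (Δ.LinkVertex v)) :
    (Δ.link v).IsMinNonface G ↔
      Δ.IsMinNonfaceAt v (G.map (Function.Embedding.subtype _)) := by
  have hv (H : Finset (Δ.LinkVertex v)) : v ∉ H.map (Function.Embedding.subtype _) := by
    simp only [Finset.mem_map, Function.Embedding.subtype_apply, not_exists, not_and]
    exact fun w _ h => w.2.1 h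
  constructor
  · rintro ⟨hne, hG, hmin⟩
    refine ⟨by simpa using hne, hv G, ?_, fun h => hG ⟨hne, h⟩, fun H hH => ?_⟩
    · simp only [Finset.mem_map, Function.Embedding.subtype_apply, forall_exists_index, and_imp]
      rintro w x _ rfl
      rw [Finset.pair_comm]
      exact x.2.2
    · rcases H.eq_empty_or_nonempty with rfl | hHne
      · simpa using Δ.singleton_mem v
      obtain ⟨H', hH', rfl⟩ := Finset.subset_map_iff.1 hH.subset
      refine (hmin H' ?_ (by simpa using hHne)).2
      exact Finset.map_ssubset_map.1 hH
  · rintro ⟨hne, -, -, hG, hmin⟩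
    exact ⟨by simpa using hne, fun h => hG h.2, fun H hH hHne =>
      ⟨hHne, hmin _ (Finset.map_ssubset_map.2 hH)⟩⟩

theorem hasLocallyDisjointNonfaces_iff :
    Δ.HasLocallyDisjointNonfaces ↔ ∀ v, (Δ.link v).HasDisjointNonfaces := by
  constructor
  · intro h v F G hF hG
    rw [isMinNonface_link_iff] at hF hG
    simpa using h v _ _ hF hG
  · intro h v M N hM hN
    have key (M : Finset V) (hM : Δ.IsMinNonfaceAt v M) :
        ∃ M' : Finset (Δ.LinkVertex v), M = M'.map (Function.Embedding.subtype _) := by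
      classical
      refine ⟨M.subtype _, (Finset.subtype_map_of_mem fun w hw => ⟨?_, ?_⟩).symm⟩
      · rintro rfl
        exact hM.2.1 hw
      · rw [Finset.pair_comm]
        exact hM.2.2.1 w hw
    obtain ⟨M', rfl⟩ := key M hM
    obtain ⟨N', rfl⟩ := key N hN
    simpa using h v M' N' ((isMinNonface_link_iff _ _).2 hM) ((isMinNonface_link_iff _ _).2 hN)

theorem graph_adj_of_mem_faces (hF : F ∈ Δ.faces) (hu : u ∈ F) (hv : v ∈ F) (h : u ≠ v) :
    Δ.graph.Adj u v :=
  ⟨h, mem_faces_of_subset hF (by grind) (by simp)⟩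

theorem isMinNonface_pair (hab : a ≠ b) (h : ¬ Δ.graph.Adj a b) : Δ.IsMinNonface {a, b} := by
  refine ⟨by simp, fun h' => h ⟨hab, h'⟩, fun G hG hne => ?_⟩
  have hc : G.card = 1 := by
    have := Finset.card_lt_card hG
    rw [Finset.card_pair hab] at this
    have := hne.card_pos
    omega
  obtain ⟨x, rfl⟩ := Finset.card_eq_one.1 hc
  exact Δ.singleton_mem x

theorem exists_isMinNonfaceAt_subset (hne : M.Nonempty) (hv : v ∉ M)
    (hadj : ∀ w ∈ M, Δ.graph.Adj v w) (hM : insert v M ∉ Δ.faces) :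
    ∃ N ⊆ M, Δ.IsMinNonfaceAt v N := by
  induction M using Finset.strongInduction with
  | H M ih =>
    by_cases h : ∀ G ⊂ M, insert v G ∈ Δ.faces
    · exact ⟨M, subset_rfl, hne, hv, fun w hw => (hadj w hw).2, hM, h⟩
    · push Not at h
      obtain ⟨G, hGM, hG⟩ := h
      rcases G.eq_empty_or_nonempty with rfl | hGne
      · exact absurd (Δ.singleton_mem v) (by simpa using hG)
      obtain ⟨H, hHG, hH⟩ := ih G hGM hGne (fun h => hv (hGM.subset h))
        (fun w hw => hadj w (hGM.subset hw)) hG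
      exact ⟨H, hHG.trans hGM.subset, hH⟩

theorem IsMinNonface.isMinNonfaceAt_erase (hF : Δ.IsMinNonface F) (hc : 3 ≤ F.card) (hv : v ∈ F) :
    Δ.IsMinNonfaceAt v (F.erase v) := by
  refine ⟨?_, by simp, fun w hw => ?_, ?_, fun G hG => ?_⟩
  · rw [← Finset.card_pos, Finset.card_erase_of_mem hv]
    omega
  · refine hF.2.2 _ (Finset.ssubset_iff_subset_ne.2 ⟨?_, ?_⟩) (by simp)
    · have := Finset.mem_of_mem_erase hw
      grind
    · rintro rfl
      have := Finset.card_le_two (a := v) (b := w)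
      omega
  · rw [Finset.insert_erase hv]
    exact hF.2.1
  · refine hF.2.2 _ (Finset.ssubset_iff_subset_ne.2 ⟨?_, ?_⟩) (by simp)
    · have := hG.subset
      grind
    · rintro rfl
      have := Finset.card_lt_card hG
      have h1 : v ∉ G := fun h => by simpa using hG.subset h
      simp [h1] at this

theorem isMinNonfaceAt_pair (hav : Δ.graph.Adj v a) (hbv : Δ.graph.Adj v b) (hab : a ≠ b)
    (h : ({v, a, b} : Finset V) ∉ Δ.faces) : Δ.IsMinNonfaceAt v {a, b} := by
  refine ⟨by simp, ?_, ?_, h, fun G hG => ?_⟩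
  · simp [hav.1, hbv.1]
  · simp [hav.2, hbv.2]
  · have hc : G.card ≤ 1 := by
      have := Finset.card_lt_card hG
      rw [Finset.card_pair hab] at this
      omega
    rcases G.eq_empty_or_nonempty with rfl | hne
    · simpa using Δ.singleton_mem v
    · obtain ⟨x, rfl⟩ := Finset.card_eq_one.1 (le_antisymm hc hne.card_pos)
      have : x ∈ ({a, b} : Finset V) := hG.subset (by simp)
      simp only [Finset.mem_insert, Finset.mem_singleton] at this
      rcases this with rfl | rfl
      · exact hav.2
      · exact hbv.2

theorem isMinNonfaceAt_pair_of_not_adj (hav : Δ.graph.Adj v a) (hbv : Δ.graph.Adj v b)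
    (hab : a ≠ b) (h : ¬ Δ.graph.Adj a b) : Δ.IsMinNonfaceAt v {a, b} :=
  isMinNonfaceAt_pair hav hbv hab fun h' =>
    h (graph_adj_of_mem_faces h' (by simp) (by simp) hab)

namespace HasLocallyDisjointNonfaces

theorem eq_of_mem (h : Δ.HasLocallyDisjointNonfaces) (hM : Δ.IsMinNonfaceAt v M)
    (hN : Δ.IsMinNonfaceAt v N) (haM : a ∈ M) (haN : a ∈ N) : M = N :=
  (h v M N hM hN).resolve_right fun hd => Finset.disjoint_left.1 hd haM haN

theorem mem_pair_of_pair (h : Δ.HasLocallyDisjointNonfaces) (hM : Δ.IsMinNonfaceAt v {a, b})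
    (hN : Δ.IsMinNonfaceAt v {a, c}) : b = c := by
  have h1 := h.eq_of_mem (a := a) hM hN (by simp) (by simp)
  have hb : b ∈ ({a, c} : Finset V) := h1 ▸ by simp
  have hc : c ∈ ({a, b} : Finset V) := h1 ▸ by simp
  grind

/-! ### Connected complexes that are locally complete intersections -/

/-- Two distinct minimal nonfaces with at least three elements that share a vertex `v` would meet
only in `v`. Looking at the links of a vertex `u ≠ v` of the first and of a vertex `w ≠ v` of the second
rules this out. -/
theorem eq_of_three_le_card (h : Δ.HasLocallyDisjointNonfaces) (hF : Δ.IsMinNonface F)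
    (hG : Δ.IsMinNonface G) (hFc : 3 ≤ F.card) (hGc : 3 ≤ G.card) (hvF : v ∈ F) (hvG : v ∈ G) :
    F = G := by
  have hM := hF.isMinNonfaceAt_erase hFc hvF
  have hN := hG.isMinNonfaceAt_erase hGc hvG
  rcases h v _ _ hM hN with heq | hd
  · rw [← Finset.insert_erase hvF, heq, Finset.insert_erase hvG]
  exfalso
  have hd' (x : V) (hx : x ≠ v) (hxF : x ∈ F) (hxG : x ∈ G) : False :=
    Finset.disjoint_left.1 hd (Finset.mem_erase.2 ⟨hx, hxF⟩) (Finset.mem_erase.2 ⟨hx, hxG⟩)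
  obtain ⟨u, hu⟩ := hM.1
  obtain ⟨w, hw⟩ := hN.1
  obtain ⟨huv, huF⟩ := Finset.mem_erase.1 hu
  obtain ⟨hwv, hwG⟩ := Finset.mem_erase.1 hw
  have huG : u ∉ G := fun hx => hd' u huv huF hx
  have huw : u ≠ w := fun hx => huG (hx ▸ hwG)
  have hGv : G.erase v ∈ Δ.faces := hG.2.2 _ (Finset.erase_ssubset hvG) hN.1
  have avu : Δ.graph.Adj v u := ⟨huv.symm, hM.2.2.1 u hu⟩
  have avw : Δ.graph.Adj v w := ⟨hwv.symm, hN.2.2.1 w hw⟩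
  have hvuw : ({v, u, w} : Finset V) ∈ Δ.faces := by
    by_contra hno
    have h1 := h.eq_of_mem hM (isMinNonfaceAt_pair avu avw huw hno) hu (by simp)
    have : w ∈ F.erase v := h1 ▸ by simp
    exact hd' w hwv (Finset.mem_of_mem_erase this) hwG
  have auw : Δ.graph.Adj w u := graph_adj_of_mem_faces hvuw (by simp) (by simp) huw.symm
  have hface : insert u (G.erase v) ∈ Δ.faces := by
    by_contra hno
    have hins : insert w ((insert u (G.erase v)).erase w) = insert u (G.erase v) :=
      Finset.insert_erase (by simp [hw])
    obtain ⟨M', hM', hM'at⟩ := exists_isMinNonfaceAt_subset (Δ := Δ) (v := w)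
      (M := (insert u (G.erase v)).erase w) ⟨u, by simp [huw]⟩ (by simp)
      (fun x hx => by
        obtain ⟨hxw, hx⟩ := Finset.mem_erase.1 hx
        rcases Finset.mem_insert.1 hx with rfl | hx
        · exact auw
        · exact graph_adj_of_mem_faces hGv hw hx hxw.symm) (by rwa [hins])
    have hGw := hG.isMinNonfaceAt_erase hGc hwG
    have hvM' : v ∉ M' := fun hx => by
      have := hM' hx
      simp [huv.symm] at this
    have hsub : M' ⊆ {u} := by
      intro x hx
      have hx' := hM' hx
      by_contra hxu
      have hxG : x ∈ G.erase w := by grind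
      exact hvM' (h.eq_of_mem hM'at hGw hx hxG ▸ by simp [hvG, hwv.symm])
    rcases Finset.subset_singleton_iff.1 hsub with rfl | rfl
    · exact Finset.not_nonempty_empty hM'at.1
    · exact hM'at.2.2.2.1 auw.2
  obtain ⟨G', hG', hG'at⟩ := exists_isMinNonfaceAt_subset (Δ := Δ) (v := u) (M := G) hG.1 huG
    (fun x hx => by
      by_cases hxv : x = v
      · exact hxv ▸ avu.symm
      · exact graph_adj_of_mem_faces hface (by simp) (by simp [hx, hxv])
          fun hux => huG (hux ▸ hx))
    (fun hno => hG.2.1 (mem_faces_of_subset hno (Finset.subset_insert _ _) hG.1))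
  by_cases hvG' : v ∈ G'
  · have heq := h.eq_of_mem hG'at (hF.isMinNonfaceAt_erase hFc huF) hvG'
      (by simp [hvF, huv.symm])
    have : 0 < ((F.erase u).erase v).card := by
      rw [Finset.card_erase_of_mem (by simp [hvF, huv.symm]), Finset.card_erase_of_mem huF]
      omega
    obtain ⟨x, hx⟩ := Finset.card_pos.1 this
    exact hd' x (by grind) (by grind) (hG' (heq ▸ Finset.mem_of_mem_erase hx))
  · exact hG'at.2.2.2.1 (mem_faces_of_subset hface
      (Finset.insert_subset_insert _ fun x hx => by grind) (by simp))

/-- If `w` is adjacent to `u` but not to `v`, then `{v, w}` and the rest of `G` are minimal nonfaces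
of the link of `u` that meet in `v`. -/
theorem not_adj_of_three_le_card (h : Δ.HasLocallyDisjointNonfaces) (hG : Δ.IsMinNonface G)
    (hGc : 3 ≤ G.card) (hv : v ∈ G) (hw : w ∉ G) (hvw : ¬ Δ.graph.Adj w v) :
    ∀ u ∈ G, ¬ Δ.graph.Adj w u := by
  intro u hu hwu
  have huv : u ≠ v := fun huv => hvw (huv ▸ hwu)
  have hGu := hG.isMinNonfaceAt_erase hGc hu
  have hvu : v ∈ G.erase u := by simp [hv, huv.symm]
  have hwv : v ≠ w := fun hx => hw (hx ▸ hv)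
  have h1 := h.eq_of_mem hGu (isMinNonfaceAt_pair_of_not_adj (v := u) (a := v) (b := w)
    ⟨huv, hGu.2.2.1 v hvu⟩ hwu.symm hwv fun hx => hvw hx.symm) hvu (by simp)
  exact hw (Finset.mem_of_mem_erase (a := u) (h1 ▸ by simp))

/-- Otherwise connectivity yields adjacent vertices `a` and `b` such that `a` is adjacent to no and
`b` to every member of `G`; the pairs of `a` and a member of `G` are then minimal nonfaces of the
link of `b` that meet in `a`. -/
theorem adj_of_three_le_card (h : Δ.HasLocallyDisjointNonfaces) (hc : Δ.IsConnected)
    (hG : Δ.IsMinNonface G) (hGc : 3 ≤ G.card) (hv : v ∈ G) (hw : w ∉ G) : Δ.graph.Adj w v := by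
  by_contra hvw
  let S : Set V := {x | x ∉ G ∧ ∀ u ∈ G, ¬ Δ.graph.Adj x u}
  have hwS : w ∈ S := ⟨hw, h.not_adj_of_three_le_card hG hGc hv hw hvw⟩
  obtain ⟨p⟩ := hc.preconnected w v
  obtain ⟨d, -, hd1, hd2⟩ := p.exists_boundary_dart S hwS (fun hx => hx.1 hv)
  obtain ⟨⟨a, b⟩, hab⟩ := d
  dsimp only at hd1 hd2 hab
  have hbG : b ∉ G := fun hb => hd1.2 b hb hab
  have hball : ∀ g ∈ G, Δ.graph.Adj b g := by
    intro g hg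
    by_contra hno
    exact hd2 ⟨hbG, h.not_adj_of_three_le_card hG hGc hg hbG hno⟩
  obtain ⟨g₁, hg₁, g₂, hg₂, hne⟩ := Finset.one_lt_card.1 (show 1 < G.card by omega)
  have key (g : V) (hg : g ∈ G) : Δ.IsMinNonfaceAt b {a, g} :=
    isMinNonfaceAt_pair_of_not_adj hab.symm (hball g hg) (fun hx => hd1.1 (hx ▸ hg)) (hd1.2 g hg)
  exact hne (h.mem_pair_of_pair (key g₁ hg₁) (key g₂ hg₂))

/-- If some face has three vertices, then every vertex lies in such a face: a triangle at `a` gives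
one at every neighbour `b` of `a`, since otherwise `b` forms two minimal nonfaces of the link of `a`
with the other vertices of the triangle. -/
theorem exists_triangle (h : Δ.HasLocallyDisjointNonfaces) (hc : Δ.IsConnected)
    (hF : F ∈ Δ.faces) (hFc : 3 ≤ F.card) (v : V) :
    ∃ y z, y ≠ v ∧ z ≠ v ∧ y ≠ z ∧ ({v, y, z} : Finset V) ∈ Δ.faces := by
  let S : Set V := {v | ∃ y z, y ≠ v ∧ z ≠ v ∧ y ≠ z ∧ ({v, y, z} : Finset V) ∈ Δ.faces}
  obtain ⟨x, y, z, hxF, hyF, hzF, hxy, hxz, hyz⟩ := Finset.two_lt_card_iff.1 hFc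
  have hxS : x ∈ S := ⟨y, z, hxy.symm, hxz.symm, hyz,
    mem_faces_of_subset hF (by grind) (by simp)⟩
  by_contra hvS
  obtain ⟨p⟩ := hc.preconnected x v
  obtain ⟨⟨⟨a, b⟩, hab⟩, -, ⟨y, z, hya, hza, hyz, hf⟩, hd2⟩ := p.exists_boundary_dart S hxS hvS
  dsimp only at hd2 hab hya hza hf
  have key (y z : V) (hya : y ≠ a) (hza : z ≠ a) (hyz : y ≠ z)
      (hf : ({a, y, z} : Finset V) ∈ Δ.faces) : Δ.IsMinNonfaceAt a {b, y} := by
    have hby : b ≠ y := by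
      rintro rfl
      exact hd2 ⟨a, z, hab.1, hyz.symm, hza.symm, mem_faces_of_subset hf (by grind) (by simp)⟩
    refine isMinNonfaceAt_pair hab (graph_adj_of_mem_faces hf (by simp) (by simp) hya.symm) hby
      fun hno => ?_
    exact hd2 ⟨a, y, hab.1, hby.symm, hya.symm, mem_faces_of_subset hno (by grind) (by simp)⟩
  exact hyz (h.mem_pair_of_pair (key y z hya hza hyz hf)
    (key z y hza hya hyz.symm (mem_faces_of_subset hf (by grind) (by simp))))

theorem triangle_mem_faces (h : Δ.HasLocallyDisjointNonfaces) (hac : Δ.IsMinNonfaceAt b {a, c})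
    (hy : Δ.graph.Adj b w) (hyc : w ≠ c) (hya : w ≠ a) : ({b, w, a} : Finset V) ∈ Δ.faces := by
  by_contra hno
  have hab : Δ.graph.Adj b a := ⟨fun hx => hac.2.1 (by simp [hx]), hac.2.2.1 a (by simp)⟩
  refine hyc (h.mem_pair_of_pair (a := a) (v := b) ?_ hac)
  rw [Finset.pair_comm]
  exact isMinNonfaceAt_pair hy hab hya hno

theorem exists_third_vertex (h : Δ.HasLocallyDisjointNonfaces) (hc : Δ.IsConnected)
    (hF : F ∈ Δ.faces) (hFc : 3 ≤ F.card) (hac : Δ.IsMinNonfaceAt b {a, c}) :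
    ∃ y, Δ.graph.Adj b y ∧ y ≠ a ∧ y ≠ c ∧ ({b, y, a} : Finset V) ∈ Δ.faces ∧
      ({b, y, c} : Finset V) ∈ Δ.faces := by
  obtain ⟨y, z, hyb, hzb, hyz, hf⟩ := h.exists_triangle hc hF hFc b
  have : ∃ y, Δ.graph.Adj b y ∧ y ≠ a ∧ y ≠ c := by
    have ay : Δ.graph.Adj b y := graph_adj_of_mem_faces hf (by simp) (by simp) hyb.symm
    have az : Δ.graph.Adj b z := graph_adj_of_mem_faces hf (by simp) (by simp) hzb.symm
    by_contra hno
    push Not at hno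
    have h1 := hno y ay
    have h2 := hno z az
    refine hac.2.2.2.1 ?_
    convert hf using 1
    by_cases hy : y = a
    · by_cases hz : z = a
      · exact absurd (hy.trans hz.symm) hyz
      · rw [hy, h2 hz]
    · by_cases hz : z = a
      · rw [hz, h1 hy, Finset.pair_comm]
      · exact absurd ((h1 hy).trans (h2 hz).symm) hyz
  obtain ⟨y, hby, hya, hyc⟩ := this
  exact ⟨y, hby, hya, hyc, h.triangle_mem_faces hac hby hyc hya,
    h.triangle_mem_faces (by rwa [Finset.pair_comm] at hac) hby hya hyc⟩

/-- The graph has diameter at most two. For a path `x, b, c, e` without shortcuts, a further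
neighbour of `b` from a triangle turns out to be adjacent to `x`, `c` and `e`. -/
theorem exists_common_neighbor (h : Δ.HasLocallyDisjointNonfaces) (hc : Δ.IsConnected)
    (hF : F ∈ Δ.faces) (hFc : 3 ≤ F.card) {x y : V} (hxy : x ≠ y) (hadj : ¬ Δ.graph.Adj x y) :
    ∃ b, Δ.graph.Adj b x ∧ Δ.graph.Adj b y := by
  let S : Set V := {y | x = y ∨ Δ.graph.Adj x y ∨ ∃ b, Δ.graph.Adj b x ∧ Δ.graph.Adj b y}
  suffices hy : y ∈ S from (hy.resolve_left hxy).resolve_left hadj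
  by_contra hyS
  obtain ⟨p⟩ := hc.preconnected x y
  obtain ⟨⟨⟨c, e⟩, hce⟩, -, hcS, heS⟩ := p.exists_boundary_dart S (Or.inl rfl) hyS
  dsimp only at hce hcS heS
  have hxe : x ≠ e := fun hx => heS (Or.inl hx)
  have nxe : ¬ Δ.graph.Adj x e := fun hx => heS (Or.inr (Or.inl hx))
  have hno (b : V) (h1 : Δ.graph.Adj b x) (h2 : Δ.graph.Adj b e) : False :=
    heS (Or.inr (Or.inr ⟨b, h1, h2⟩))
  have hxc : x ≠ c := by
    rintro rfl
    exact nxe hce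
  have nxc : ¬ Δ.graph.Adj x c := fun hx => hno c hx.symm hce
  obtain ⟨b, hbx, hbc⟩ := (hcS.resolve_left hxc).resolve_left nxc
  obtain ⟨y, hby, hyx, hyc, fyx, fyc⟩ := h.exists_third_vertex hc hF hFc
    (isMinNonfaceAt_pair_of_not_adj hbx hbc hxc nxc)
  have ayx : Δ.graph.Adj y x := graph_adj_of_mem_faces fyx (by simp) (by simp) hyx
  have ayc : Δ.graph.Adj y c := graph_adj_of_mem_faces fyc (by simp) (by simp) hyc
  have hbe : b ≠ e := by
    rintro rfl
    exact nxe hbx.symm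
  have hye : y ≠ e := by
    rintro rfl
    exact nxe ayx.symm
  have hat : Δ.IsMinNonfaceAt c {e, b} := by
    rw [Finset.pair_comm]
    exact isMinNonfaceAt_pair_of_not_adj hbc.symm hce hbe fun hx => hno b hbx hx
  have hf := h.triangle_mem_faces hat ayc.symm hby.symm.1 hye
  exact hno y ayx (graph_adj_of_mem_faces hf (by simp) (by simp) hye)

/-- Suppose that `v` were joined neither to `u` nor to `w`. A vertex adjacent to all of `u`, `v`, `w`
is excluded by its link. Common neighbours `b` of `u, v` and `c` of `v, w` are then not adjacent, and
the link of `v` has a further vertex, which turns out to be adjacent to `u`, `v` and `w`. -/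
theorem eq_of_not_adj (h : Δ.HasLocallyDisjointNonfaces) (hc : Δ.IsConnected)
    (hF : F ∈ Δ.faces) (hFc : 3 ≤ F.card) (hvu : v ≠ u) (hvw : v ≠ w)
    (nvu : ¬ Δ.graph.Adj v u) (nvw : ¬ Δ.graph.Adj v w) : u = w := by
  by_contra huw
  have hno (b : V) (bv : Δ.graph.Adj b v) (bu : Δ.graph.Adj b u) (bw : Δ.graph.Adj b w) : False :=
    huw (h.mem_pair_of_pair (isMinNonfaceAt_pair_of_not_adj bv bu hvu nvu)
      (isMinNonfaceAt_pair_of_not_adj bv bw hvw nvw))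
  obtain ⟨b, bv, bu⟩ := h.exists_common_neighbor hc hF hFc hvu nvu
  obtain ⟨c, cv, cw⟩ := h.exists_common_neighbor hc hF hFc hvw nvw
  have nbw : ¬ Δ.graph.Adj b w := fun hx => hno b bv bu hx
  have ncu : ¬ Δ.graph.Adj c u := fun hx => hno c cv hx cw
  have hbc : b ≠ c := by
    rintro rfl
    exact nbw cw
  have hatb := isMinNonfaceAt_pair_of_not_adj bv bu hvu nvu
  have hatc := isMinNonfaceAt_pair_of_not_adj cv cw hvw nvw
  have nbc : ¬ Δ.graph.Adj b c := by
    intro hx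
    have hcu : u ≠ c := by
      rintro rfl
      exact nvu cv.symm
    have h1 := isMinNonfaceAt_pair_of_not_adj bu hx hcu fun hx => ncu hx.symm
    rw [Finset.pair_comm] at hatb
    exact cv.1 (h.mem_pair_of_pair h1 hatb)
  obtain ⟨y, hvy, hyb, hyc, fyb, fyc⟩ := h.exists_third_vertex hc hF hFc
    (isMinNonfaceAt_pair_of_not_adj bv.symm cv.symm hbc nbc)
  have ayb : Δ.graph.Adj b y := graph_adj_of_mem_faces fyb (by simp) (by simp) hyb.symm
  have ayc : Δ.graph.Adj c y := graph_adj_of_mem_faces fyc (by simp) (by simp) hyc.symm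
  have hyu : y ≠ u := by
    rintro rfl
    exact nvu hvy
  have hyw : y ≠ w := by
    rintro rfl
    exact nvw hvy
  rw [Finset.pair_comm] at hatb hatc
  have f1 := h.triangle_mem_faces hatb ayb hvy.symm.1 hyu
  have f2 := h.triangle_mem_faces hatc ayc hvy.symm.1 hyw
  exact hno y hvy.symm (graph_adj_of_mem_faces f1 (by simp) (by simp) hyu)
    (graph_adj_of_mem_faces f2 (by simp) (by simp) hyw)

theorem hasDisjointNonfaces (h : Δ.HasLocallyDisjointNonfaces) (hc : Δ.IsConnected)
    (hF : F ∈ Δ.faces) (hFc : 3 ≤ F.card) : Δ.HasDisjointNonfaces := by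
  have small (A B : Finset V) (hA : Δ.IsMinNonface A) (hB : Δ.IsMinNonface B) (hAc : A.card = 2)
      (hd : ¬ Disjoint A B) : A = B := by
    obtain ⟨v, hvA, hvB⟩ := Finset.not_disjoint_iff.1 hd
    obtain ⟨u, hu⟩ : ∃ u, A.erase v = {u} :=
      Finset.card_eq_one.1 (by rw [Finset.card_erase_of_mem hvA, hAc])
    have hAeq : A = {v, u} := by rw [← Finset.insert_erase hvA, hu]
    have huv : v ≠ u := by
      have : u ∈ A.erase v := by simp [hu]
      exact (Finset.ne_of_mem_erase this).symm
    have nvu : ¬ Δ.graph.Adj v u := fun hx => hA.2.1 (hAeq ▸ hx.2)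
    by_cases huB : u ∈ B
    · refine hA.eq_of_subset hB ?_
      rw [hAeq]
      grind
    · rcases hB.two_le_card.lt_or_eq with hBc | hBc
      · exact absurd (h.adj_of_three_le_card hc hB hBc hvB huB).symm nvu
      · obtain ⟨w, hw⟩ : ∃ w, B.erase v = {w} :=
          Finset.card_eq_one.1 (by rw [Finset.card_erase_of_mem hvB, ← hBc])
        have hBeq : B = {v, w} := by rw [← Finset.insert_erase hvB, hw]
        have hwv : v ≠ w := by
          have : w ∈ B.erase v := by simp [hw]
          exact (Finset.ne_of_mem_erase this).symm
        have nvw : ¬ Δ.graph.Adj v w := fun hx => hB.2.1 (hBeq ▸ hx.2)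
        exact absurd (h.eq_of_not_adj hc hF hFc huv hwv nvu nvw ▸ by simp [hBeq]) huB
  intro A B hA hB
  by_cases hd : Disjoint A B
  · exact Or.inr hd
  left
  rcases hA.two_le_card.lt_or_eq with hAc | hAc
  · rcases hB.two_le_card.lt_or_eq with hBc | hBc
    · obtain ⟨v, hvA, hvB⟩ := Finset.not_disjoint_iff.1 hd
      exact h.eq_of_three_le_card hA hB hAc hBc hvA hvB
    · exact (small B A hB hA hBc.symm fun hx => hd hx.symm).symm
  · exact small A B hA hB hAc.symm hd

end HasLocallyDisjointNonfaces

end AbstractSimplicialComplex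

namespace AbstractSimplicialComplex

/-! ### Gons, pointed paths and points -/

section Facets

variable {V : Type*} [Finite V] {Δ : AbstractSimplicialComplex V} {F : Finset V}

theorem exists_isFacet_superset (hF : F ∈ Δ.faces) : ∃ G, Δ.IsFacet G ∧ F ⊆ G := by
  obtain ⟨G, hFG, hG⟩ := (Set.toFinite Δ.faces).exists_le_maximal hF
  exact ⟨G, ⟨hG.1, fun H hH hGH => subset_antisymm hGH (hG.2 hH hGH)⟩, hFG⟩

theorem bddAbove_card_faces (Δ : AbstractSimplicialComplex V) :
    BddAbove {n : ℕ | ∃ F ∈ Δ.faces, F.card = n} := by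
  have := Fintype.ofFinite V
  refine ⟨Fintype.card V, ?_⟩
  rintro n ⟨F, -, rfl⟩
  exact F.card_le_univ

theorem le_dim_iff {n : ℕ} : (n : ℤ) ≤ Δ.dim ↔ ∃ F ∈ Δ.faces, n + 1 ≤ F.card := by
  constructor
  · intro h
    have hne : {n : ℕ | ∃ F ∈ Δ.faces, F.card = n}.Nonempty := by
      by_contra hno
      rw [Set.not_nonempty_iff_eq_empty] at hno
      rw [dim, hno, csSup_empty] at h
      simp only [bot_eq_zero', Nat.cast_zero] at h
      omega
    obtain ⟨F, hF, hc⟩ := Nat.sSup_mem hne (bddAbove_card_faces Δ)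
    refine ⟨F, hF, ?_⟩
    rw [dim] at h
    omega
  · rintro ⟨F, hF, hc⟩
    have := le_csSup (bddAbove_card_faces Δ) ⟨F, hF, rfl⟩
    rw [dim]
    omega

end Facets

variable {V : Type*} [DecidableEq V] {Δ : AbstractSimplicialComplex V} {F G M N : Finset V}
  {a b c u v w : V}

theorem HasDisjointNonfaces.hasLocallyDisjointNonfaces (h : Δ.HasDisjointNonfaces) :
    Δ.HasLocallyDisjointNonfaces := by
  have key (v : V) (M : Finset V) (hM : Δ.IsMinNonfaceAt v M) :
      ∃ A, Δ.IsMinNonface A ∧ M = A.erase v := by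
    obtain ⟨A, hAM, hA⟩ := exists_isMinNonface_subset (Δ := Δ) (Finset.insert_nonempty v M)
      hM.2.2.2.1
    refine ⟨A, hA, subset_antisymm (fun w hw => ?_) fun w hw => ?_⟩
    · refine Finset.mem_erase.2 ⟨fun hx => hM.2.1 (hx ▸ hw), ?_⟩
      by_contra hwA
      refine hA.2.1 (mem_faces_of_subset (hM.2.2.2.2 _ (Finset.erase_ssubset hw)) ?_ hA.1)
      grind
    · grind
  intro v M N hM hN
  obtain ⟨A, hA, rfl⟩ := key v M hM
  obtain ⟨B, hB, rfl⟩ := key v N hN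
  rcases h A B hA hB with rfl | hd
  · exact Or.inl rfl
  · exact Or.inr (hd.mono (Finset.erase_subset _ _) (Finset.erase_subset _ _))

/-- Every vertex has at most two neighbours. -/
def HasDegreeLeTwo (Δ : AbstractSimplicialComplex V) : Prop :=
  ∀ v a b c, Δ.graph.Adj v a → Δ.graph.Adj v b → Δ.graph.Adj v c → a = b ∨ a = c ∨ b = c

theorem IsMinNonfaceAt.exists_ne (hM : Δ.IsMinNonfaceAt v M) (ha : a ∈ M) : ∃ b ∈ M, b ≠ a := by
  by_contra! h
  have : M = {a} := Finset.eq_singleton_iff_unique_mem.2 ⟨ha, h⟩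
  subst this
  exact hM.2.2.2.1 (hM.2.2.1 a ha)

theorem HasDegreeLeTwo.hasLocallyDisjointNonfaces (h : Δ.HasDegreeLeTwo) :
    Δ.HasLocallyDisjointNonfaces := by
  have adj (v : V) (M : Finset V) (hM : Δ.IsMinNonfaceAt v M) (w : V) (hw : w ∈ M) :
      Δ.graph.Adj v w := ⟨fun hx => hM.2.1 (hx ▸ hw), hM.2.2.1 w hw⟩
  intro v M N hM hN
  by_cases hd : Disjoint M N
  · exact Or.inr hd
  left
  obtain ⟨x, hxM, hxN⟩ := Finset.not_disjoint_iff.1 hd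
  by_contra hne
  have hNM : ¬ N ⊆ M := fun hs =>
    hN.2.2.2.1 (hM.2.2.2.2 N (Finset.ssubset_iff_subset_ne.2 ⟨hs, Ne.symm hne⟩))
  obtain ⟨z, hzN, hzM⟩ := Finset.not_subset.1 hNM
  obtain ⟨y, hyM, hyx⟩ := hM.exists_ne hxM
  rcases h v x y z (adj v M hM x hxM) (adj v M hM y hyM) (adj v N hN z hzN) with rfl | rfl | rfl
  · exact hyx rfl
  · exact hzM hxM
  · exact hzM hyM

theorem HasLocallyDisjointNonfaces.hasDegreeLeTwo (h : Δ.HasLocallyDisjointNonfaces)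
    (h3 : ∀ F ∈ Δ.faces, F.card < 3) : Δ.HasDegreeLeTwo := by
  intro v a b c ha hb hc
  by_contra! hne
  have key (x y : V) (hx : Δ.graph.Adj v x) (hy : Δ.graph.Adj v y) (hxy : x ≠ y) :
      Δ.IsMinNonfaceAt v {x, y} := by
    refine isMinNonfaceAt_pair hx hy hxy fun hf => ?_
    have := h3 _ hf
    rw [Finset.card_eq_three.2 ⟨v, x, y, hx.1, hy.1, hxy, rfl⟩] at this
    omega
  exact hne.2.2 (h.mem_pair_of_pair (key a b ha hb hne.1) (key a c ha hc hne.2.1))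

section Relation

variable {m : ℕ} {e : Fin m ≃ V} {R : Fin m → Fin m → Prop}

theorem hasDegreeLeTwo_of_isFacet_iff [Finite V]
    (hR : ∀ i j k, R i j → R i k → j = k) (hR' : ∀ i j k, R i k → R j k → i = j)
    (hF : ∀ F, Δ.IsFacet F ↔ ∃ i j, R i j ∧ F = {e i, e j}) : Δ.HasDegreeLeTwo := by
  have key (v w : V) (h : Δ.graph.Adj v w) :
      R (e.symm v) (e.symm w) ∨ R (e.symm w) (e.symm v) := by
    obtain ⟨G, hG, hs⟩ := exists_isFacet_superset h.2
    obtain ⟨i, j, hij, rfl⟩ := (hF G).1 hG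
    have h1 : v ∈ ({e i, e j} : Finset V) := hs (by simp)
    have h2 : w ∈ ({e i, e j} : Finset V) := hs (by simp)
    simp only [Finset.mem_insert, Finset.mem_singleton] at h1 h2
    rcases h1 with rfl | rfl <;> rcases h2 with rfl | rfl
    · exact absurd rfl h.1
    · left; simpa using hij
    · right; simpa using hij
    · exact absurd rfl h.1
  intro v a b c ha hb hc
  have inj {x y : V} (h : e.symm x = e.symm y) : x = y := e.symm.injective h
  rcases key v a ha with ha | ha <;> rcases key v b hb with hb | hb <;>
    rcases key v c hc with hc | hc
  · exact Or.inl (inj (hR _ _ _ ha hb))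
  · exact Or.inl (inj (hR _ _ _ ha hb))
  · exact Or.inr (Or.inl (inj (hR _ _ _ ha hc)))
  · exact Or.inr (Or.inr (inj (hR' _ _ _ hb hc)))
  · exact Or.inr (Or.inr (inj (hR _ _ _ hb hc)))
  · exact Or.inr (Or.inl (inj (hR' _ _ _ ha hc)))
  · exact Or.inl (inj (hR' _ _ _ ha hb))
  · exact Or.inl (inj (hR' _ _ _ ha hb))

theorem isConnected_of_isFacet_iff (hm : 0 < m)
    (hR : ∀ i j : Fin m, j.val = i.val + 1 → R i j)
    (hF : ∀ F, Δ.IsFacet F ↔ ∃ i j, R i j ∧ F = {e i, e j}) : Δ.IsConnected := by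
  have adj (i : ℕ) (hi : i + 1 < m) : Δ.graph.Adj (e ⟨i, by omega⟩) (e ⟨i + 1, hi⟩) := by
    refine ⟨fun hx => ?_, ((hF _).2 ⟨⟨i, by omega⟩, ⟨i + 1, hi⟩, hR _ _ rfl, rfl⟩).1⟩
    have := congrArg Fin.val (e.injective hx)
    simp at this
  have reach (i : ℕ) (hi : i < m) : Δ.graph.Reachable (e ⟨0, hm⟩) (e ⟨i, hi⟩) := by
    induction i with
    | zero => rfl
    | succ i ih => exact (ih (by omega)).trans (adj i hi).reachable
  have reach' (v : V) : Δ.graph.Reachable (e ⟨0, hm⟩) v := by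
    obtain ⟨i, rfl⟩ := e.surjective v
    exact reach i i.2
  exact (SimpleGraph.connected_iff_exists_forall_reachable _).2 ⟨_, reach'⟩

end Relation

section Kinds

variable {m : ℕ}

theorem IsGon.hasDegreeLeTwo [Finite V] (h : Δ.IsGon m) : Δ.HasDegreeLeTwo := by
  obtain ⟨e, he⟩ := h
  refine hasDegreeLeTwo_of_isFacet_iff (fun i j k h1 h2 => ?_) (fun i j k h1 h2 => ?_) he <;>
    ext <;> omega

theorem IsGon.isConnected (hm : 0 < m) (h : Δ.IsGon m) : Δ.IsConnected := by
  obtain ⟨e, he⟩ := h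
  exact isConnected_of_isFacet_iff hm (fun i j hij => Or.inl hij) he

theorem IsPointedPath.hasDegreeLeTwo [Finite V] (h : Δ.IsPointedPath m) : Δ.HasDegreeLeTwo := by
  obtain ⟨e, he⟩ := h
  refine hasDegreeLeTwo_of_isFacet_iff (fun i j k h1 h2 => ?_) (fun i j k h1 h2 => ?_) he <;>
    ext <;> omega

theorem IsPointedPath.isConnected (hm : 0 < m) (h : Δ.IsPointedPath m) : Δ.IsConnected := by
  obtain ⟨e, he⟩ := h
  exact isConnected_of_isFacet_iff hm (fun i j hij => hij) he

theorem IsPoint.hasDegreeLeTwo (h : Δ.IsPoint) : Δ.HasDegreeLeTwo := by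
  have := (Nat.card_eq_one_iff_unique.1 h).1
  exact fun v a b c ha _ _ => absurd (Subsingleton.elim v a) ha.1

theorem IsPoint.isConnected (h : Δ.IsPoint) : Δ.IsConnected := by
  have := (Nat.card_eq_one_iff_unique.1 h).1
  have := (Nat.card_eq_one_iff_unique.1 h).2
  exact ⟨fun v w => Subsingleton.elim v w ▸ SimpleGraph.Reachable.refl _⟩

theorem HasDisjointNonfaces.isConnected (h : Δ.HasDisjointNonfaces) (hF : F ∈ Δ.faces)
    (hFc : 3 ≤ F.card) : Δ.IsConnected := by
  obtain ⟨x, hx⟩ := nonempty_of_mem_faces hF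
  have : Nonempty V := ⟨x⟩
  refine ⟨fun u v => ?_⟩
  by_cases huv : u = v
  · exact huv ▸ SimpleGraph.Reachable.refl _
  by_cases ha : Δ.graph.Adj u v
  · exact ha.reachable
  obtain ⟨w, hwF, hw⟩ : ∃ w ∈ F, w ∉ ({u, v} : Finset V) :=
    Finset.exists_mem_notMem_of_card_lt_card (by have := Finset.card_pair huv; omega)
  simp only [Finset.mem_insert, Finset.mem_singleton, not_or] at hw
  have key (u v : V) (huv : u ≠ v) (ha : ¬ Δ.graph.Adj u v) (h1 : w ≠ u) (h2 : w ≠ v) :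
      Δ.graph.Adj u w := by
    by_contra hno
    rcases h _ _ (isMinNonface_pair huv ha) (isMinNonface_pair h1.symm hno) with heq | hd
    · have : v ∈ ({u, w} : Finset V) := heq ▸ by simp
      grind
    · simp at hd
  exact (key u v huv ha hw.1 hw.2).reachable.trans
    (key v u (Ne.symm huv) (fun hx => ha hx.symm) hw.2 hw.1).symm.reachable

/-- In a connected graph with a second vertex the facets are the edges. -/
theorem isFacet_iff_of_card_lt_three (hc : Δ.IsConnected) [Nontrivial V]
    (h3 : ∀ F ∈ Δ.faces, F.card < 3) (F : Finset V) :
    Δ.IsFacet F ↔ ∃ u v, Δ.graph.Adj u v ∧ F = {u, v} := by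
  constructor
  · rintro ⟨hF, hmax⟩
    obtain ⟨x, hx⟩ := nonempty_of_mem_faces hF
    have : ∃ y ∈ F, y ≠ x := by
      by_contra! hno
      have hFx : F = {x} := Finset.eq_singleton_iff_unique_mem.2 ⟨hx, hno⟩
      obtain ⟨y, hy⟩ := hc.preconnected.exists_adj_of_nontrivial x
      have := hmax _ hy.2 (by simp [hFx])
      exact hy.1 (hno y (this ▸ by simp)).symm
    obtain ⟨y, hy, hyx⟩ := this
    refine ⟨x, y, graph_adj_of_mem_faces hF hx hy hyx.symm, ?_⟩
    refine (Finset.eq_of_subset_of_card_le (by grind) ?_).symm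
    rw [Finset.card_pair hyx.symm]
    have := h3 F hF
    omega
  · rintro ⟨u, v, huv, rfl⟩
    refine ⟨huv.2, fun G hG hs => Finset.eq_of_subset_of_card_le hs ?_⟩
    rw [Finset.card_pair huv.1]
    have := h3 G hG
    omega

end Kinds

/-- A path of maximal length in a connected graph whose vertices have at most two neighbours visits
all vertices, and besides its edges only its two ends can be joined. -/
theorem exists_hamiltonian_path [Finite V] (hc : Δ.IsConnected) (h2 : Δ.HasDegreeLeTwo) :
    ∃ (m : ℕ) (e : Fin m ≃ V), 0 < m ∧
      (∀ i j : Fin m, j.val = i.val + 1 → Δ.graph.Adj (e i) (e j)) ∧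
      (∀ i j : Fin m, i < j → Δ.graph.Adj (e i) (e j) →
        j.val = i.val + 1 ∨ (i.val = 0 ∧ j.val + 1 = m)) := by
  classical
  have := Fintype.ofFinite V
  let P : ℕ → Prop := fun m => ∃ p : ℕ → V, Set.InjOn p (Set.Iio m) ∧
    ∀ i, i + 1 < m → Δ.graph.Adj (p i) (p (i + 1))
  have hP1 : P 1 := ⟨fun _ => hc.nonempty.some, fun i hi j hj _ => by
    simp only [Set.mem_Iio, Nat.lt_one_iff] at hi hj
    omega, fun i hi => by omega⟩
  have hbound (m : ℕ) (hm : P m) : m ≤ Fintype.card V := by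
    obtain ⟨p, hp, -⟩ := hm
    have := Finset.card_le_card_of_injOn (s := Finset.range m) (t := Finset.univ) p (by simp)
      (by simpa using hp)
    simpa using this
  obtain ⟨m, hm, hmax⟩ : ∃ m, P m ∧ ∀ n, P n → n ≤ m := by
    have h1 : 1 ≤ Fintype.card V := hbound 1 hP1
    exact ⟨Nat.findGreatest P (Fintype.card V), Nat.findGreatest_spec h1 hP1,
      fun n hn => Nat.le_findGreatest (hbound n hn) hn⟩
  have hm1 : 1 ≤ m := hmax 1 hP1
  obtain ⟨p, hinj, hadj⟩ := hm
  have hinj' {i j : ℕ} (hi : i < m) (hj : j < m) (h : p i = p j) : i = j := hinj hi hj h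
  -- Neighbours of vertices of the path lie on the path, as it can be extended at neither end.
  have hclosed (i : ℕ) (hi : i < m) (x : V) (hx : Δ.graph.Adj (p i) x) : ∃ j < m, p j = x := by
    by_contra! hno
    by_cases hend : i + 1 = m
    · refine absurd (hmax (m + 1) ⟨fun j => if j = m then x else p j, ?_, ?_⟩) (by omega)
      · intro j hj k hk hjk
        simp only [Set.mem_Iio] at hj hk
        dsimp only at hjk
        split_ifs at hjk with h1 h2 h2
        · omega
        · exact absurd hjk.symm (hno k (by omega))
        · exact absurd hjk (hno j (by omega))
        · exact hinj' (by omega) (by omega) hjk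
      · intro j hj
        dsimp only
        rw [if_neg (by omega)]
        split_ifs with h1
        · have : j = i := by omega
          exact this ▸ hx
        · exact hadj j (by omega)
    by_cases hstart : i = 0
    · refine absurd (hmax (m + 1) ⟨fun j => if j = 0 then x else p (j - 1), ?_, ?_⟩) (by omega)
      · intro j hj k hk hjk
        simp only [Set.mem_Iio] at hj hk
        dsimp only at hjk
        split_ifs at hjk with h1 h2 h2
        · omega
        · exact absurd hjk.symm (hno (k - 1) (by omega))
        · exact absurd hjk (hno (j - 1) (by omega))
        · have := hinj' (by omega) (by omega) hjk
          omega
      · intro j hj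
        dsimp only
        rw [if_neg (Nat.succ_ne_zero j)]
        split_ifs with h1
        · subst h1
          exact hstart ▸ hx.symm
        · have := hadj (j - 1) (by omega)
          rwa [Nat.sub_add_cancel (by omega)] at this
    · have h3 := hadj (i - 1) (by omega)
      rw [Nat.sub_add_cancel (by omega)] at h3
      rcases h2 (p i) (p (i - 1)) (p (i + 1)) x h3.symm (hadj i (by omega)) hx with h | h | h
      · have := hinj' (by omega) (by omega) h
        omega
      · exact hno (i - 1) (by omega) h
      · exact hno (i + 1) (by omega) h
  have hsurj (x : V) : ∃ j < m, p j = x := by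
    by_contra hx
    obtain ⟨q⟩ := hc.preconnected (p 0) x
    obtain ⟨⟨⟨a, b⟩, hab⟩, -, ⟨j, hj, rfl⟩, hb⟩ :=
      q.exists_boundary_dart {x | ∃ j < m, p j = x} ⟨0, by omega, rfl⟩ hx
    exact hb (hclosed j hj b hab)
  have hbij : Function.Bijective (fun i : Fin m => p i) := by
    refine ⟨fun i j h => Fin.ext (hinj' i.2 j.2 h), fun x => ?_⟩
    obtain ⟨j, hj, rfl⟩ := hsurj x
    exact ⟨⟨j, hj⟩, rfl⟩
  refine ⟨m, Equiv.ofBijective _ hbij, hm1, ?_, ?_⟩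
  · rintro ⟨i, hi⟩ ⟨j, hj⟩ hij
    dsimp only at hij
    subst hij
    exact hadj i hj
  · rintro ⟨i, hi⟩ ⟨j, hj⟩ hij ha
    simp only [Fin.mk_lt_mk] at hij
    change Δ.graph.Adj (p i) (p j) at ha
    dsimp only
    by_cases hi0 : i = 0
    · subst hi0
      by_contra! hno
      have h1 := hno.2 rfl
      have h3 := hadj (j - 1) (by omega)
      rw [Nat.sub_add_cancel (by omega)] at h3
      rcases h2 (p j) (p (j - 1)) (p (j + 1)) (p 0) h3.symm (hadj j (by omega)) ha.symm
        with h | h | h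
      all_goals
        have := hinj' (by omega) (by omega) h
        omega
    · left
      have h3 := hadj (i - 1) (by omega)
      rw [Nat.sub_add_cancel (by omega)] at h3
      rcases h2 (p i) (p (i - 1)) (p (i + 1)) (p j) h3.symm (hadj i (by omega)) ha
        with h | h | h
      all_goals
        have := hinj' (by omega) (by omega) h
        omega

theorem isGon_or_isPointedPath_or_isPoint [Finite V] (hc : Δ.IsConnected) (h2 : Δ.HasDegreeLeTwo)
    (h3 : ∀ F ∈ Δ.faces, F.card < 3) :
    (∃ m, 3 ≤ m ∧ Δ.IsGon m) ∨ (∃ m, 2 ≤ m ∧ Δ.IsPointedPath m) ∨ Δ.IsPoint := by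
  obtain ⟨m, e, hm, hadj, hadj'⟩ := exists_hamiltonian_path hc h2
  have hcard : Nat.card V = m := by rw [← Nat.card_congr e, Nat.card_eq_fintype_card,
    Fintype.card_fin]
  rcases Nat.lt_or_ge m 2 with hm2 | hm2
  · right; right
    rw [IsPoint]
    omega
  have : Nontrivial V := by
    rw [← Finite.one_lt_card_iff_nontrivial]
    omega
  by_cases hcl : 3 ≤ m ∧ Δ.graph.Adj (e ⟨0, by omega⟩) (e ⟨m - 1, by omega⟩)
  · refine Or.inl ⟨m, hcl.1, e, fun F => ?_⟩
    rw [isFacet_iff_of_card_lt_three hc h3]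
    constructor
    · rintro ⟨u, v, huv, rfl⟩
      obtain ⟨i, rfl⟩ := e.surjective u
      obtain ⟨j, rfl⟩ := e.surjective v
      rcases lt_trichotomy i j with hij | hij | hij
      · rcases hadj' i j hij huv with h | h
        · exact ⟨i, j, Or.inl h, rfl⟩
        · exact ⟨j, i, Or.inr h.symm, Finset.pair_comm _ _⟩
      · exact absurd (congrArg e hij) huv.1
      · rcases hadj' j i hij huv.symm with h | h
        · exact ⟨j, i, Or.inl h, Finset.pair_comm _ _⟩
        · exact ⟨i, j, Or.inr h.symm, rfl⟩
    · rintro ⟨i, j, hij | ⟨hi, hj⟩, rfl⟩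
      · exact ⟨_, _, hadj i j hij, rfl⟩
      · have h1 : i = ⟨m - 1, by omega⟩ := Fin.ext (by dsimp only; omega)
        have h2 : j = ⟨0, by omega⟩ := Fin.ext hj
        exact ⟨e i, e j, h1 ▸ h2 ▸ hcl.2.symm, rfl⟩
  · refine Or.inr (Or.inl ⟨m, hm2, e, fun F => ?_⟩)
    rw [isFacet_iff_of_card_lt_three hc h3]
    have hcons (i j : Fin m) (hij : i < j) (ha : Δ.graph.Adj (e i) (e j)) :
        j.val = i.val + 1 := by
      rcases hadj' i j hij ha with h | ⟨h1, h2⟩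
      · exact h
      by_contra hno
      refine hcl ⟨by omega, ?_⟩
      have hi : i = ⟨0, by omega⟩ := Fin.ext h1
      have hj : j = ⟨m - 1, by omega⟩ := Fin.ext (by dsimp only; omega)
      exact hi ▸ hj ▸ ha
    constructor
    · rintro ⟨u, v, huv, rfl⟩
      obtain ⟨i, rfl⟩ := e.surjective u
      obtain ⟨j, rfl⟩ := e.surjective v
      rcases lt_trichotomy i j with hij | hij | hij
      · exact ⟨i, j, hcons i j hij huv, rfl⟩
      · exact absurd (congrArg e hij) huv.1
      · exact ⟨j, i, hcons j i hij huv.symm, Finset.pair_comm _ _⟩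
    · rintro ⟨i, j, hij, rfl⟩
      exact ⟨_, _, hadj i j hij, rfl⟩

/-! ### Restrictions and disjoint unions -/

/-- The complex induced on `W` by an embedding of `W` into the vertex set. -/
def comap {W : Type*} (Δ : AbstractSimplicialComplex V) (f : W ↪ V) :
    AbstractSimplicialComplex W where
  faces := {G | G.map f ∈ Δ.faces}
  isRelLowerSet_faces := by
    intro G hG
    refine ⟨by simpa using nonempty_of_mem_faces hG, fun H hHG hH => ?_⟩
    exact mem_faces_of_subset hG (Finset.map_subset_map.2 hHG) (by simpa using hH)
  singleton_mem w := by simpa using Δ.singleton_mem (f w)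

section Map

variable {W : Type*} [DecidableEq W] {Γ : AbstractSimplicialComplex W} {f : W ↪ V}

theorem isMinNonfaceAt_map_iff (hΓ : ∀ G, G ∈ Γ.faces ↔ G.map f ∈ Δ.faces) (w : W)
    (M : Finset W) : Δ.IsMinNonfaceAt (f w) (M.map f) ↔ Γ.IsMinNonfaceAt w M := by
  have h2 (G : Finset W) : insert (f w) (G.map f) = (insert w G).map f :=
    (Finset.map_insert _ _ _).symm
  refine and_congr (by simp) (and_congr (by simp) (and_congr ?_ (and_congr ?_ ⟨?_, ?_⟩)))
  · simp [hΓ, Finset.map_insert]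
  · rw [hΓ, h2]
  · intro h G hG
    rw [hΓ, ← h2]
    exact h _ (Finset.map_ssubset_map.2 hG)
  · intro h H hH
    obtain ⟨G, -, rfl⟩ := Finset.subset_map_iff.1 hH.subset
    rw [h2, ← hΓ]
    exact h G (Finset.map_ssubset_map.1 hH)

theorem HasLocallyDisjointNonfaces.of_embedding (h : Δ.HasLocallyDisjointNonfaces)
    (hΓ : ∀ G, G ∈ Γ.faces ↔ G.map f ∈ Δ.faces) : Γ.HasLocallyDisjointNonfaces := by
  intro w M N hM hN
  rw [← isMinNonfaceAt_map_iff hΓ] at hM hN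
  simpa using h _ _ _ hM hN

end Map

theorem IsDisjointUnion.hasLocallyDisjointNonfaces {ι : Type*} {c : V → ι}
    {Γ : (i : ι) → AbstractSimplicialComplex {v : V // c v = i}} (h : Δ.IsDisjointUnion c Γ)
    (hΓ : ∀ i, (Γ i).HasLocallyDisjointNonfaces) : Δ.HasLocallyDisjointNonfaces := by
  classical
  have hmem (i : ι) (G : Finset {v : V // c v = i}) :
      G ∈ (Γ i).faces ↔ G.map (Function.Embedding.subtype _) ∈ Δ.faces := by
    refine ⟨fun hG => (h _).2 ⟨i, G, hG, rfl⟩, fun hG => ?_⟩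
    obtain ⟨j, G', hG', heq⟩ := (h _).1 hG
    obtain ⟨⟨v, hv⟩, hvG⟩ : G.Nonempty := by simpa using nonempty_of_mem_faces hG
    have hv' : v ∈ G'.map (Function.Embedding.subtype _) :=
      heq ▸ Finset.mem_map_of_mem _ hvG
    obtain ⟨⟨v', hv''⟩, -, hvv⟩ := Finset.mem_map.1 hv'
    have hij : i = j := by
      change v' = v at hvv
      rw [← hv, ← hv'', hvv]
    subst hij
    rwa [Finset.map_injective _ heq]
  have key (v : V) (M : Finset V) (hM : Δ.IsMinNonfaceAt v M) :
      ∃ M' : Finset {w : V // c w = c v}, M = M'.map (Function.Embedding.subtype _) := by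
    refine ⟨M.subtype _, (Finset.subtype_map_of_mem fun w hw => ?_).symm⟩
    obtain ⟨j, G', -, heq⟩ := (h _).1 (hM.2.2.1 w hw)
    have h1 : v ∈ G'.map (Function.Embedding.subtype _) := heq ▸ by simp
    have h2 : w ∈ G'.map (Function.Embedding.subtype _) := heq ▸ by simp
    obtain ⟨⟨v', hv'⟩, -, rfl⟩ := Finset.mem_map.1 h1
    obtain ⟨⟨w', hw'⟩, -, rfl⟩ := Finset.mem_map.1 h2
    exact hw'.trans hv'.symm
  intro v M N hM hN
  obtain ⟨M', rfl⟩ := key v M hM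
  obtain ⟨N', rfl⟩ := key v N hN
  have h1 := (isMinNonfaceAt_map_iff (hmem (c v)) ⟨v, rfl⟩ M').1 hM
  have h2 := (isMinNonfaceAt_map_iff (hmem (c v)) ⟨v, rfl⟩ N').1 hN
  simpa using hΓ _ _ _ _ h1 h2

/-- A finite complex is the disjoint union of the complexes induced on its connected components. -/
theorem exists_isDisjointUnion_comap [Finite V] (Δ : AbstractSimplicialComplex V) :
    ∃ (r : ℕ) (c : V → Fin r),
      Δ.IsDisjointUnion c (fun _ => Δ.comap (Function.Embedding.subtype _)) ∧
      ∀ i, (Δ.comap (Function.Embedding.subtype fun v => c v = i)).IsConnected := by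
  obtain ⟨r, ⟨e⟩⟩ := Finite.exists_equiv_fin Δ.graph.ConnectedComponent
  let c : V → Fin r := fun v => e (Δ.graph.connectedComponentMk v)
  have hc (u v : V) (h : Δ.graph.Adj u v) : c u = c v :=
    congrArg e (SimpleGraph.ConnectedComponent.eq.2 h.reachable)
  refine ⟨r, c, fun F => ⟨fun hF => ?_, ?_⟩, fun i => ?_⟩
  · obtain ⟨v, hv⟩ := nonempty_of_mem_faces hF
    have hsub : (F.subtype fun w => c w = c v).map (Function.Embedding.subtype _) = F := by
      refine Finset.subtype_map_of_mem fun w hw => ?_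
      by_cases hwv : w = v
      · rw [hwv]
      · exact hc w v (graph_adj_of_mem_faces hF hw hv hwv)
    refine ⟨c v, F.subtype fun w => c w = c v, ?_, hsub.symm⟩
    change Finset.map _ _ ∈ Δ.faces
    rwa [hsub]
  · rintro ⟨i, G, hG, rfl⟩
    exact hG
  · have walk (u w : V) (p : Δ.graph.Walk u w) (hu : c u = i) (hw : c w = i) :
        (Δ.comap (Function.Embedding.subtype fun v => c v = i)).graph.Reachable ⟨u, hu⟩ ⟨w, hw⟩ := by
      induction p with
      | nil => rfl
      | @cons u v w huv p ih =>
        have hv : c v = i := (hc u v huv).symm.trans hu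
        refine SimpleGraph.Reachable.trans (SimpleGraph.Adj.reachable ?_) (ih hv hw)
        refine ⟨fun hx => huv.1 (congrArg Subtype.val hx), ?_⟩
        change Finset.map _ _ ∈ Δ.faces
        simpa [Finset.map_insert] using huv.2
    have hne : Nonempty {v // c v = i} := by
      obtain ⟨v, hv⟩ := (e.symm i).exists_rep
      refine ⟨v, ?_⟩
      change e (Quot.mk _ v) = i
      rw [hv, Equiv.apply_symm_apply]
    refine ⟨fun ⟨u, hu⟩ ⟨w, hw⟩ => ?_⟩
    have : Δ.graph.Reachable u w := by
      rw [← SimpleGraph.ConnectedComponent.eq]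
      exact e.injective (hu.trans hw.symm)
    obtain ⟨p⟩ := this
    exact walk u w p hu hw

end AbstractSimplicialComplex

open RingTheory.Sequence

/-! ### Depth of local rings -/

section Depth

variable {R : Type*} [CommRing R] [IsLocalRing R] [IsNoetherianRing R]

theorem localDepth_le_ringKrullDim :
    ((localDepth R : ℕ∞) : WithBot ℕ∞) ≤ ringKrullDim R := by
  obtain ⟨d, hd⟩ : ∃ d : ℕ∞, ringKrullDim R = d := by
    obtain ⟨d, hd⟩ := WithBot.ne_bot_iff_exists.1
      (ne_bot_of_le_ne_bot (by simp) (ringKrullDim_nonneg_of_nontrivial (R := R)))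
    exact ⟨d, hd.symm⟩
  rw [hd, WithBot.coe_le_coe]
  refine iSup₂_le fun rs hrs => ?_
  have h := ringKrullDim_add_length_eq_ringKrullDim_of_isRegular rs hrs.1
  have hnt : Nontrivial (R ⧸ Ideal.ofList rs) := by
    refine Ideal.Quotient.nontrivial_iff.2 fun htop => hrs.1.top_ne_smul ?_
    rw [htop, smul_eq_mul, Ideal.mul_top]
  have h0 := ringKrullDim_nonneg_of_nontrivial (R := R ⧸ Ideal.ofList rs)
  rw [← WithBot.coe_le_coe, ← hd, ← h]
  exact le_add_of_nonneg_left h0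

theorem localDepth_eq_ringKrullDim_of_isWeaklyRegular {rs : List R}
    (hreg : IsWeaklyRegular R rs) (hmem : ∀ r ∈ rs, r ∈ IsLocalRing.maximalIdeal R)
    (hdim : ringKrullDim R ≤ (rs.length : ℕ∞)) :
    ((localDepth R : ℕ∞) : WithBot ℕ∞) = ringKrullDim R := by
  refine le_antisymm localDepth_le_ringKrullDim (hdim.trans ?_)
  rw [WithBot.coe_le_coe]
  exact le_iSup₂_of_le rs ⟨.of_isWeaklyRegular_of_mem_maximalIdeal R hmem hreg, hmem⟩ le_rfl

end Depth

section Rees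

universe u

open CategoryTheory CategoryTheory.Abelian CategoryTheory.Limits

variable {R : Type u} [CommRing R] [IsLocalRing R] [IsNoetherianRing R]

/-- Dividing by one regular element lowers the depth by at most one. By the Rees theorem depth is
measured by the vanishing of `Ext`, so that this follows from the long exact sequence. -/
theorem exists_isRegular_quotSMulTop (M : Type u) [AddCommGroup M] [Module R M] [Module.Finite R M]
    [Nontrivial M] {n : ℕ} {rs : List R} (hlen : rs.length = n + 1)
    (hmem : ∀ r ∈ rs, r ∈ IsLocalRing.maximalIdeal R) (hreg : IsRegular M rs)
    {x : R} (hx : x ∈ IsLocalRing.maximalIdeal R) (hxreg : IsSMulRegular M x) :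
    ∃ rs' : List R, rs'.length = n ∧ (∀ r ∈ rs', r ∈ IsLocalRing.maximalIdeal R) ∧
      IsRegular (QuotSMulTop x M) rs' := by
  have hlt (L : Type u) [AddCommGroup L] [Module R L] [Module.Finite R L] [Nontrivial L] :
      IsLocalRing.maximalIdeal R • (⊤ : Submodule R L) < ⊤ :=
    (Submodule.top_ne_ideal_smul_of_le_jacobson_annihilator
      (IsLocalRing.maximalIdeal_le_jacobson _)).symm.lt_top
  have : Nontrivial (QuotSMulTop x M) := nontrivial_quotSMulTop_of_mem_maximalIdeal M hx
  have hM := (ModuleCat.exists_isRegular_tfae (IsLocalRing.maximalIdeal R) (n + 1)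
    (ModuleCat.of R M) (hlt M)).out 3 1
  have hQ := (ModuleCat.exists_isRegular_tfae (IsLocalRing.maximalIdeal R) n
    (ModuleCat.of R (QuotSMulTop x M)) (hlt _)).out 1 3
  have h1 : ∀ i < n + 1, Subsingleton
      (Ext (ModuleCat.of R (Shrink.{u} (R ⧸ IsLocalRing.maximalIdeal R))) (ModuleCat.of R M) i) :=
    hM.1 ⟨rs, hlen, hmem, hreg⟩
  refine hQ.1 fun i hi => ?_
  have zero1 := AddCommGrpCat.isZero_of_iff_subsingleton.mpr (h1 i (by omega))
  have zero2 := AddCommGrpCat.isZero_of_iff_subsingleton.mpr (h1 (i + 1) (by omega))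
  have hxreg' : IsSMulRegular (ModuleCat.of R M) x := hxreg
  exact AddCommGrpCat.subsingleton_of_isZero <| ShortComplex.Exact.isZero_of_both_zeros
    ((Ext.covariant_sequence_exact₃' _ hxreg'.smulShortComplex_shortExact) i (i + 1) rfl)
    (zero1.eq_zero_of_src _) (zero2.eq_zero_of_tgt _)

theorem exists_isRegular_quotient_ofList (M : Type u) [AddCommGroup M] [Module R M]
    [Module.Finite R M] [Nontrivial M] {fs rs : List R}
    (hmem : ∀ r ∈ rs, r ∈ IsLocalRing.maximalIdeal R) (hreg : IsRegular M rs)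
    (hfmem : ∀ r ∈ fs, r ∈ IsLocalRing.maximalIdeal R) (hfreg : IsWeaklyRegular M fs) :
    ∃ rs' : List R, rs'.length = rs.length - fs.length ∧
      (∀ r ∈ rs', r ∈ IsLocalRing.maximalIdeal R) ∧
      IsWeaklyRegular (M ⧸ (Ideal.ofList fs • ⊤ : Submodule R M)) rs' := by
  induction fs generalizing M rs with
  | nil =>
    refine ⟨rs, by simp, hmem, ?_⟩
    have := (isWeaklyRegular_append_iff M [] rs).1 hreg.toIsWeaklyRegular
    exact this.2
  | cons x fs ih =>
    rcases Nat.eq_zero_or_pos rs.length with h0 | h0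
    · exact ⟨[], by simp [h0], by simp, .nil _ _⟩
    rw [isWeaklyRegular_cons_iff] at hfreg
    have hx := hfmem x (by simp)
    obtain ⟨rs₁, hlen₁, hmem₁, hreg₁⟩ := exists_isRegular_quotSMulTop M
      (n := rs.length - 1) (by omega) hmem hreg hx hfreg.1
    have : Nontrivial (QuotSMulTop x M) := nontrivial_quotSMulTop_of_mem_maximalIdeal M hx
    obtain ⟨rs₂, hlen₂, hmem₂, hreg₂⟩ := ih (QuotSMulTop x M) hmem₁ hreg₁
      (fun r hr => hfmem r (by simp [hr])) hfreg.2
    refine ⟨rs₂, by simp; omega, hmem₂, ?_⟩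
    exact (Submodule.quotOfListConsSMulTopEquivQuotSMulTopInner M x fs).isWeaklyRegular_congr
      rs₂ |>.2 hreg₂

end Rees

/-! ### Regular sequences in maximal ideals of polynomial rings -/

/-- Every maximal ideal contains a regular sequence of length `d`. -/
def HasRegularSequencesOfLength (R : Type*) [CommRing R] (d : ℕ) : Prop :=
  ∀ P : Ideal R, P.IsMaximal → ∃ rs : List R, rs.length = d ∧ (∀ r ∈ rs, r ∈ P) ∧
    IsWeaklyRegular R rs

namespace HasRegularSequencesOfLength

variable {R S : Type*} [CommRing R] [CommRing S] {d : ℕ}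

theorem of_ringEquiv (h : HasRegularSequencesOfLength R d) (e : R ≃+* S) :
    HasRegularSequencesOfLength S d := by
  intro P hP
  obtain ⟨rs, hlen, hmem, hreg⟩ := h (P.comap e) inferInstance
  refine ⟨rs.map e, by simpa using hlen, fun r hr => ?_, ?_⟩
  · obtain ⟨s, hs, rfl⟩ := List.mem_map.1 hr
    exact hmem s hs
  · refine (AddEquiv.isWeaklyRegular_congr (e := e.toAddEquiv) ?_).1 hreg
    rw [List.forall₂_map_right_iff, List.forall₂_same]
    intro r _ x
    simp

open Polynomial in
/-- A maximal ideal of `R[X]` contains a regular sequence of its contraction to `R`, and a monic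
polynomial, which continues the sequence. -/
theorem polynomial [IsJacobsonRing R] (h : HasRegularSequencesOfLength R d) :
    HasRegularSequencesOfLength R[X] (d + 1) := by
  intro P hP
  obtain ⟨rs, hlen, hmem, hreg⟩ := h (P.comap C) (isMaximal_comap_C_of_isJacobsonRing P)
  obtain ⟨g, hg, hgP⟩ := quotient_mk_comp_C_isIntegral_of_isJacobsonRing P (Ideal.Quotient.mk P X)
  have hgmem : g ∈ P := by
    rw [← Ideal.Quotient.eq_zero_iff_mem, ← hgP, ← hom_eval₂, eval₂_C_X]
  refine ⟨rs.map C ++ [g], by simp [hlen], fun r hr => ?_, ?_⟩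
  · rcases List.mem_append.1 hr with hr | hr
    · obtain ⟨s, hs, rfl⟩ := List.mem_map.1 hr
      exact hmem s hs
    · rwa [List.mem_singleton.1 hr]
  · rw [isWeaklyRegular_append_iff]
    refine ⟨hreg.of_flat (S := R[X]), ?_⟩
    rw [isWeaklyRegular_singleton_iff, isSMulRegular_quotient_iff_mem_of_smul_mem]
    intro p hp
    have hI : (Ideal.ofList (rs.map C) • ⊤ : Submodule R[X] R[X]) =
        (Ideal.ofList rs).map (C : R →+* R[X]) := by
      rw [smul_eq_mul, Ideal.mul_top, Ideal.map_ofList]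
    rw [hI] at hp ⊢
    have hker (q : R[X]) : q ∈ (Ideal.ofList rs).map (C : R →+* R[X]) ↔
        q.map (Ideal.Quotient.mk (Ideal.ofList rs)) = 0 := by
      rw [Ideal.mem_map_C_iff, Polynomial.ext_iff]
      simp [coeff_map, Ideal.Quotient.eq_zero_iff_mem]
    rw [hker] at hp ⊢
    rw [smul_eq_mul, Polynomial.map_mul] at hp
    exact (hg.map _).mul_right_eq_zero_iff.1 hp

end HasRegularSequencesOfLength

theorem hasRegularSequencesOfLength_mvPolynomial (K : Type*) [Field K] (V : Type*) [Finite V] :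
    HasRegularSequencesOfLength (MvPolynomial V K) (Nat.card V) := by
  induction V using Finite.induction_empty_option with
  | of_equiv e h =>
    rw [← Nat.card_congr e]
    exact h.of_ringEquiv (MvPolynomial.renameEquiv K e).toRingEquiv
  | h_empty => exact fun P _ => ⟨[], by simp, by simp, .nil _ _⟩
  | @h_option V _ h =>
    rw [Finite.card_option]
    exact h.polynomial.of_ringEquiv (MvPolynomial.optionEquivLeft K V).symm.toRingEquiv

/-! ### Localizations of quotients of polynomial rings -/

/-- Let `J ⊇ I` be an ideal that agrees with `I` near a prime ideal `P`. The localization of `S ⧸ I`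
at the image of `P` is the quotient of `S_P` by `J`. -/
theorem Localization.localRingHom_mk_surjective_and_ker {S : Type*} [CommRing S] {I J : Ideal S}
    (hIJ : I ≤ J) (p : Ideal (S ⧸ I)) [p.IsPrime] {s : S}
    (hs : s ∉ p.comap (Ideal.Quotient.mk I)) (hJ : ∀ z ∈ J, s * z ∈ I) :
    let φ := Localization.localRingHom (p.comap (Ideal.Quotient.mk I)) p (Ideal.Quotient.mk I) rfl
    Function.Surjective φ ∧ RingHom.ker φ = J.map (algebraMap S _) := by
  intro φ
  set P := p.comap (Ideal.Quotient.mk I)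
  refine ⟨fun z => ?_, le_antisymm (fun z hz => ?_) ?_⟩
  · obtain ⟨⟨a, t, ht⟩, rfl⟩ := IsLocalization.mk'_surjective p.primeCompl z
    obtain ⟨a, rfl⟩ := Ideal.Quotient.mk_surjective a
    obtain ⟨t, rfl⟩ := Ideal.Quotient.mk_surjective t
    exact ⟨IsLocalization.mk' _ a (⟨t, ht⟩ : P.primeCompl), Localization.localRingHom_mk' _ _ _ _ _ _⟩
  · obtain ⟨⟨a, t⟩, rfl⟩ := IsLocalization.mk'_surjective P.primeCompl z
    rw [RingHom.mem_ker] at hz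
    dsimp only at hz
    rw [Localization.localRingHom_mk', IsLocalization.mk'_eq_zero_iff] at hz
    obtain ⟨⟨u, hu⟩, hua⟩ := hz
    obtain ⟨u, rfl⟩ := Ideal.Quotient.mk_surjective u
    dsimp only at hua
    rw [← map_mul, Ideal.Quotient.eq_zero_iff_mem] at hua
    rw [IsLocalization.mk'_mem_map_algebraMap_iff]
    exact ⟨u, hu, hIJ hua⟩
  · rw [Ideal.map_le_iff_le_comap]
    intro z hz
    rw [Ideal.mem_comap, RingHom.mem_ker, Localization.localRingHom_to_map]
    have h0 : algebraMap (S ⧸ I) (Localization.AtPrime p) (Ideal.Quotient.mk I s) *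
        algebraMap _ _ (Ideal.Quotient.mk I z) = 0 := by
      rw [← map_mul, ← map_mul, Ideal.Quotient.eq_zero_iff_mem.2 (hJ z hz), map_zero]
    exact (IsUnit.mul_right_eq_zero
      (IsLocalization.map_units (Localization.AtPrime p) (⟨_, hs⟩ : p.primeCompl))).1 h0

/-- Quotients of polynomial rings that are defined by a regular sequence near a maximal ideal are
Cohen–Macaulay there. -/
theorem localDepth_eq_ringKrullDim_of_ofList {K : Type*} [Field K] {V : Type*} [Finite V]
    {I : Ideal (MvPolynomial V K)} {fs : List (MvPolynomial V K)}
    (hfs : IsWeaklyRegular (MvPolynomial V K) fs)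
    (hI : I ≤ Ideal.ofList fs) (p : Ideal (MvPolynomial V K ⧸ I)) [p.IsMaximal]
    {s : MvPolynomial V K} (hs : s ∉ p.comap (Ideal.Quotient.mk I))
    (hJ : ∀ z ∈ Ideal.ofList fs, s * z ∈ I) :
    ((localDepth (Localization.AtPrime p) : ℕ∞) : WithBot ℕ∞) =
      ringKrullDim (Localization.AtPrime p) := by
  obtain ⟨hsurj, hker⟩ := Localization.localRingHom_mk_surjective_and_ker hI p hs hJ
  have hlocal := Localization.isLocalHom_localRingHom (p.comap (Ideal.Quotient.mk I)) p
    (Ideal.Quotient.mk I) rfl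
  set P := p.comap (Ideal.Quotient.mk I) with hP
  set φ := Localization.localRingHom P p (Ideal.Quotient.mk I) rfl
  have hPmax : P.IsMaximal := Ideal.comap_isMaximal_of_surjective _ Ideal.Quotient.mk_surjective
  have hmemP : ∀ f ∈ fs, f ∈ P := by
    intro f hf
    have h1 : s * f ∈ P := by
      rw [hP, Ideal.mem_comap, Ideal.Quotient.eq_zero_iff_mem.2 (hJ f (Ideal.subset_span hf))]
      exact Ideal.zero_mem _
    exact (hPmax.isPrime.mem_or_mem h1).resolve_left hs
  have hloc {r : MvPolynomial V K} (hr : r ∈ P) :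
      algebraMap _ (Localization.AtPrime P) r ∈ IsLocalRing.maximalIdeal _ := by
    rw [← Localization.AtPrime.map_eq_maximalIdeal]
    exact Ideal.mem_map_of_mem _ hr
  have hlocmap {rs : List (MvPolynomial V K)} (h : ∀ r ∈ rs, r ∈ P) :
      ∀ r ∈ rs.map (algebraMap _ (Localization.AtPrime P)), r ∈ IsLocalRing.maximalIdeal _ := by
    intro r hr
    obtain ⟨s, hs, rfl⟩ := List.mem_map.1 hr
    exact hloc (h s hs)
  obtain ⟨rs, hlen, hmem, hreg⟩ := hasRegularSequencesOfLength_mvPolynomial K V P hPmax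
  have hreg' := hreg.isRegular_of_isLocalization_of_mem (Localization.AtPrime P) P hmem
  have hfs' := hfs.isRegular_of_isLocalization_of_mem (Localization.AtPrime P) P hmemP
  obtain ⟨gs, hglen, hgmem, hgreg⟩ := exists_isRegular_quotient_ofList (Localization.AtPrime P)
    (hlocmap hmem) hreg' (hlocmap hmemP) hfs'.toIsWeaklyRegular
  rw [List.length_map, List.length_map, hlen] at hglen
  have hkerfs : RingHom.ker φ = Ideal.ofList (fs.map (algebraMap _ (Localization.AtPrime P))) := by
    rw [hker, Ideal.map_ofList]
  let e : (Localization.AtPrime P ⧸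
      Ideal.ofList (fs.map (algebraMap _ (Localization.AtPrime P)))) ≃+* Localization.AtPrime p :=
    (Ideal.quotEquivOfEq hkerfs.symm).trans (RingHom.quotientKerEquivOfSurjective hsurj)
  have he (x : Localization.AtPrime P) : e (Ideal.Quotient.mk _ x) = φ x := rfl
  refine localDepth_eq_ringKrullDim_of_isWeaklyRegular (rs := gs.map φ) ?_ ?_ ?_
  · have hI' : (Ideal.ofList (fs.map (algebraMap _ (Localization.AtPrime P))) •
        (⊤ : Submodule (Localization.AtPrime P) (Localization.AtPrime P))) =
        Ideal.ofList (fs.map (algebraMap _ (Localization.AtPrime P))) := by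
      rw [smul_eq_mul, Ideal.mul_top]
    rw [hI'] at hgreg
    refine (AddEquiv.isWeaklyRegular_congr (e := e.toAddEquiv) ?_).1 hgreg
    rw [List.forall₂_map_right_iff, List.forall₂_same]
    intro r _ x
    obtain ⟨x, rfl⟩ := Ideal.Quotient.mk_surjective x
    change e (Ideal.Quotient.mk _ (r * x)) = φ r * e (Ideal.Quotient.mk _ x)
    rw [he, he, map_mul]
  · intro r hr
    obtain ⟨g, hg, rfl⟩ := List.mem_map.1 hr
    exact (IsLocalRing.mem_maximalIdeal _).2 fun hu =>
      (IsLocalRing.mem_maximalIdeal _).1 (hgmem g hg) (isUnit_of_map_unit φ g hu)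
  · have h1 := ringKrullDim_add_length_eq_ringKrullDim_of_isRegular _ hfs'
    rw [ringKrullDim_eq_of_ringEquiv e, List.length_map,
      IsLocalization.AtPrime.ringKrullDim_eq_height P] at h1
    have h2 : ((P.height : ℕ∞) : WithBot ℕ∞) ≤ (Nat.card V : ℕ∞) := by
      refine (Ideal.height_le_ringKrullDim_of_ne_top hPmax.ne_top).trans ?_
      rw [MvPolynomial.ringKrullDim_of_isNoetherianRing, ringKrullDim_eq_zero_of_field, zero_add]
      rfl
    rw [← h1] at h2
    obtain ⟨d, hd⟩ := WithBot.ne_bot_iff_exists.1 (ne_bot_of_le_ne_bot (by simp)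
      (ringKrullDim_nonneg_of_nontrivial (R := Localization.AtPrime p)))
    rw [← hd] at h2 ⊢
    rw [List.length_map, hglen]
    have h3 : d + (fs.length : ℕ∞) ≤ (Nat.card V : ℕ∞) := by exact_mod_cast h2
    have h4 : d ≠ ⊤ := by
      rintro rfl
      simp at h3
    obtain ⟨n, rfl⟩ := ENat.ne_top_iff_exists.1 h4
    have h5 : n + fs.length ≤ Nat.card V := by exact_mod_cast h3
    have h6 : n ≤ Nat.card V - fs.length := by omega
    exact_mod_cast h6

open MvPolynomial

/-! ### Squarefree monomial ideals -/

namespace MvPolynomial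

variable {K : Type*} [CommRing K] {V : Type*}

/-- The exponent vector of the squarefree monomial with support `F`. -/
noncomputable def sqfreeExponent (F : Finset V) : V →₀ ℕ := ∑ v ∈ F, Finsupp.single v 1

theorem sqfreeExponent_apply [DecidableEq V] (F : Finset V) (v : V) :
    sqfreeExponent F v = if v ∈ F then 1 else 0 := by
  simp [sqfreeExponent, Finsupp.finsetSum_apply, Finsupp.single_apply]

theorem support_sqfreeExponent (F : Finset V) : (sqfreeExponent F).support = F := by
  classical
  ext v
  simp [sqfreeExponent_apply]

theorem sqfreeExponent_le_iff {F : Finset V} {n : V →₀ ℕ} :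
    sqfreeExponent F ≤ n ↔ F ⊆ n.support := by
  classical
  rw [Finsupp.le_def]
  refine forall_congr' fun v => ?_
  rw [sqfreeExponent_apply, Finsupp.mem_support_iff]
  split_ifs with h <;> simp [h, Nat.one_le_iff_ne_zero]

theorem prod_X_eq_monomial (F : Finset V) :
    ∏ v ∈ F, (X v : MvPolynomial V K) = monomial (sqfreeExponent F) 1 := by
  rw [sqfreeExponent, monomial_sum_one]
  rfl

/-- The ideal generated by the squarefree monomials with supports in `𝓖`. -/
noncomputable def sqfreeIdeal (K : Type*) [CommRing K] (𝓖 : Set (Finset V)) :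
    Ideal (MvPolynomial V K) :=
  Ideal.span ((fun F => ∏ v ∈ F, X v) '' 𝓖)

theorem mem_sqfreeIdeal_iff {𝓖 : Set (Finset V)} {p : MvPolynomial V K} :
    p ∈ sqfreeIdeal K 𝓖 ↔ ∀ n ∈ p.support, ∃ F ∈ 𝓖, F ⊆ n.support := by
  have h : (fun F => ∏ v ∈ F, (X v : MvPolynomial V K)) '' 𝓖 =
      (fun n => monomial n 1) '' (sqfreeExponent '' 𝓖) := by
    rw [Set.image_image]
    exact Set.image_congr fun F _ => prod_X_eq_monomial F
  rw [sqfreeIdeal, h, mem_ideal_span_monomial_image]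
  simp only [Set.exists_mem_image, sqfreeExponent_le_iff]

theorem mem_sqfreeIdeal_of_monomial_mul_mem {𝓖 : Set (Finset V)} {n : V →₀ ℕ}
    {p : MvPolynomial V K} (hn : ∀ F ∈ 𝓖, Disjoint n.support F)
    (h : monomial n 1 * p ∈ sqfreeIdeal K 𝓖) : p ∈ sqfreeIdeal K 𝓖 := by
  classical
  rw [mem_sqfreeIdeal_iff] at h ⊢
  intro m hm
  obtain ⟨F, hF, hs⟩ := h (n + m) (by
    rw [mem_support_iff, coeff_monomial_mul, one_mul]
    exact mem_support_iff.1 hm)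
  refine ⟨F, hF, fun v hv => ?_⟩
  rcases Finset.mem_union.1 (Finsupp.support_add (hs hv)) with h | h
  · exact absurd hv (Finset.disjoint_left.1 (hn F hF) h)
  · exact h

theorem ofList_prod_X (L : List (Finset V)) :
    Ideal.ofList (L.map fun F => ∏ v ∈ F, (X v : MvPolynomial V K)) =
      sqfreeIdeal K {F | F ∈ L} := by
  rw [Ideal.ofList, sqfreeIdeal]
  congr 1
  ext p
  simp

/-- Squarefree monomials with pairwise disjoint supports form a regular sequence. -/
theorem isWeaklyRegular_prod_X (L : List (Finset V)) (hL : L.Pairwise Disjoint) :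
    IsWeaklyRegular (MvPolynomial V K) (L.map fun F => ∏ v ∈ F, (X v : MvPolynomial V K)) := by
  induction L using List.reverseRecOn with
  | nil => exact .nil _ _
  | append_singleton L F ih =>
    rw [List.pairwise_append] at hL
    rw [List.map_append, isWeaklyRegular_append_iff]
    refine ⟨ih hL.1, ?_⟩
    rw [List.map_singleton, isWeaklyRegular_singleton_iff,
      isSMulRegular_quotient_iff_mem_of_smul_mem]
    intro p hp
    rw [smul_eq_mul, Ideal.mul_top, ofList_prod_X] at hp ⊢
    rw [smul_eq_mul, prod_X_eq_monomial] at hp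
    refine mem_sqfreeIdeal_of_monomial_mul_mem (fun G hG => ?_) hp
    rw [support_sqfreeExponent]
    exact (hL.2.2 G hG F (by simp)).symm

end MvPolynomial

/-! ### Relations between the members of a regular sequence -/

theorem Ideal.mem_ofList_iff_exists_sum {R : Type*} [CommRing R] {rs : List R} {x : R} :
    x ∈ Ideal.ofList rs ↔ ∃ b : ℕ → R, ∑ i ∈ Finset.range rs.length, b i * rs.getD i 0 = x := by
  have h : {r | r ∈ rs} = Set.range fun i : Fin rs.length => rs.getD i 0 := by
    ext r
    simp [List.mem_iff_get]
  rw [Ideal.ofList, h, Ideal.mem_span_range_iff_exists_fun]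
  constructor
  · rintro ⟨c, rfl⟩
    refine ⟨fun i => if hi : i < rs.length then c ⟨i, hi⟩ else 0, ?_⟩
    rw [Finset.sum_range]
    simp
  · rintro ⟨b, rfl⟩
    exact ⟨fun i => b i, (Finset.sum_range fun i => b i * rs.getD i 0).symm⟩

/-- The coefficients of a linear relation between the members of a regular sequence lie in the ideal
that the sequence generates. -/
theorem RingTheory.Sequence.IsWeaklyRegular.mem_ofList_of_sum_eq_zero {R : Type*} [CommRing R]
    {rs : List R} (h : IsWeaklyRegular R rs) (a : ℕ → R)
    (ha : ∑ i ∈ Finset.range rs.length, a i * rs.getD i 0 = 0) :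
    ∀ i < rs.length, a i ∈ Ideal.ofList rs := by
  induction rs using List.reverseRecOn generalizing a with
  | nil => simp
  | append_singleton rs r ih =>
    rw [isWeaklyRegular_append_iff, isWeaklyRegular_singleton_iff,
      isSMulRegular_quotient_iff_mem_of_smul_mem] at h
    obtain ⟨hrs, hr⟩ := h
    simp only [smul_eq_mul, Ideal.mul_top] at hr
    have hget (i : ℕ) (hi : i ∈ Finset.range rs.length) :
        (rs ++ [r]).getD i 0 = rs.getD i 0 :=
      List.getD_append _ _ _ _ (Finset.mem_range.1 hi)
    rw [List.length_append, List.length_singleton, Finset.sum_range_succ,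
      List.getD_append_right _ _ _ _ le_rfl, Nat.sub_self, List.getD_cons_zero,
      Finset.sum_congr rfl fun i hi => by rw [hget i hi]] at ha
    have hlast : a rs.length ∈ Ideal.ofList rs := by
      refine hr _ (Ideal.mem_ofList_iff_exists_sum.2 ⟨fun i => - a i, ?_⟩)
      simp only [neg_mul, Finset.sum_neg_distrib]
      linear_combination -ha
    obtain ⟨b, hb⟩ := Ideal.mem_ofList_iff_exists_sum.1 hlast
    have hab := ih hrs (fun i => a i + b i * r) (by
      refine Eq.trans ?_ ha
      rw [← hb, Finset.sum_mul, ← Finset.sum_add_distrib]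
      exact Finset.sum_congr rfl fun i _ => by ring)
    rw [Ideal.ofList_append, List.length_append, List.length_singleton]
    intro i hi
    rcases Nat.lt_succ_iff_lt_or_eq.1 hi with hi | rfl
    · have hmem : r ∈ Ideal.ofList rs ⊔ Ideal.ofList [r] :=
        Submodule.mem_sup_right (Ideal.subset_span (by simp))
      have := Submodule.mem_sup_left (T := Ideal.ofList [r]) (hab i hi)
      rw [show a i = (a i + b i * r) - b i * r by ring]
      exact Ideal.sub_mem _ this (Ideal.mul_mem_left _ _ hmem)
    · exact Submodule.mem_sup_left hlast

/-! ### Complete intersection complexes -/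

namespace AbstractSimplicialComplex

variable {K : Type*} [Field K] {V : Type*} {Δ : AbstractSimplicialComplex V}

theorem stanleyReisnerIdeal_eq_sqfreeIdeal :
    Δ.stanleyReisnerIdeal K = sqfreeIdeal K {F | F.Nonempty ∧ F ∉ Δ.faces} := by
  rw [stanleyReisnerIdeal, sqfreeIdeal]
  congr 1
  ext p
  simp only [Set.mem_ofPred_eq, Set.mem_image, and_assoc, eq_comm]

theorem mem_stanleyReisnerIdeal_iff {p : MvPolynomial V K} :
    p ∈ Δ.stanleyReisnerIdeal K ↔ ∀ n ∈ p.support, n ≠ 0 ∧ n.support ∉ Δ.faces := by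
  rw [stanleyReisnerIdeal_eq_sqfreeIdeal, mem_sqfreeIdeal_iff]
  refine forall₂_congr fun n _ => ?_
  constructor
  · rintro ⟨F, ⟨hne, hF⟩, hs⟩
    have hn : n.support.Nonempty := hne.mono hs
    exact ⟨Finsupp.support_nonempty_iff.1 hn, fun h => hF (mem_faces_of_subset h hs hne)⟩
  · rintro ⟨hn, h⟩
    exact ⟨n.support, ⟨Finsupp.support_nonempty_iff.2 hn, h⟩, subset_rfl⟩

theorem stanleyReisnerIdeal_eq_sqfreeIdeal_isMinNonface :
    Δ.stanleyReisnerIdeal K = sqfreeIdeal K {F | Δ.IsMinNonface F} := by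
  ext p
  rw [stanleyReisnerIdeal_eq_sqfreeIdeal, mem_sqfreeIdeal_iff, mem_sqfreeIdeal_iff]
  refine forall₂_congr fun n _ => ?_
  constructor
  · rintro ⟨F, ⟨hne, hF⟩, hs⟩
    obtain ⟨G, hGF, hG⟩ := exists_isMinNonface_subset hne hF
    exact ⟨G, hG, hGF.trans hs⟩
  · rintro ⟨F, hF, hs⟩
    exact ⟨F, ⟨hF.1, hF.2.1⟩, hs⟩

theorem HasDisjointNonfaces.isCompleteIntersection [Finite V] (h : Δ.HasDisjointNonfaces) :
    Δ.IsCompleteIntersection K := by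
  let L := (Set.toFinite {F | Δ.IsMinNonface F}).toFinset.toList
  have hL (F : Finset V) : F ∈ L ↔ Δ.IsMinNonface F := by simp [L]
  have hI : Ideal.ofList (L.map fun F => ∏ v ∈ F, (X v : MvPolynomial V K)) =
      Δ.stanleyReisnerIdeal K := by
    rw [ofList_prod_X, stanleyReisnerIdeal_eq_sqfreeIdeal_isMinNonface]
    simp only [hL]
  refine ⟨_, ⟨isWeaklyRegular_prod_X L ?_, ?_⟩, hI⟩
  · refine (Finset.nodup_toList _).pairwise_of_forall_ne fun F hF G hG hne => ?_
    exact (h F G ((hL F).1 hF) ((hL G).1 hG)).resolve_left hne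
  · rw [hI, smul_eq_mul, Ideal.mul_top]
    intro htop
    have h1 : (1 : MvPolynomial V K) ∈ Δ.stanleyReisnerIdeal K := htop ▸ Submodule.mem_top
    exact (mem_stanleyReisnerIdeal_iff.1 h1 0 (by simp)).1 rfl

/-- If the ideal generated by the minimal nonfaces is generated by a regular sequence, then the
monomials of the minimal nonfaces and the sequence express each other by matrices `C` and `D`, and
`C * D` is the identity at the origin. The coefficients of a relation between the monomials hence
lie in the ideal after multiplication by the determinant of `C * D`, which has constant term one.
The relation that comes from the least common multiple of two monomials with a common variable has
coefficients outside the ideal. -/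
theorem IsCompleteIntersection.hasDisjointNonfaces [Finite V]
    (h : Δ.IsCompleteIntersection K) : Δ.HasDisjointNonfaces := by
  classical
  obtain ⟨fs, hreg, hI⟩ := h
  let T := {F : Finset V // Δ.IsMinNonface F}
  have := Fintype.ofFinite T
  let m : T → MvPolynomial V K := fun F => monomial (sqfreeExponent F.1) 1
  have hspan : Ideal.span (Set.range m) = Δ.stanleyReisnerIdeal K := by
    rw [stanleyReisnerIdeal_eq_sqfreeIdeal_isMinNonface, sqfreeIdeal]
    congr 1
    ext p
    simp [m, T, prod_X_eq_monomial]
  have hm (F : T) : m F ∈ Ideal.ofList fs := by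
    rw [hI, ← hspan]
    exact Ideal.subset_span ⟨F, rfl⟩
  have hf (i : ℕ) : fs.getD i 0 ∈ Ideal.span (Set.range m) := by
    rw [hspan, ← hI]
    by_cases hi : i < fs.length
    · rw [List.getD_eq_getElem _ _ hi]
      exact Ideal.subset_span (List.getElem_mem hi)
    · rw [List.getD_eq_default _ _ (not_lt.1 hi)]
      exact Ideal.zero_mem _
  choose C hC using fun F => Ideal.mem_ofList_iff_exists_sum.1 (hm F)
  choose D hD using fun i => Ideal.mem_span_range_iff_exists_fun.1 (hf i)
  let E : Matrix T T (MvPolynomial V K) :=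
    fun F G => ∑ i ∈ Finset.range fs.length, C F i * D i G
  have hE (F : T) : ∑ G, E F G * m G = m F := by
    simp only [E, Finset.sum_mul]
    rw [Finset.sum_comm, ← hC F]
    refine Finset.sum_congr rfl fun i _ => ?_
    rw [← hD i, Finset.mul_sum]
    exact Finset.sum_congr rfl fun G _ => by ring
  have hcoeff (p : MvPolynomial V K) (F G : T) :
      coeff (sqfreeExponent F.1) (p * m G) = if F = G then constantCoeff p else 0 := by
    rw [coeff_mul_monomial', mul_one]
    by_cases hFG : F = G
    · subst hFG
      simp [constantCoeff_eq]
    · rw [if_neg hFG, if_neg]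
      rw [sqfreeExponent_le_iff, support_sqfreeExponent]
      exact fun hs => hFG (Subtype.ext (G.2.eq_of_subset F.2 hs).symm)
  have hEconst : (constantCoeff (R := K) (σ := V)).mapMatrix E = 1 := by
    ext F G
    have := congrArg (coeff (sqfreeExponent G.1)) (hE F)
    rw [coeff_sum, Finset.sum_congr rfl fun H _ => hcoeff (E F H) G H, Finset.sum_ite_eq,
      if_pos (Finset.mem_univ G)] at this
    refine Eq.trans this ?_
    rw [← one_mul (m F), hcoeff, map_one, Matrix.one_apply]
    exact if_congr eq_comm rfl rfl
  have hdet : constantCoeff E.det = 1 := by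
    rw [RingHom.map_det, hEconst, Matrix.det_one]
  have hrel (r : T → MvPolynomial V K) (hr : ∑ F, r F * m F = 0) (F : T) :
      E.det * r F ∈ Δ.stanleyReisnerIdeal K := by
    have hs (i : ℕ) (hi : i < fs.length) : ∑ F, r F * C F i ∈ Δ.stanleyReisnerIdeal K := by
      rw [← hI]
      refine hreg.toIsWeaklyRegular.mem_ofList_of_sum_eq_zero (fun i => ∑ F, r F * C F i) ?_ i hi
      simp only [Finset.sum_mul]
      rw [Finset.sum_comm]
      refine Eq.trans ?_ hr
      refine Finset.sum_congr rfl fun F _ => ?_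
      rw [← hC F, Finset.mul_sum]
      exact Finset.sum_congr rfl fun i _ => by ring
    have hrE (G : T) : (Matrix.vecMul r E) G ∈ Δ.stanleyReisnerIdeal K := by
      have : (Matrix.vecMul r E) G =
          ∑ i ∈ Finset.range fs.length, (∑ F, r F * C F i) * D i G := by
        simp only [Matrix.vecMul, dotProduct, E, Finset.mul_sum, Finset.sum_mul]
        rw [Finset.sum_comm]
        exact Finset.sum_congr rfl fun i _ => Finset.sum_congr rfl fun F _ => by ring
      rw [this]
      exact Ideal.sum_mem _ fun i hi => Ideal.mul_mem_right _ _ (hs i (Finset.mem_range.1 hi))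
    have hadj : Matrix.vecMul (Matrix.vecMul r E) E.adjugate = E.det • r := by
      rw [Matrix.vecMul_vecMul, Matrix.mul_adjugate, Matrix.vecMul_smul, Matrix.vecMul_one]
    have := congrFun hadj F
    rw [Pi.smul_apply, smul_eq_mul] at this
    rw [← this, Matrix.vecMul, dotProduct]
    exact Ideal.sum_mem _ fun G _ => Ideal.mul_mem_right _ _ (hrE G)
  intro A B hA hB
  by_contra! hne
  obtain ⟨v, hvA, hvB⟩ := Finset.not_disjoint_iff.1 hne.2
  have hTne : (⟨A, hA⟩ : T) ≠ ⟨B, hB⟩ := fun hx => hne.1 (congrArg Subtype.val hx)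
  let r : T → MvPolynomial V K := fun F =>
    if F = ⟨A, hA⟩ then monomial (sqfreeExponent (B \ A)) 1
    else if F = ⟨B, hB⟩ then - monomial (sqfreeExponent (A \ B)) 1 else 0
  have hr : ∑ F, r F * m F = 0 := by
    rw [Finset.sum_eq_add_of_mem (⟨A, hA⟩ : T) ⟨B, hB⟩ (Finset.mem_univ _) (Finset.mem_univ _) hTne
      fun F _ hF => by simp [r, hF.1, hF.2]]
    simp only [r, if_true, if_neg hTne.symm, m, neg_mul, monomial_mul, mul_one]
    rw [add_neg_eq_zero]
    congr 2
    ext w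
    simp only [Finsupp.add_apply, sqfreeExponent_apply, Finset.mem_sdiff]
    by_cases h1 : w ∈ A <;> by_cases h2 : w ∈ B <;> simp [h1, h2]
  have hmem := hrel r hr ⟨A, hA⟩
  have hrA : r ⟨A, hA⟩ = monomial (sqfreeExponent (B \ A)) 1 := if_pos rfl
  rw [hrA, mem_stanleyReisnerIdeal_iff] at hmem
  have hsupp := hmem (sqfreeExponent (B \ A)) (by
    rw [mem_support_iff, coeff_mul_monomial', if_pos le_rfl, tsub_self, mul_one,
      ← constantCoeff_eq, hdet]
    exact one_ne_zero)
  rw [support_sqfreeExponent] at hsupp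
  refine hsupp.2 (hB.2.2 _ (Finset.ssubset_iff_subset_ne.2 ⟨Finset.sdiff_subset, fun hx => ?_⟩) ?_)
  · rw [← hx] at hvB
    exact (Finset.mem_sdiff.1 hvB).2 hvA
  · rw [← support_sqfreeExponent (B \ A)]
    exact Finsupp.support_nonempty_iff.2 hsupp.1

theorem isCompleteIntersection_iff [Finite V] :
    Δ.IsCompleteIntersection K ↔ Δ.HasDisjointNonfaces :=
  ⟨fun h => h.hasDisjointNonfaces, fun h => h.isCompleteIntersection⟩

variable [DecidableEq V]

theorem isLocallyCompleteIntersection_iff [Finite V] :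
    Δ.IsLocallyCompleteIntersection K ↔ Δ.HasLocallyDisjointNonfaces := by
  rw [hasLocallyDisjointNonfaces_iff]
  exact forall_congr' fun v => isCompleteIntersection_iff

/-! ### The classification -/

theorem IsBuildingBlock.hasLocallyDisjointNonfaces [Finite V] (h : Δ.IsBuildingBlock K) :
    Δ.HasLocallyDisjointNonfaces := by
  rcases h with ⟨h, -⟩ | ⟨m, -, h⟩ | ⟨m, -, h⟩ | h
  · exact h.hasDisjointNonfaces.hasLocallyDisjointNonfaces
  · exact h.hasDegreeLeTwo.hasLocallyDisjointNonfaces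
  · exact h.hasDegreeLeTwo.hasLocallyDisjointNonfaces
  · exact h.hasDegreeLeTwo.hasLocallyDisjointNonfaces

theorem IsBuildingBlock.isConnected [Finite V] (h : Δ.IsBuildingBlock K) : Δ.IsConnected := by
  rcases h with ⟨h, hd⟩ | ⟨m, hm, h⟩ | ⟨m, hm, h⟩ | h
  · obtain ⟨F, hF, hc⟩ := (le_dim_iff (n := 2)).1 hd
    exact h.hasDisjointNonfaces.isConnected hF hc
  · exact h.isConnected (by omega)
  · exact h.isConnected (by omega)
  · exact h.isConnected

theorem HasLocallyDisjointNonfaces.isBuildingBlock [Finite V] (h : Δ.HasLocallyDisjointNonfaces)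
    (hc : Δ.IsConnected) : Δ.IsBuildingBlock K := by
  by_cases h3 : ∃ F ∈ Δ.faces, 3 ≤ F.card
  · obtain ⟨F, hF, hFc⟩ := h3
    exact Or.inl ⟨(h.hasDisjointNonfaces hc hF hFc).isCompleteIntersection,
      (le_dim_iff (n := 2)).2 ⟨F, hF, hFc⟩⟩
  · push Not at h3
    exact Or.inr (isGon_or_isPointedPath_or_isPoint hc (h.hasDegreeLeTwo h3) h3)

theorem isLocallyCompleteIntersection_iff_exists_isDisjointUnion [Finite V] :
    Δ.IsLocallyCompleteIntersection K ↔
      ∃ (r : ℕ) (c : V → Fin r) (Γ : (i : Fin r) → AbstractSimplicialComplex {v : V // c v = i}),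
        Δ.IsDisjointUnion c Γ ∧ ∀ i, (Γ i).IsBuildingBlock K := by
  rw [isLocallyCompleteIntersection_iff]
  constructor
  · intro h
    obtain ⟨r, c, hU, hc⟩ := exists_isDisjointUnion_comap Δ
    exact ⟨r, c, _, hU, fun i => (h.of_embedding fun G => Iff.rfl).isBuildingBlock (hc i)⟩
  · rintro ⟨r, c, Γ, hU, hΓ⟩
    exact hU.hasLocallyDisjointNonfaces fun i => (hΓ i).hasLocallyDisjointNonfaces

end AbstractSimplicialComplex

namespace AbstractSimplicialComplex

variable {K : Type*} [Field K] {V : Type*} {Δ : AbstractSimplicialComplex V}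
  {F G : Finset V}

/-! ### Restriction of polynomials to faces -/

theorem exists_mem_faces_support_subset [Nonempty V] (n : V →₀ ℕ)
    (hn : n = 0 ∨ n.support ∈ Δ.faces) : ∃ F ∈ Δ.faces, n.support ⊆ F := by
  rcases hn with rfl | hn
  · exact ⟨_, Δ.singleton_mem (Classical.arbitrary V), by simp⟩
  · exact ⟨_, hn, subset_rfl⟩

section FaceEval

variable [DecidableEq V]

/-- The endomorphism of the polynomial ring that sets the variables outside `F` to zero. -/
noncomputable def faceEval (K : Type*) [Field K] (F : Finset V) :
    MvPolynomial V K →ₐ[K] MvPolynomial V K :=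
  aeval fun v => if v ∈ F then X v else 0

theorem faceEval_X (v : V) : faceEval K F (X v) = if v ∈ F then X v else 0 := by
  simp [faceEval]

theorem faceEval_monomial (n : V →₀ ℕ) (k : K) :
    faceEval K F (monomial n k) = if n.support ⊆ F then monomial n k else 0 := by
  rw [faceEval, aeval_monomial]
  split_ifs with h
  · rw [monomial_eq, algebraMap_eq]
    congr 1
    exact Finset.prod_congr rfl fun v hv => by simp only [if_pos (h hv)]
  · obtain ⟨v, hv, hvF⟩ := Finset.not_subset.1 h
    rw [Finsupp.prod, Finset.prod_eq_zero hv, mul_zero]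
    rw [if_neg hvF, zero_pow (Finsupp.mem_support_iff.1 hv)]

theorem coeff_faceEval (n : V →₀ ℕ) (q : MvPolynomial V K) :
    coeff n (faceEval K F q) = if n.support ⊆ F then coeff n q else 0 := by
  induction q using MvPolynomial.monomial_add_induction_on with
  | C a =>
    rw [← monomial_zero', faceEval_monomial, if_pos (by simp), coeff_monomial]
    split_ifs with h1 h2 h2
    · rfl
    · exact absurd (h1 ▸ Finset.empty_subset F) h2
    · rfl
    · rfl
  | monomial_add m b q _ _ ih =>
    rw [map_add, coeff_add, ih, faceEval_monomial, coeff_add]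
    split_ifs with h1 h2 h2
    · rfl
    · rw [coeff_monomial, if_neg, add_zero]
      rintro rfl
      exact h2 h1
    · rw [coeff_monomial, if_neg, coeff_zero]
      rintro rfl
      exact h1 h2
    · rw [coeff_zero, add_zero]

theorem faceEval_faceEval_of_subset (h : F ⊆ G) (q : MvPolynomial V K) :
    faceEval K F (faceEval K G q) = faceEval K F q := by
  ext n
  rw [coeff_faceEval, coeff_faceEval, coeff_faceEval]
  split_ifs with h1 h2
  · rfl
  · exact absurd (h1.trans h) h2
  · rfl

theorem faceEval_eq_zero_of_mem (hF : F ∈ Δ.faces) {q : MvPolynomial V K}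
    (hq : q ∈ Δ.stanleyReisnerIdeal K) : faceEval K F q = 0 := by
  rw [mem_stanleyReisnerIdeal_iff] at hq
  ext n
  rw [coeff_faceEval, coeff_zero, ite_eq_right_iff]
  intro hn
  by_contra hne
  obtain ⟨h0, hns⟩ := hq n (mem_support_iff.2 hne)
  exact hns (mem_faces_of_subset hF hn (Finsupp.support_nonempty_iff.2 h0))

theorem mem_stanleyReisnerIdeal_of_faceEval {𝓔 : Set (Finset V)}
    (h𝓔 : ∀ n : V →₀ ℕ, n = 0 ∨ n.support ∈ Δ.faces → ∃ F ∈ 𝓔, n.support ⊆ F)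
    {q : MvPolynomial V K} (hq : ∀ F ∈ 𝓔, faceEval K F q = 0) : q ∈ Δ.stanleyReisnerIdeal K := by
  rw [mem_stanleyReisnerIdeal_iff]
  intro n hn
  by_contra hno
  obtain ⟨F, hF, hs⟩ := h𝓔 n (by tauto)
  have := congrArg (coeff n) (hq F hF)
  rw [coeff_faceEval, if_pos hs, coeff_zero] at this
  exact mem_support_iff.1 hn this

/-- The homomorphism from the Stanley–Reisner ring that sets the variables outside a face to
zero. -/
noncomputable def stanleyReisnerFaceEval (K : Type*) [Field K] (hF : F ∈ Δ.faces) :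
    Δ.StanleyReisnerRing K →+* MvPolynomial V K :=
  Ideal.Quotient.lift _ (faceEval K F).toRingHom fun _ hq => faceEval_eq_zero_of_mem hF hq

theorem stanleyReisnerFaceEval_mk (hF : F ∈ Δ.faces) (q : MvPolynomial V K) :
    stanleyReisnerFaceEval K hF (Ideal.Quotient.mk _ q) = faceEval K F q := rfl

end FaceEval

/-! ### The dimension of the Stanley–Reisner ring -/

theorem ringKrullDim_stanleyReisnerRing_le [Finite V] {d : ℕ}
    (hd : ∀ F ∈ Δ.faces, F.card ≤ d) : ringKrullDim (Δ.StanleyReisnerRing K) ≤ (d : ℕ∞) := by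
  classical
  have := Fintype.ofFinite V
  -- The variables outside a prime `p` form a face, and generate the residue ring of `p`.
  have key (p : Ideal (Δ.StanleyReisnerRing K)) [p.IsPrime] :
      ringKrullDim (Δ.StanleyReisnerRing K ⧸ p) ≤ (d : ℕ∞) := by
    let F : Finset V := {v | Δ.stanleyReisnerVar K v ∉ p}
    have hmem (v : V) : v ∈ F ↔ Δ.stanleyReisnerVar K v ∉ p := by simp [F]
    have hFd : F.card ≤ d := by
      rcases F.eq_empty_or_nonempty with h | hne
      · simp [h]
      refine hd F ?_
      by_contra hF
      have h0 : ∏ v ∈ F, Δ.stanleyReisnerVar K v = 0 := by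
        simp only [stanleyReisnerVar]
        rw [← map_prod, Ideal.Quotient.eq_zero_iff_mem]
        exact Ideal.subset_span ⟨F, hne, hF, rfl⟩
      have h1 : ∏ v ∈ F, Δ.stanleyReisnerVar K v ∈ p := h0 ▸ Ideal.zero_mem p
      obtain ⟨v, hv, hvp⟩ := (Ideal.IsPrime.prod_mem_iff).1 h1
      exact (hmem v).1 hv hvp
    let f : MvPolynomial F K →ₐ[K] Δ.StanleyReisnerRing K ⧸ p :=
      aeval fun v : F => Ideal.Quotient.mk p (Δ.stanleyReisnerVar K v.1)
    have hf : Function.Surjective f := by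
      intro z
      obtain ⟨z, rfl⟩ := Ideal.Quotient.mk_surjective z
      obtain ⟨q, rfl⟩ := Ideal.Quotient.mk_surjective z
      induction q using MvPolynomial.induction_on with
      | C a => exact ⟨C a, by simp only [f, aeval_C]; rfl⟩
      | add q r hq hr =>
        obtain ⟨q', hq'⟩ := hq
        obtain ⟨r', hr'⟩ := hr
        exact ⟨q' + r', by simp only [map_add, hq', hr']⟩
      | mul_X q v hq =>
        obtain ⟨q', hq'⟩ := hq
        by_cases hv : v ∈ F
        · refine ⟨q' * X ⟨v, hv⟩, ?_⟩
          simp only [map_mul, hq']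
          congr 1
          simp only [f, aeval_X]
          rfl
        · refine ⟨0, ?_⟩
          have : Ideal.Quotient.mk p (Ideal.Quotient.mk (Δ.stanleyReisnerIdeal K) (X v)) = 0 :=
            Ideal.Quotient.eq_zero_iff_mem.2 (not_not.1 fun hno => hv ((hmem v).2 hno))
          rw [map_zero, map_mul, map_mul, this]
          exact (mul_zero (M₀ := Δ.StanleyReisnerRing K ⧸ p) _).symm
    refine (ringKrullDim_le_of_surjective f.toRingHom hf).trans ?_
    rw [MvPolynomial.ringKrullDim_of_isNoetherianRing, ringKrullDim_eq_zero_of_field, zero_add]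
    rw [Nat.card_eq_fintype_card, Fintype.card_coe]
    exact_mod_cast hFd
  refine iSup_le fun l => ?_
  have h1 := key l.head.asIdeal
  rw [ringKrullDim_quotient] at h1
  let l' : LTSeries (PrimeSpectrum.zeroLocus
      (l.head.asIdeal : Set (Δ.StanleyReisnerRing K))) :=
    { length := l.length
      toFun := fun i => ⟨l i, LTSeries.head_le l i⟩
      step := fun i => l.step i }
  exact (Order.LTSeries.length_le_krullDim l').trans h1

theorem card_le_ringKrullDim_stanleyReisnerRing (hF : F ∈ Δ.faces) :
    ((F.card : ℕ∞) : WithBot ℕ∞) ≤ ringKrullDim (Δ.StanleyReisnerRing K) := by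
  classical
  let g : MvPolynomial V K →ₐ[K] MvPolynomial F K :=
    aeval fun v => if h : v ∈ F then X ⟨v, h⟩ else 0
  have hg : ∀ q ∈ Δ.stanleyReisnerIdeal K, g q = 0 := by
    intro q hq
    have hle : Δ.stanleyReisnerIdeal K ≤ RingHom.ker g := by
      refine Ideal.span_le.2 ?_
      rintro _ ⟨G, hne, hG, rfl⟩
      have hGF : ¬ G ⊆ F := fun hs => hG (mem_faces_of_subset hF hs hne)
      obtain ⟨v, hv, hvF⟩ := Finset.not_subset.1 hGF
      rw [SetLike.mem_coe, RingHom.mem_ker, map_prod]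
      exact Finset.prod_eq_zero hv (by simp [g, hvF])
    exact hle hq
  let f : Δ.StanleyReisnerRing K →+* MvPolynomial F K := Ideal.Quotient.lift _ g.toRingHom hg
  have hf : Function.Surjective f := by
    intro q
    refine ⟨Ideal.Quotient.mk _ (rename Subtype.val q), ?_⟩
    change g (rename Subtype.val q) = q
    rw [aeval_rename]
    conv_rhs => rw [← aeval_X_left_apply q]
    congr 2
    ext v
    simp
  have := ringKrullDim_le_of_surjective f hf
  rwa [MvPolynomial.ringKrullDim_of_isNoetherianRing, ringKrullDim_eq_zero_of_field, zero_add,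
    Nat.card_eq_fintype_card, Fintype.card_coe] at this

/-! ### Cohen–Macaulayness away from the origin -/

section Family

variable [Finite V] {𝓖 : Set (Finset V)}

theorem localDepth_eq_ringKrullDim_of_pairwise_disjoint
    (h𝓖 : ∀ F ∈ 𝓖, ∀ G ∈ 𝓖, F ≠ G → Disjoint F G)
    (hI : Δ.stanleyReisnerIdeal K ≤ sqfreeIdeal K 𝓖) (p : Ideal (Δ.StanleyReisnerRing K))
    [p.IsMaximal] {s : MvPolynomial V K} (hs : s ∉ p.comap (Ideal.Quotient.mk _))
    (hJ : ∀ F ∈ 𝓖, s * ∏ v ∈ F, X v ∈ Δ.stanleyReisnerIdeal K) :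
    ((localDepth (Localization.AtPrime p) : ℕ∞) : WithBot ℕ∞) =
      ringKrullDim (Localization.AtPrime p) := by
  let L := (Set.toFinite 𝓖).toFinset.toList
  have hL : {F | F ∈ L} = 𝓖 := by
    ext F
    simp [L]
  have hmem (F : Finset V) : F ∈ L ↔ F ∈ 𝓖 := by simp [L]
  refine localDepth_eq_ringKrullDim_of_ofList (fs := L.map fun F => ∏ v ∈ F, X v)
    (isWeaklyRegular_prod_X L ?_) ?_ p hs ?_
  · exact (Finset.nodup_toList _).pairwise_of_forall_ne fun F hF G hG hne =>
      h𝓖 F ((hmem F).1 hF) G ((hmem G).1 hG) hne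
  · rwa [ofList_prod_X, hL]
  · rw [ofList_prod_X, hL]
    intro z hz
    have hle : sqfreeIdeal K 𝓖 ≤
        Submodule.comap (LinearMap.mulLeft (MvPolynomial V K) s) (Δ.stanleyReisnerIdeal K) := by
      refine Ideal.span_le.2 ?_
      rintro _ ⟨F, hF, rfl⟩
      exact hJ F hF
    exact hle hz

end Family

theorem HasDisjointNonfaces.localDepth_eq [Finite V] (h : Δ.HasDisjointNonfaces)
    (p : Ideal (Δ.StanleyReisnerRing K)) [hp : p.IsMaximal] :
    ((localDepth (Localization.AtPrime p) : ℕ∞) : WithBot ℕ∞) =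
      ringKrullDim (Localization.AtPrime p) := by
  refine localDepth_eq_ringKrullDim_of_pairwise_disjoint (𝓖 := {F | Δ.IsMinNonface F}) (s := 1)
    (fun F hF G hG hne => (h F G hF hG).resolve_left hne)
    stanleyReisnerIdeal_eq_sqfreeIdeal_isMinNonface.le p ?_ fun F hF => ?_
  · rw [Ideal.mem_comap, map_one]
    exact fun h1 => hp.ne_top ((Ideal.eq_top_iff_one _).2 h1)
  · rw [one_mul]
    exact Ideal.subset_span ⟨F, hF.1, hF.2.1, rfl⟩

/-- Where the variable of `v` is invertible the Stanley–Reisner ideal agrees with the one of the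
star of `v`. This is generated by the variables of the vertices that are not adjacent to `v` and the
monomials of the minimal nonfaces of the link, which have pairwise disjoint supports. -/
theorem HasLocallyDisjointNonfaces.localDepth_eq [DecidableEq V] [Finite V]
    (h : Δ.HasLocallyDisjointNonfaces) (p : Ideal (Δ.StanleyReisnerRing K)) [p.IsMaximal] {v : V}
    (hv : Δ.stanleyReisnerVar K v ∉ p) :
    ((localDepth (Localization.AtPrime p) : ℕ∞) : WithBot ℕ∞) =
      ringKrullDim (Localization.AtPrime p) := by
  let 𝓖 : Set (Finset V) := {F | v ∉ F ∧ insert v F ∉ Δ.faces ∧ ∀ G ⊂ F, insert v G ∈ Δ.faces}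
  have hcases (F : Finset V) (hF : F ∈ 𝓖) :
      Δ.IsMinNonfaceAt v F ∨ ∃ w, F = {w} ∧ ({v, w} : Finset V) ∉ Δ.faces := by
    by_cases hadj : ∀ w ∈ F, ({v, w} : Finset V) ∈ Δ.faces
    · refine Or.inl ⟨?_, hF.1, hadj, hF.2⟩
      rw [Finset.nonempty_iff_ne_empty]
      rintro rfl
      exact hF.2.1 (by simpa using Δ.singleton_mem v)
    · push Not at hadj
      obtain ⟨w, hw, hno⟩ := hadj
      refine Or.inr ⟨w, ?_, hno⟩
      by_contra hne
      exact hno (hF.2.2 {w} (Finset.ssubset_iff_subset_ne.2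
        ⟨Finset.singleton_subset_iff.2 hw, fun hx => hne hx.symm⟩))
  have hdisj (F : Finset V) (hF : Δ.IsMinNonfaceAt v F) (w : V)
      (hw : ({v, w} : Finset V) ∉ Δ.faces) : Disjoint F {w} :=
    Finset.disjoint_singleton_right.2 fun hx => hw (hF.2.2.1 w hx)
  refine localDepth_eq_ringKrullDim_of_pairwise_disjoint (𝓖 := 𝓖) (s := X v)
    (fun F hF G hG hne => ?_) (fun q hq => ?_) p hv fun F hF => ?_
  · rcases hcases F hF with hF' | ⟨w, rfl, hw⟩ <;> rcases hcases G hG with hG' | ⟨w', rfl, hw'⟩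
    · exact (h v F G hF' hG').resolve_left hne
    · exact hdisj F hF' w' hw'
    · exact (hdisj G hG' w hw).symm
    · rw [Finset.disjoint_singleton]
      rintro rfl
      exact hne rfl
  · rw [mem_stanleyReisnerIdeal_iff] at hq
    rw [mem_sqfreeIdeal_iff]
    intro n hn
    obtain ⟨h0, hns⟩ := hq n hn
    have hins : insert v (n.support.erase v) ∉ Δ.faces := fun hf =>
      hns (mem_faces_of_subset hf (fun w hw => by grind) (Finsupp.support_nonempty_iff.2 h0))
    obtain ⟨F, hF, hmin⟩ := (Set.toFinite {F : Finset V | insert v F ∉ Δ.faces}).exists_le_minimal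
      hins
    refine ⟨F, ⟨fun hx => by simpa using hF hx, hmin.1, fun G hG => ?_⟩,
      hF.trans (Finset.erase_subset _ _)⟩
    by_contra hno
    exact hG.not_subset (hmin.2 hno hG.subset)
  · rw [← Finset.prod_insert hF.1]
    exact Ideal.subset_span ⟨_, Finset.insert_nonempty _ _, hF.2.1, rfl⟩

/-! ### Regular sequences at the origin for graphs -/

theorem isWeaklyRegular_pair {R : Type*} [CommRing R] {a b : R} (ha : ∀ x, a * x = 0 → x = 0)
    (hb : ∀ x y, b * x = a * y → ∃ t, x = a * t) : IsWeaklyRegular R [a, b] := by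
  rw [isWeaklyRegular_cons_iff, isWeaklyRegular_singleton_iff]
  refine ⟨IsSMulRegular.of_right_eq_zero_of_smul ha, ?_⟩
  refine (isSMulRegular_quotient_iff_mem_of_smul_mem _ _).2 fun x hx => ?_
  rw [Submodule.mem_smul_pointwise_iff_exists] at hx ⊢
  obtain ⟨y, -, hy⟩ := hx
  obtain ⟨t, ht⟩ := hb x y hy.symm
  exact ⟨t, trivial, ht.symm⟩

/-- Polynomials on the members of a finite family of sets of variables that have the same
coefficients wherever both make sense are the restrictions of one polynomial. -/
theorem exists_faceEval_eq [DecidableEq V] {𝓔 : Finset (Finset V)} {t : Finset V → MvPolynomial V K}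
    (ht : ∀ F ∈ 𝓔, faceEval K F (t F) = t F)
    (hcompat : ∀ F ∈ 𝓔, ∀ G ∈ 𝓔, ∀ n : V →₀ ℕ, n.support ⊆ F → n.support ⊆ G →
      coeff n (t F) = coeff n (t G)) :
    ∃ q : MvPolynomial V K, ∀ F ∈ 𝓔, faceEval K F q = t F := by
  classical
  choose! sel hsel using fun (n : V →₀ ℕ) (h : ∃ F ∈ 𝓔, n.support ⊆ F) => h
  refine ⟨∑ n ∈ 𝓔.biUnion fun F => (t F).support, monomial n (coeff n (t (sel n))),
    fun F hF => ?_⟩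
  ext m
  rw [coeff_faceEval]
  split_ifs with hm
  · obtain ⟨h1, h2⟩ := hsel m ⟨F, hF, hm⟩
    rw [coeff_sum]
    simp only [coeff_monomial, Finset.sum_ite_eq', Finset.mem_biUnion]
    rw [hcompat _ h1 F hF m h2 hm, ite_eq_left_iff]
    intro hno
    by_contra hne
    exact hno ⟨F, hF, mem_support_iff.2 (Ne.symm hne)⟩
  · rw [← ht F hF, coeff_faceEval, if_neg hm]

/-- The polynomials `X u + X v` and `X u * X v` are coprime. -/
theorem exists_eq_add_mul_of_X_mul_X_mul_eq {u v : V} (huv : u ≠ v) {q r : MvPolynomial V K}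
    (h : X u * X v * q = (X u + X v) * r) : ∃ t, q = (X u + X v) * t := by
  have hu : ¬ (X u : MvPolynomial V K) ∣ X u + X v := fun hd =>
    huv (X_dvd_X.1 ((dvd_add_right dvd_rfl).1 hd))
  have hv : ¬ (X v : MvPolynomial V K) ∣ X u + X v := fun hd =>
    huv.symm (X_dvd_X.1 ((dvd_add_left dvd_rfl).1 hd))
  obtain ⟨r', rfl⟩ := (((X_prime (i := u)).dvd_or_dvd ⟨X v * q, by rw [← h]; ring⟩).resolve_left hu)
  have h1 : X v * q = (X u + X v) * r' :=
    mul_left_cancel₀ (X_ne_zero u) (by rw [← mul_assoc, h]; ring)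
  obtain ⟨t, rfl⟩ := (((X_prime (i := v)).dvd_or_dvd ⟨q, h1.symm⟩).resolve_left hv)
  exact ⟨t, mul_left_cancel₀ (X_ne_zero v) (by rw [h1]; ring)⟩

section Origin

variable [Fintype V] [DecidableEq V]

theorem faceEval_sum_X : faceEval K F (∑ v, X v) = ∑ v ∈ F, X v := by
  rw [map_sum]
  simp [faceEval_X]

theorem faceEval_sum_X_ne_zero (hF : F.Nonempty) :
    faceEval K F (∑ v, X v) ≠ 0 := by
  obtain ⟨v, hv⟩ := hF
  intro h
  have := congrArg (coeff (Finsupp.single v 1)) h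
  rw [faceEval_sum_X, coeff_sum, coeff_zero, Finset.sum_eq_single v] at this
  · simp at this
  · intro w _ hw
    rw [coeff_X, if_neg]
    exact fun h => hw (Finsupp.single_left_injective one_ne_zero h)
  · exact fun hno => absurd hv hno

theorem eq_zero_of_sum_X_mul_eq_zero [Nonempty V] (x : Δ.StanleyReisnerRing K)
    (hx : Ideal.Quotient.mk _ (∑ v, X v) * x = 0) : x = 0 := by
  obtain ⟨q, rfl⟩ := Ideal.Quotient.mk_surjective x
  rw [← map_mul, Ideal.Quotient.eq_zero_iff_mem] at hx
  rw [Ideal.Quotient.eq_zero_iff_mem]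
  refine mem_stanleyReisnerIdeal_of_faceEval exists_mem_faces_support_subset fun F hF => ?_
  have := faceEval_eq_zero_of_mem hF hx
  rw [map_mul] at this
  exact (mul_eq_zero.1 this).resolve_left (faceEval_sum_X_ne_zero (nonempty_of_mem_faces hF))

theorem faceEval_sum_prod_X (hF : F.card = 2) :
    faceEval K F (∑ G ∈ Finset.powersetCard 2 Finset.univ, ∏ v ∈ G, X v) = ∏ v ∈ F, X v := by
  rw [map_sum, Finset.sum_eq_single F]
  · rw [map_prod]
    exact Finset.prod_congr rfl fun v hv => by rw [faceEval_X, if_pos hv]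
  · intro G hG hne
    have hGF : ¬ G ⊆ F := fun hs => hne (Finset.eq_of_subset_of_card_le hs
      (by rw [hF, (Finset.mem_powersetCard.1 hG).2]))
    obtain ⟨v, hv, hvF⟩ := Finset.not_subset.1 hGF
    rw [map_prod]
    exact Finset.prod_eq_zero hv (by rw [faceEval_X, if_neg hvF])
  · exact fun hno => absurd (Finset.mem_powersetCard.2 ⟨Finset.subset_univ F, hF⟩) hno

/-- In the Stanley–Reisner ring of a connected graph the sum of the variables and the sum of the
products of two variables form a regular sequence. On an edge `{u, v}` they are `X u + X v` and
`X u * X v`, which are coprime. Quotients by `X u + X v` on the edges agree at the vertices, and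
since the graph is connected, they have the same constant term, so that they can be glued. -/
theorem isWeaklyRegular_of_isConnected [Nontrivial V] (hc : Δ.IsConnected)
    (h3 : ∀ F ∈ Δ.faces, F.card < 3) :
    IsWeaklyRegular (Δ.StanleyReisnerRing K) [
      Ideal.Quotient.mk (Δ.stanleyReisnerIdeal K) (∑ v, X v),
      Ideal.Quotient.mk (Δ.stanleyReisnerIdeal K)
        (∑ G ∈ Finset.powersetCard 2 (Finset.univ : Finset V), ∏ v ∈ G, X v)] := by
  classical
  refine isWeaklyRegular_pair eq_zero_of_sum_X_mul_eq_zero fun x y hxy => ?_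
  obtain ⟨q, rfl⟩ := Ideal.Quotient.mk_surjective x
  obtain ⟨r, rfl⟩ := Ideal.Quotient.mk_surjective y
  rw [← map_mul, ← map_mul, Ideal.Quotient.eq] at hxy
  let 𝓔 : Finset (Finset V) := {F | F ∈ Δ.faces ∧ F.card = 2}
  have h𝓔 (F : Finset V) : F ∈ 𝓔 ↔ F ∈ Δ.faces ∧ F.card = 2 := by simp [𝓔]
  have hcov (n : V →₀ ℕ) (hn : n = 0 ∨ n.support ∈ Δ.faces) :
      ∃ F ∈ (𝓔 : Set (Finset V)), n.support ⊆ F := by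
    obtain ⟨F, hF, hnF⟩ := exists_mem_faces_support_subset n hn
    obtain ⟨G, hG, hFG⟩ := exists_isFacet_superset hF
    obtain ⟨u, v, huv, rfl⟩ := (isFacet_iff_of_card_lt_three hc h3 G).1 hG
    exact ⟨_, (h𝓔 _).2 ⟨hG.1, Finset.card_pair huv.1⟩, hnF.trans hFG⟩
  have hexists (F : Finset V) (hF : F ∈ 𝓔) : ∃ t, faceEval K F t = t ∧
      faceEval K F q = faceEval K F (∑ v : V, X v) * t := by
    obtain ⟨hFf, hF2⟩ := (h𝓔 F).1 hF
    have h1 := faceEval_eq_zero_of_mem hFf hxy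
    rw [map_sub, map_mul, map_mul, faceEval_sum_prod_X hF2, sub_eq_zero] at h1
    obtain ⟨u, v, huv, rfl⟩ := Finset.card_eq_two.1 hF2
    rw [faceEval_sum_X, Finset.prod_pair huv, Finset.sum_pair huv] at h1
    obtain ⟨t, ht⟩ := exists_eq_add_mul_of_X_mul_X_mul_eq huv h1
    refine ⟨faceEval K {u, v} t, faceEval_faceEval_of_subset subset_rfl t, ?_⟩
    rw [← faceEval_faceEval_of_subset subset_rfl q, ht, map_mul, faceEval_sum_X,
      Finset.sum_pair huv, map_add, faceEval_X, faceEval_X, if_pos (by simp), if_pos (by simp)]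
  choose! t ht1 ht2 using hexists
  have hcoeff (F : Finset V) (hF : F ∈ 𝓔) (u : V) (hu : u ∈ F) (n : V →₀ ℕ)
      (hn : n.support ⊆ {u}) : coeff n (t F) = coeff (Finsupp.single u 1 + n) q := by
    have hsupp : (Finsupp.single u 1 + n).support ⊆ {u} :=
      Finsupp.support_add.trans (Finset.union_subset Finsupp.support_single_subset hn)
    have h1 := congrArg (coeff (Finsupp.single u 1 + n)) (ht2 F hF)
    rw [coeff_faceEval, if_pos (hsupp.trans (Finset.singleton_subset_iff.2 hu)), faceEval_sum_X,
      Finset.sum_mul, coeff_sum, Finset.sum_eq_single u, coeff_X_mul] at h1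
    · exact h1.symm
    · intro v _ hv
      rw [coeff_X_mul', if_neg]
      exact fun hx => hv (Finset.mem_singleton.1 (hsupp hx))
    · exact fun hno => absurd hu hno
  have hconst (u w : V) : coeff (Finsupp.single u 1) q = coeff (Finsupp.single w 1) q := by
    obtain ⟨walk⟩ := hc.preconnected u w
    induction walk with
    | nil => rfl
    | @cons u v w huv _ ih =>
      have he : ({u, v} : Finset V) ∈ 𝓔 := (h𝓔 _).2 ⟨huv.2, Finset.card_pair huv.1⟩
      have h1 := hcoeff _ he u (by simp) 0 (by simp)
      have h2 := hcoeff _ he v (by simp) 0 (by simp)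
      rw [add_zero] at h1 h2
      exact (h1.symm.trans h2).trans ih
  obtain ⟨s, hs⟩ := exists_faceEval_eq ht1 (by
    intro F hF G hG n hnF hnG
    have hF2 := ((h𝓔 F).1 hF).2
    have hG2 := ((h𝓔 G).1 hG).2
    rcases Nat.lt_or_ge n.support.card 2 with hlt | hge
    · rcases n.support.eq_empty_or_nonempty with h0 | ⟨u, hu⟩
      · obtain rfl := Finsupp.support_eq_empty.1 h0
        obtain ⟨u, hu⟩ : F.Nonempty := Finset.card_pos.1 (by omega)
        obtain ⟨w, hw⟩ : G.Nonempty := Finset.card_pos.1 (by omega)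
        rw [hcoeff F hF u hu 0 (by simp), hcoeff G hG w hw 0 (by simp), add_zero, add_zero,
          hconst u w]
      · have hn : n.support ⊆ {u} := fun w hw =>
          Finset.mem_singleton.2 (Finset.card_le_one.1 (by omega) w hw u hu)
        rw [hcoeff F hF u (hnF hu) n hn, hcoeff G hG u (hnG hu) n hn]
    · have h1 := Finset.eq_of_subset_of_card_le hnF (by omega)
      have h2 := Finset.eq_of_subset_of_card_le hnG (by omega)
      rw [← h1, ← h2])
  refine ⟨Ideal.Quotient.mk _ s, ?_⟩
  rw [← map_mul, Ideal.Quotient.eq]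
  refine mem_stanleyReisnerIdeal_of_faceEval hcov fun F hF => ?_
  rw [map_sub, map_mul, hs F hF, ht2 F hF, sub_self]

end Origin

theorem localDepth_eq_of_isWeaklyRegular [Finite V] (p : Ideal (Δ.StanleyReisnerRing K))
    [hp : p.IsMaximal] {rs : List (Δ.StanleyReisnerRing K)}
    (hreg : IsWeaklyRegular (Δ.StanleyReisnerRing K) rs)
    (hmem : ∀ r ∈ rs, r ∈ p) (hd : ∀ F ∈ Δ.faces, F.card ≤ rs.length) :
    ((localDepth (Localization.AtPrime p) : ℕ∞) : WithBot ℕ∞) =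
      ringKrullDim (Localization.AtPrime p) := by
  refine localDepth_eq_ringKrullDim_of_isWeaklyRegular
    (hreg.of_isLocalization (Localization.AtPrime p) p.primeCompl) ?_ ?_
  · intro r hr
    obtain ⟨s, hs, rfl⟩ := List.mem_map.1 hr
    rw [← Localization.AtPrime.map_eq_maximalIdeal]
    exact Ideal.mem_map_of_mem _ (hmem s hs)
  · rw [List.length_map, IsLocalization.AtPrime.ringKrullDim_eq_height p]
    exact (Ideal.height_le_ringKrullDim_of_ne_top hp.ne_top).trans
      (ringKrullDim_stanleyReisnerRing_le hd)

theorem HasLocallyDisjointNonfaces.isCohenMacaulayRing [DecidableEq V] [Finite V] [Nonempty V]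
    (h : Δ.HasLocallyDisjointNonfaces) (hc : Δ.dim = 0 ∨ Δ.IsConnected) :
    IsCohenMacaulayRing (Δ.StanleyReisnerRing K) := by
  have := Fintype.ofFinite V
  refine ⟨inferInstance, fun p hp => ?_⟩
  by_cases hv : ∃ v, Δ.stanleyReisnerVar K v ∉ p
  · obtain ⟨v, hv⟩ := hv
    exact h.localDepth_eq p hv
  push Not at hv
  have hsum : Ideal.Quotient.mk (Δ.stanleyReisnerIdeal K) (∑ v, X v) ∈ p := by
    rw [map_sum]
    exact Ideal.sum_mem _ fun v _ => hv v
  rcases hc with hc | hc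
  · refine localDepth_eq_of_isWeaklyRegular p (rs := [Ideal.Quotient.mk _ (∑ v, X v)]) ?_
      (by simpa using hsum) fun F hF => ?_
    · rw [isWeaklyRegular_singleton_iff]
      exact IsSMulRegular.of_right_eq_zero_of_smul eq_zero_of_sum_X_mul_eq_zero
    · by_contra hno
      have := (le_dim_iff (n := 1)).2 ⟨F, hF, not_le.1 hno⟩
      omega
  · by_cases h3 : ∃ F ∈ Δ.faces, 3 ≤ F.card
    · obtain ⟨F, hF, hFc⟩ := h3
      exact (h.hasDisjointNonfaces hc hF hFc).localDepth_eq p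
    push Not at h3
    rcases subsingleton_or_nontrivial V with hV | hV
    · refine HasDisjointNonfaces.localDepth_eq (fun F _ hF _ => ?_) p
      have h1 := hF.two_le_card
      have h2 := F.card_le_univ
      have h3 := Fintype.card_le_one_iff_subsingleton.2 hV
      omega
    · refine localDepth_eq_of_isWeaklyRegular p (isWeaklyRegular_of_isConnected hc h3) ?_
        fun F hF => Nat.lt_succ_iff.1 (h3 F hF)
      simp only [List.mem_cons, List.not_mem_nil, or_false, forall_eq_or_imp, forall_eq]
      refine ⟨hsum, ?_⟩
      rw [map_sum]
      refine Ideal.sum_mem _ fun G hG => ?_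
      rw [map_prod]
      obtain ⟨v, hvG⟩ : G.Nonempty :=
        Finset.card_pos.1 (by rw [(Finset.mem_powersetCard.1 hG).2]; omega)
      exact Ideal.mem_of_dvd _ (Finset.dvd_prod_of_mem _ hvG) (hv v)

/-! ### Disconnected complexes -/

/-- A local ring whose maximal ideal is the sum of two nonzero ideals with product zero (its
punctured spectrum is disconnected) has depth at most one. For a regular sequence starting with
`a₁ + a₂, b₁ + b₂` the relation `(b₁ + b₂) * a₁ = (a₁ + a₂) * b₁` shows that `a₁ + a₂` divides `a₁`.
Hence `a₁ + a₂` lies in one of the ideals and annihilates the other one. -/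
theorem localDepth_le_one {R : Type*} [CommRing R] [IsLocalRing R] {M₁ M₂ : Ideal R}
    (hsup : IsLocalRing.maximalIdeal R ≤ M₁ ⊔ M₂) (hmul : M₁ * M₂ = ⊥) (h₁ : M₁ ≠ ⊥)
    (h₂ : M₂ ≠ ⊥) : localDepth R ≤ 1 := by
  refine iSup₂_le fun rs hrs => ?_
  obtain ⟨hreg, hmem⟩ := hrs
  match rs with
  | [] => simp
  | [a] => simp
  | a :: b :: l =>
    exfalso
    have hz {x y : R} (hx : x ∈ M₁) (hy : y ∈ M₂) : x * y = 0 := by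
      have := Ideal.mul_mem_mul hx hy
      rwa [hmul, Ideal.mem_bot] at this
    have hw := hreg.toIsWeaklyRegular
    rw [isWeaklyRegular_cons_iff, isWeaklyRegular_cons_iff] at hw
    obtain ⟨ha, hb, -⟩ := hw
    obtain ⟨a₁, ha₁, a₂, ha₂, rfl⟩ := Submodule.mem_sup.1 (hsup (hmem a (by simp)))
    obtain ⟨b₁, hb₁, b₂, hb₂, rfl⟩ := Submodule.mem_sup.1 (hsup (hmem b (by simp)))
    have hdvd := (isSMulRegular_quotient_iff_mem_of_smul_mem _ _).1 hb a₁ (by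
      rw [Submodule.mem_smul_pointwise_iff_exists]
      refine ⟨b₁, trivial, ?_⟩
      rw [smul_eq_mul, smul_eq_mul]
      linear_combination hz hb₁ ha₂ - hz ha₁ hb₂)
    rw [Submodule.mem_smul_pointwise_iff_exists] at hdvd
    obtain ⟨t, -, ht⟩ := hdvd
    rw [smul_eq_mul] at ht
    have hann {M : Ideal R} (hM : M ≠ ⊥) (hx : ∀ x ∈ M, (a₁ + a₂) * x = 0) : False :=
      hM ((Submodule.eq_bot_iff M).2 fun x hxM => ha.right_eq_zero_of_smul (hx x hxM))
    rcases IsLocalRing.isUnit_or_isUnit_one_sub_self t with hu | hu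
    · have : a₂ ∈ M₁ := (Ideal.unit_mul_mem_iff_mem M₁ hu).1 (by
        have : t * a₂ = (1 - t) * a₁ := by linear_combination ht
        rw [this]
        exact Ideal.mul_mem_left _ _ ha₁)
      exact hann h₂ fun x hx => hz (add_mem ha₁ this) hx
    · have : a₁ ∈ M₂ := (Ideal.unit_mul_mem_iff_mem M₂ hu).1 (by
        have : (1 - t) * a₁ = t * a₂ := by linear_combination -ht
        rw [this]
        exact Ideal.mul_mem_left _ _ ha₂)
      exact hann h₁ fun x hx => by rw [mul_comm]; exact hz hx (add_mem this ha₂)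

/-- The projection of the Stanley–Reisner ring to the ground field, which sends the variables to
zero. Its kernel is the homogeneous maximal ideal. -/
noncomputable def stanleyReisnerAugmentation (K : Type*) [Field K]
    (Δ : AbstractSimplicialComplex V) : Δ.StanleyReisnerRing K →+* K :=
  Ideal.Quotient.lift _ constantCoeff fun q hq => by
    by_contra hne
    exact (mem_stanleyReisnerIdeal_iff.1 hq 0 (mem_support_iff.2 hne)).1 rfl

theorem stanleyReisnerAugmentation_mk (q : MvPolynomial V K) :
    stanleyReisnerAugmentation K Δ (Ideal.Quotient.mk _ q) = constantCoeff q := rfl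

theorem isMaximal_ker_stanleyReisnerAugmentation :
    (RingHom.ker (stanleyReisnerAugmentation K Δ)).IsMaximal :=
  RingHom.ker_isMaximal_of_surjective _ fun a =>
    ⟨Ideal.Quotient.mk _ (C a), by rw [stanleyReisnerAugmentation_mk, constantCoeff_C]⟩

theorem ker_stanleyReisnerAugmentation_le :
    RingHom.ker (stanleyReisnerAugmentation K Δ) ≤
      Ideal.span (Set.range (Δ.stanleyReisnerVar K)) := by
  intro x hx
  obtain ⟨q, rfl⟩ := Ideal.Quotient.mk_surjective x
  rw [RingHom.mem_ker, stanleyReisnerAugmentation_mk, constantCoeff_eq] at hx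
  have hq : q ∈ Ideal.span (X '' (Set.univ : Set V)) := by
    rw [mem_ideal_span_X_image]
    intro n hn
    by_contra! h
    have : n = 0 := Finsupp.ext fun v => h v trivial
    rw [mem_support_iff, this] at hn
    exact hn hx
  have := Ideal.mem_map_of_mem (Ideal.Quotient.mk (Δ.stanleyReisnerIdeal K)) hq
  rwa [Ideal.map_span, Set.image_univ, ← Set.range_comp] at this

theorem algebraMap_stanleyReisnerVar_ne_zero {p : Ideal (Δ.StanleyReisnerRing K)} [p.IsPrime]
    (hp : p = RingHom.ker (stanleyReisnerAugmentation K Δ)) (v : V) :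
    algebraMap _ (Localization.AtPrime p) (Δ.stanleyReisnerVar K v) ≠ 0 := by
  intro h
  rw [IsLocalization.map_eq_zero_iff p.primeCompl] at h
  obtain ⟨⟨s, hs⟩, h⟩ := h
  obtain ⟨q, rfl⟩ := Ideal.Quotient.mk_surjective s
  replace hs : ¬ Ideal.Quotient.mk _ q ∈ p := hs
  rw [hp, RingHom.mem_ker, stanleyReisnerAugmentation_mk, constantCoeff_eq] at hs
  change Ideal.Quotient.mk _ q * Ideal.Quotient.mk _ (X v) = 0 at h
  rw [← map_mul, Ideal.Quotient.eq_zero_iff_mem, mem_stanleyReisnerIdeal_iff] at h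
  refine (h (Finsupp.single v 1) ?_).2 ?_
  · rw [mem_support_iff, mul_comm, ← add_zero (Finsupp.single v 1), coeff_X_mul]
    exact hs
  · rw [Finsupp.support_single _ one_ne_zero]
    exact Δ.singleton_mem v

/-- Setting all variables except those of `u` and `v`, or except that of `u`, to zero gives two steps
of a chain of primes. -/
theorem two_le_height_ker_stanleyReisnerAugmentation {u v : V} (huv : u ≠ v)
    (hE : ∃ F ∈ Δ.faces, u ∈ F ∧ v ∈ F) :
    2 ≤ (RingHom.ker (stanleyReisnerAugmentation K Δ)).height := by
  classical
  have hface : ({u, v} : Finset V) ∈ Δ.faces := by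
    obtain ⟨F, hF, hu, hv⟩ := hE
    exact mem_faces_of_subset hF (by grind) (by simp)
  have hp := (isMaximal_ker_stanleyReisnerAugmentation (K := K) (Δ := Δ)).isPrime
  have h0 : (RingHom.ker (stanleyReisnerFaceEval K hface)).IsPrime := RingHom.ker_isPrime _
  have h1 : (RingHom.ker (stanleyReisnerFaceEval K (Δ.singleton_mem u))).IsPrime :=
    RingHom.ker_isPrime _
  have hlt1 : RingHom.ker (stanleyReisnerFaceEval K hface) <
      RingHom.ker (stanleyReisnerFaceEval K (Δ.singleton_mem u)) := by
    refine SetLike.lt_iff_le_and_exists.2 ⟨fun x hx => ?_, Δ.stanleyReisnerVar K v, ?_, ?_⟩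
    · obtain ⟨q, rfl⟩ := Ideal.Quotient.mk_surjective x
      rw [RingHom.mem_ker, stanleyReisnerFaceEval_mk] at hx ⊢
      rw [← faceEval_faceEval_of_subset (G := {u, v}) (by simp), hx, map_zero]
    · rw [RingHom.mem_ker, stanleyReisnerVar, stanleyReisnerFaceEval_mk, faceEval_X,
        if_neg (by simpa using huv.symm)]
    · rw [RingHom.mem_ker, stanleyReisnerVar, stanleyReisnerFaceEval_mk, faceEval_X,
        if_pos (by simp)]
      exact X_ne_zero v
  have hlt2 : RingHom.ker (stanleyReisnerFaceEval K (Δ.singleton_mem u)) <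
      RingHom.ker (stanleyReisnerAugmentation K Δ) := by
    refine SetLike.lt_iff_le_and_exists.2 ⟨fun x hx => ?_, Δ.stanleyReisnerVar K u, ?_, ?_⟩
    · obtain ⟨q, rfl⟩ := Ideal.Quotient.mk_surjective x
      rw [RingHom.mem_ker, stanleyReisnerFaceEval_mk] at hx
      rw [RingHom.mem_ker, stanleyReisnerAugmentation_mk, constantCoeff_eq]
      have := congrArg (coeff 0) hx
      rwa [coeff_faceEval, if_pos (by simp), coeff_zero] at this
    · rw [RingHom.mem_ker, stanleyReisnerVar, stanleyReisnerAugmentation_mk, constantCoeff_X]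
    · rw [RingHom.mem_ker, stanleyReisnerVar, stanleyReisnerFaceEval_mk, faceEval_X,
        if_pos (by simp)]
      exact X_ne_zero u
  have e1 := Ideal.height_add_one_le_of_lt_of_isPrime hlt1
  have e2 := Ideal.height_add_one_le_of_lt_of_isPrime hlt2
  calc (2 : ℕ∞) = 0 + 1 + 1 := by norm_num
    _ ≤ _ := (add_le_add_left (le_trans (add_le_add_left (zero_le) 1) e1) 1).trans e2

theorem dim_eq_zero_or_isConnected_of_isCohenMacaulayRing [DecidableEq V] [Finite V] [Nonempty V]
    (h : IsCohenMacaulayRing (Δ.StanleyReisnerRing K)) : Δ.dim = 0 ∨ Δ.IsConnected := by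
  by_contra! hno
  obtain ⟨hdim, hconn⟩ := hno
  have hdim0 : (0 : ℤ) ≤ Δ.dim :=
    (le_dim_iff (n := 0)).2 ⟨_, Δ.singleton_mem (Classical.arbitrary V), by simp⟩
  obtain ⟨F, hF, hFc⟩ := (le_dim_iff (Δ := Δ) (n := 1)).1 (by omega)
  obtain ⟨u, v, hu, hv, huv⟩ := Finset.one_lt_card_iff.1 hFc
  have hpre : ¬ Δ.graph.Preconnected := fun hp => hconn ⟨hp⟩
  simp only [SimpleGraph.Preconnected, not_forall] at hpre
  obtain ⟨a, b, hab⟩ := hpre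
  have hmax := isMaximal_ker_stanleyReisnerAugmentation (K := K) (Δ := Δ)
  have hprime := hmax.isPrime
  obtain ⟨p, hp⟩ : ∃ p, p = RingHom.ker (stanleyReisnerAugmentation K Δ) := ⟨_, rfl⟩
  rw [← hp] at hmax hprime
  let φ := algebraMap (Δ.StanleyReisnerRing K) (Localization.AtPrime p)
  let M (s : Set V) : Ideal (Localization.AtPrime p) :=
    Ideal.span ((fun v => φ (Δ.stanleyReisnerVar K v)) '' s)
  have hM (s : Set V) (w : V) (hw : w ∈ s) : M s ≠ ⊥ := by
    intro hbot
    have : φ (Δ.stanleyReisnerVar K w) ∈ M s := Ideal.subset_span ⟨w, hw, rfl⟩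
    rw [hbot, Ideal.mem_bot] at this
    exact algebraMap_stanleyReisnerVar_ne_zero hp w this
  let U : Set V := {w | Δ.graph.Reachable a w}
  have hdepth : localDepth (Localization.AtPrime p) ≤ 1 := by
    refine localDepth_le_one (M₁ := M U) (M₂ := M Uᶜ) ?_ ?_
      (hM _ a (SimpleGraph.Reachable.refl a)) (hM _ b hab)
    · rw [← Localization.AtPrime.map_eq_maximalIdeal]
      refine (Ideal.map_mono (hp.le.trans ker_stanleyReisnerAugmentation_le)).trans ?_
      rw [Ideal.map_span, ← Ideal.span_union, ← Set.image_union, Set.union_compl_self,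
        Set.image_univ, ← Set.range_comp]
      exact le_rfl
    · rw [Ideal.span_mul_span', Ideal.span_eq_bot]
      rintro _ ⟨_, ⟨w, hw, rfl⟩, _, ⟨z, hz, rfl⟩, rfl⟩
      change φ _ * φ _ = 0
      have hwz : w ≠ z := fun h => hz (h ▸ hw)
      have h0 : Δ.stanleyReisnerVar K w * Δ.stanleyReisnerVar K z = 0 := by
        rw [stanleyReisnerVar, stanleyReisnerVar, ← map_mul, Ideal.Quotient.eq_zero_iff_mem]
        refine Ideal.subset_span ⟨{w, z}, by simp, fun hface => hz ?_, (Finset.prod_pair hwz).symm⟩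
        exact SimpleGraph.Reachable.trans hw (SimpleGraph.Adj.reachable ⟨hwz, hface⟩)
      rw [← map_mul, h0, map_zero]
  have hdim2 := two_le_height_ker_stanleyReisnerAugmentation (K := K) huv ⟨F, hF, hu, hv⟩
  rw [← hp] at hdim2
  have heq := h.2 p
  rw [IsLocalization.AtPrime.ringKrullDim_eq_height p, WithBot.coe_inj] at heq
  rw [heq] at hdepth
  exact absurd (hdim2.trans hdepth) (by norm_num)

end AbstractSimplicialComplex

/-! ### Čech cochains with a common denominator -/

section Cech

variable {A : Type*} [CommRing A] {V : Type*} {x : V → A} {F G : Finset V}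

/-- The map `A → A_{x_F}`, `a ↦ a / x_F ^ k`. -/
noncomputable def cechFrac (x : V → A) (F : Finset V) (k : ℕ) : A →ₗ[A] CechModule x F :=
  LinearMap.toSpanSingleton A (CechModule x F)
    (IsLocalization.Away.invSelf (∏ v ∈ F, x v) ^ k)

theorem koszulToCech_eq_cechFrac : koszulToCech x F = cechFrac x F 1 := by
  rw [koszulToCech, cechFrac, pow_one]

theorem pow_smul_cechFrac (k : ℕ) (a : A) :
    (∏ v ∈ F, x v) ^ k • cechFrac x F k a = algebraMap A (CechModule x F) a := by
  rw [cechFrac, LinearMap.toSpanSingleton_apply, smul_comm, Algebra.smul_def,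
    Algebra.smul_def ((∏ v ∈ F, x v) ^ k), map_pow, ← mul_pow,
    IsLocalization.Away.mul_invSelf, one_pow, mul_one]

theorem pow_smul_cechModule_injective (h : F ⊆ G) (k : ℕ) {y z : CechModule x G}
    (hyz : (∏ v ∈ F, x v) ^ k • y = (∏ v ∈ F, x v) ^ k • z) : y = z := by
  rw [Algebra.smul_def, Algebra.smul_def, map_pow] at hyz
  exact ((isUnit_algebraMap_cechModule x F G h).pow k).mul_left_cancel hyz

theorem cechModule_eq_of_prod_eq_zero (h : ∏ v ∈ F, x v = 0) (y z : CechModule x F) : y = z := by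
  have h1 : (∏ v ∈ F, x v) ^ 1 = 0 := by rw [pow_one, h]
  exact pow_smul_cechModule_injective subset_rfl 1 ((congrArg (· • y) h1).trans
    ((zero_smul A y).trans ((zero_smul A z).symm.trans (congrArg (· • z) h1).symm)))

theorem cechFrac_add (k j : ℕ) (a : A) :
    cechFrac x F (k + j) ((∏ v ∈ F, x v) ^ j * a) = cechFrac x F k a := by
  apply pow_smul_cechModule_injective subset_rfl (k + j)
  rw [pow_smul_cechFrac, add_comm k j, pow_add, mul_smul, pow_smul_cechFrac, Algebra.smul_def,
    map_mul, map_pow]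

theorem exists_pow_mul_eq_zero_of_cechFrac_eq_zero {k : ℕ} {a : A} (h : cechFrac x F k a = 0) :
    ∃ j, (∏ v ∈ F, x v) ^ j * a = 0 := by
  have h1 := pow_smul_cechFrac (x := x) (F := F) k a
  rw [h, smul_zero, eq_comm, IsLocalization.map_eq_zero_iff (Submonoid.powers (∏ v ∈ F, x v))]
    at h1
  obtain ⟨⟨_, j, rfl⟩, hj⟩ := h1
  exact ⟨j, hj⟩

theorem exists_cechFrac_eq (z : CechModule x F) : ∃ k a, cechFrac x F k a = z := by
  obtain ⟨k, a, h⟩ := IsLocalization.Away.surj (∏ v ∈ F, x v) z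
  refine ⟨k, a, pow_smul_cechModule_injective subset_rfl k ?_⟩
  rw [pow_smul_cechFrac, ← h, Algebra.smul_def, mul_comm, map_pow]

theorem cechRes_cechFrac [DecidableEq V] (h : F ⊆ G) (k : ℕ) (a : A) :
    cechRes x F G h (cechFrac x F k a) = cechFrac x G k ((∏ v ∈ G \ F, x v) ^ k * a) := by
  apply pow_smul_cechModule_injective h k
  rw [← map_smul, pow_smul_cechFrac, ← map_smul, smul_eq_mul, ← mul_assoc, ← mul_pow, mul_comm
    (∏ v ∈ F, x v), Finset.prod_sdiff h, ← smul_eq_mul, map_smul, pow_smul_cechFrac]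
  exact AlgHom.commutes (IsLocalization.Away.liftAlgHom (A := A) (∏ v ∈ F, x v)
    (f := Algebra.ofId A (CechModule x G)) (isUnit_algebraMap_cechModule x F G h)) a

/-- The Čech cochain with components `p F / x_F ^ k`. -/
noncomputable def cechFamily (x : V → A) (k : ℕ) (p : Finset V → A) (i : ℕ) :
    SetCochain (CechModule x) i :=
  fun F => cechFrac x F.1 k (p F.1)

theorem exists_cechFamily_eq [Finite V] {i : ℕ} (c : SetCochain (CechModule x) i) :
    ∃ (k : ℕ) (p : Finset V → A), cechFamily x k p i = c := by
  have := Fintype.ofFinite V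
  choose k a hka using fun F : {F : Finset V // F.card = i} => exists_cechFrac_eq (x := x) (c F)
  let m := ∑ F, k F
  have hm (F : {F : Finset V // F.card = i}) : k F ≤ m :=
    Finset.single_le_sum (fun _ _ => Nat.zero_le _) (Finset.mem_univ F)
  refine ⟨m, fun F => if h : F.card = i then (∏ v ∈ F, x v) ^ (m - k ⟨F, h⟩) * a ⟨F, h⟩ else 0, ?_⟩
  funext F
  rw [cechFamily, dif_pos F.2]
  obtain ⟨j, hj⟩ := Nat.exists_eq_add_of_le (hm F)
  rw [hj, Nat.add_sub_cancel_left, cechFrac_add, hka]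

variable [LinearOrder V]

/-- The differential `(d a)_G = ∑_{v ∈ G} ± x_v ^ k a_{G ∖ {v}}` of the Koszul complex of the `k`-th
powers of the `x_v`, on families indexed by all finite sets. -/
def koszulPowSum (x : V → A) (k : ℕ) (p : Finset V → A) (G : Finset V) : A :=
  ∑ v ∈ G, setSign G v • (x v ^ k * p (G.erase v))

theorem sdiff_erase_of_mem {v : V} (hv : v ∈ G) : G \ G.erase v = {v} := by
  ext w
  simp only [Finset.mem_sdiff, Finset.mem_erase, Finset.mem_singleton]
  grind

theorem setCoboundary_koszulRes (p : Finset V → A) (i : ℕ)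
    (G : {G : Finset V // G.card = i + 1}) :
    setCoboundary (fun _ : Finset V => A) (koszulRes x) i (fun F => p F.1) G =
      koszulPowSum x 1 p G.1 := by
  rw [koszulPowSum, ← Finset.sum_coe_sort]
  simp only [setCoboundary, LinearMap.pi_apply, LinearMap.sum_apply, LinearMap.smul_apply,
    LinearMap.comp_apply, LinearMap.proj_apply, koszulRes, LinearMap.mulLeft_apply, pow_one]
  refine Finset.sum_congr rfl fun v _ => ?_
  rw [sdiff_erase_of_mem v.2, Finset.prod_singleton]

theorem setCoboundary_cechFamily (k : ℕ) (p : Finset V → A) (i : ℕ)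
    (G : {G : Finset V // G.card = i + 1}) :
    setCoboundary (CechModule x) (cechRes x) i (cechFamily x k p i) G =
      cechFrac x G.1 k (koszulPowSum x k p G.1) := by
  rw [koszulPowSum, ← Finset.sum_coe_sort, map_sum]
  simp only [setCoboundary, LinearMap.pi_apply, LinearMap.sum_apply, LinearMap.smul_apply,
    LinearMap.comp_apply, LinearMap.proj_apply, cechFamily]
  refine Finset.sum_congr rfl fun v _ => ?_
  rw [cechRes_cechFrac, sdiff_erase_of_mem v.2, Finset.prod_singleton, map_zsmul]

theorem cechFamily_koszulPowSum_mem (k : ℕ) (p : Finset V → A) (i : ℕ) :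
    cechFamily x k (koszulPowSum x k p) i ∈ setCoboundaries (CechModule x) (cechRes x) i := by
  cases i with
  | zero =>
    refine (Submodule.mem_bot A).2 (funext fun F => ?_)
    have h0 : koszulPowSum x k p F.1 = 0 := by
      rw [koszulPowSum, Finset.card_eq_zero.1 F.2, Finset.sum_empty]
    rw [cechFamily, h0, map_zero]
    rfl
  | succ i => exact ⟨cechFamily x k p i, funext fun G => setCoboundary_cechFamily k p i G⟩

/-- Multiplication by the `j`-th powers is a chain map between the Koszul complexes of the powers. -/
theorem koszulPowSum_pow_mul (k j : ℕ) (p : Finset V → A) (G : Finset V) :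
    koszulPowSum x (k + j) (fun F => (∏ v ∈ F, x v) ^ j * p F) G =
      (∏ v ∈ G, x v) ^ j * koszulPowSum x k p G := by
  rw [koszulPowSum, koszulPowSum, Finset.mul_sum]
  refine Finset.sum_congr rfl fun v hv => ?_
  rw [mul_smul_comm, ← Finset.mul_prod_erase G x hv]
  ring_nf

theorem koszulToLocalCohomology_surjective_iff {i : ℕ} :
    Function.Surjective (koszulToLocalCohomology x i) ↔
      ∀ c ∈ setCocycles (CechModule x) (cechRes x) i,
        ∃ b ∈ setCocycles (fun _ : Finset V => A) (koszulRes x) i,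
          setCochainMap (koszulToCech x) i b - c ∈ setCoboundaries (CechModule x) (cechRes x) i := by
  constructor
  · intro h c hc
    obtain ⟨z, hz⟩ := h (Submodule.Quotient.mk ⟨c, hc⟩)
    obtain ⟨⟨b, hb⟩, rfl⟩ := Submodule.Quotient.mk_surjective _ z
    exact ⟨b, hb, (Submodule.Quotient.eq ((setCoboundaries (CechModule x) (cechRes x) i).submoduleOf
      (setCocycles (CechModule x) (cechRes x) i))).1 hz⟩
  · intro h z
    obtain ⟨⟨c, hc⟩, rfl⟩ := Submodule.Quotient.mk_surjective _ z
    obtain ⟨b, hb, hbc⟩ := h c hc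
    exact ⟨Submodule.Quotient.mk ⟨b, hb⟩, (Submodule.Quotient.eq
      ((setCoboundaries (CechModule x) (cechRes x) i).submoduleOf
        (setCocycles (CechModule x) (cechRes x) i))).2 hbc⟩

/-- A class in local cohomology comes from the Koszul complex of the `k`-th powers of the `x_v` for
all large `k`, so the map from Koszul cohomology is surjective if every cocycle of these complexes is
cohomologous to the image of one for `k = 1`. -/
theorem koszulToLocalCohomology_surjective [Finite V] {i : ℕ}
    (h : ∀ (k : ℕ) (p : Finset V → A), 0 < k → (∀ F, ∏ v ∈ F, x v ∣ p F) →
      (∀ G : Finset V, G.card = i + 1 → koszulPowSum x k p G = 0) →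
      ∃ q r : Finset V → A, (∀ G : Finset V, G.card = i + 1 → koszulPowSum x 1 r G = 0) ∧
        ∀ F : Finset V, F.card = i →
          p F = (∏ v ∈ F, x v) ^ (k - 1) * r F + koszulPowSum x k q F) :
    Function.Surjective (koszulToLocalCohomology x i) := by
  have := Fintype.ofFinite V
  rw [koszulToLocalCohomology_surjective_iff]
  intro c hc
  obtain ⟨k, p, rfl⟩ := exists_cechFamily_eq c
  have hzero (G : {G : Finset V // G.card = i + 1}) :
      ∃ j, (∏ v ∈ G.1, x v) ^ j * koszulPowSum x k p G.1 = 0 := by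
    apply exists_pow_mul_eq_zero_of_cechFrac_eq_zero (k := k)
    rw [← setCoboundary_cechFamily]
    exact congrFun hc G
  choose j hj using hzero
  let m := ∑ G, j G
  have hm (G : {G : Finset V // G.card = i + 1}) : j G ≤ m :=
    Finset.single_le_sum (fun _ _ => Nat.zero_le _) (Finset.mem_univ G)
  obtain ⟨q, r, hr, hqr⟩ := h (k + (m + 1)) (fun F => (∏ v ∈ F, x v) ^ (m + 1) * p F) (by omega)
    (fun F => Dvd.dvd.mul_right (dvd_pow_self _ (by omega)) _) (fun G hG => by
      obtain ⟨t, ht⟩ := Nat.exists_eq_add_of_le ((hm ⟨G, hG⟩).trans (Nat.le_add_right m 1))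
      rw [koszulPowSum_pow_mul, ht, pow_add, mul_comm (_ ^ _), mul_assoc, hj ⟨G, hG⟩, mul_zero])
  let b : SetCochain (fun _ : Finset V => A) i := fun F => r F.1
  have hmap (F : {F : Finset V // F.card = i}) :
      koszulToCech x F.1 (r F.1) - cechFrac x F.1 k (p F.1) =
        cechFrac x F.1 (k + (m + 1)) (koszulPowSum x (k + (m + 1)) (fun G => -q G) F.1) := by
    have hneg : koszulPowSum x (k + (m + 1)) (fun G => -q G) F.1 =
        -koszulPowSum x (k + (m + 1)) q F.1 := by simp [koszulPowSum]
    rw [← cechFrac_add k (m + 1), hqr F.1 F.2, map_add, koszulToCech_eq_cechFrac,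
      ← cechFrac_add 1 (k + (m + 1) - 1), Nat.add_sub_cancel' (by omega), hneg, map_neg]
    abel
  refine ⟨b, funext fun G => (setCoboundary_koszulRes r i G).trans (hr G.1 G.2), ?_⟩
  have heq : setCochainMap (koszulToCech x) i b - cechFamily x k p i =
      cechFamily x (k + (m + 1)) (koszulPowSum x (k + (m + 1)) fun G => -q G) i := funext hmap
  rw [heq]
  exact cechFamily_koszulPowSum_mem _ _ _

end Cech

/-! ### Signed sums over families of finite sets -/

section SignedSum

variable {V : Type*} [LinearOrder V] {M : Type*} [AddCommGroup M] {F G : Finset V}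

theorem setSign_mul_self (G : Finset V) (v : V) : setSign G v * setSign G v = 1 := by
  rw [setSign, ← mul_pow]
  simp

theorem setSign_erase_of_lt {u v : V} (hu : u ∈ G) (huv : u < v) :
    setSign (G.erase u) v = -setSign G v := by
  have hmem : u ∈ G.filter (· < v) := Finset.mem_filter.2 ⟨hu, huv⟩
  rw [setSign, setSign, Finset.filter_erase, ← Finset.card_erase_add_one hmem, pow_succ]
  ring

theorem setSign_erase_of_le {u v : V} (huv : v ≤ u) : setSign (G.erase u) v = setSign G v := by
  have hmem : u ∉ G.filter (· < v) := fun h => huv.not_gt (Finset.mem_filter.1 h).2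
  rw [setSign, setSign, Finset.filter_erase, Finset.erase_eq_of_notMem hmem]

theorem setSign_mul_setSign_erase {u v : V} (hu : u ∈ G) (hv : v ∈ G) (h : u ≠ v) :
    setSign G u * setSign (G.erase u) v = -(setSign G v * setSign (G.erase v) u) := by
  rcases h.lt_or_gt with h | h
  · rw [setSign_erase_of_lt hu h, setSign_erase_of_le h.le]
    ring
  · rw [setSign_erase_of_lt hv h, setSign_erase_of_le h.le]
    ring

/-- The simplicial differential `(d p)_G = ∑_{v ∈ G} ± p_{G ∖ {v}}` on families indexed by all
finite sets. -/
def signedSum (p : Finset V → M) (G : Finset V) : M := ∑ v ∈ G, setSign G v • p (G.erase v)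

theorem signedSum_sub (p q : Finset V → M) (G : Finset V) :
    signedSum (fun F => p F - q F) G = signedSum p G - signedSum q G := by
  simp only [signedSum, smul_sub, Finset.sum_sub_distrib]

theorem signedSum_add (p q : Finset V → M) (G : Finset V) :
    signedSum (fun F => p F + q F) G = signedSum p G + signedSum q G := by
  simp only [signedSum, smul_add, Finset.sum_add_distrib]

theorem signedSum_eq_zero {p : Finset V → M} (h : ∀ v ∈ G, p (G.erase v) = 0) :
    signedSum p G = 0 :=
  Finset.sum_eq_zero fun v hv => by rw [h v hv, smul_zero]

theorem signedSum_signedSum (p : Finset V → M) (G : Finset V) :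
    signedSum (signedSum p) G = 0 := by
  simp only [signedSum, Finset.smul_sum]
  rw [Finset.sum_sigma']
  refine Finset.sum_involution (fun s _ => ⟨s.2, s.1⟩) ?_ ?_ ?_ ?_
  · rintro ⟨u, v⟩ h
    obtain ⟨hu, hv⟩ := Finset.mem_sigma.1 h
    obtain ⟨hne, hv⟩ := Finset.mem_erase.1 hv
    dsimp only at hu hv hne ⊢
    rw [smul_smul, smul_smul, setSign_mul_setSign_erase hu hv hne.symm,
      Finset.erase_right_comm (a := v), neg_smul, neg_add_cancel]
  · rintro ⟨u, v⟩ h - heq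
    have := (Finset.mem_erase.1 (Finset.mem_sigma.1 h).2).1
    exact this (congrArg Sigma.fst heq)
  · rintro ⟨u, v⟩ h
    obtain ⟨hu, hv⟩ := Finset.mem_sigma.1 h
    obtain ⟨hne, hv⟩ := Finset.mem_erase.1 hv
    exact Finset.mem_sigma.2 ⟨hv, Finset.mem_erase.2 ⟨hne.symm, hu⟩⟩
  · rintro ⟨u, v⟩ h
    rfl

/-- Exactness in degree `i` of the cochain complex with a copy of `M` for each member of `Φ`, the
degree of a member being its cardinality. A cochain is a family indexed by all finite sets that
vanishes outside `Φ`. -/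
def IsExactAt (M : Type*) [AddCommGroup M] (Φ : Set (Finset V)) (i : ℕ) : Prop :=
  ∀ p : Finset V → M, (∀ F ∉ Φ, p F = 0) → (∀ G ∈ Φ, G.card = i + 1 → signedSum p G = 0) →
    ∃ q : Finset V → M, (∀ F ∉ Φ, q F = 0) ∧ ∀ F ∈ Φ, F.card = i → p F = signedSum q F

/-- A family of sets that is stable under adding and removing `t` is contractible. -/
theorem isExactAt_of_cone {Φ : Set (Finset V)} {t : V}
    (h : ∀ F ∈ Φ, insert t F ∈ Φ ∧ F.erase t ∈ Φ) (i : ℕ) : IsExactAt M Φ i := by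
  intro p hp hc
  refine ⟨fun F => if t ∈ F then 0 else setSign (insert t F) t • p (insert t F), fun F hF => ?_,
    fun F hF hFi => ?_⟩
  · dsimp only
    split_ifs with ht
    · rfl
    · rw [hp, smul_zero]
      intro hins
      have := (h _ hins).2
      rw [Finset.erase_insert ht] at this
      exact hF this
  · by_cases ht : t ∈ F
    · rw [signedSum, Finset.sum_eq_single_of_mem t ht, if_neg (Finset.notMem_erase t F),
        Finset.insert_erase ht, smul_smul, setSign_mul_self, one_smul]
      intro v _ hvt
      rw [if_pos (Finset.mem_erase.2 ⟨hvt.symm, ht⟩), smul_zero]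
    · have hG := hc _ (h F hF).1 (by rw [Finset.card_insert_of_notMem ht, hFi])
      rw [signedSum, Finset.sum_insert ht, Finset.erase_insert ht] at hG
      rw [← one_smul ℤ (p F), ← setSign_mul_self (insert t F) t, ← smul_smul,
        eq_neg_of_add_eq_zero_left hG, smul_neg, Finset.smul_sum, ← Finset.sum_neg_distrib,
        signedSum]
      refine Finset.sum_congr rfl fun v hv => ?_
      have htv : t ≠ v := fun he => ht (he ▸ hv)
      have hsign := setSign_mul_setSign_erase (Finset.mem_insert_self t F)
        (Finset.mem_insert_of_mem hv) htv
      rw [Finset.erase_insert ht] at hsign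
      rw [if_neg fun hx => ht (Finset.mem_of_mem_erase hx), ← Finset.erase_insert_of_ne htv,
        smul_smul, smul_smul, ← neg_smul]
      congr 1
      have h1 := setSign_mul_self (insert t F) t
      have h2 := setSign_mul_self ((insert t F).erase v) t
      linear_combination setSign F v * setSign ((insert t F).erase v) t * h1 -
        setSign (insert t F) t * setSign ((insert t F).erase v) t * hsign +
        setSign (insert t F) t * setSign (insert t F) v * h2

/-- The long exact sequence of the members of `Φ` that contain `w` and those that do not. -/
theorem IsExactAt.of_mem_of_notMem {Φ : Set (Finset V)} (hΦ : Φ.OrdConnected) (w : V) {i : ℕ}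
    (hdel : IsExactAt M {F | F ∈ Φ ∧ w ∉ F} i) (hlk : IsExactAt M {F | F ∈ Φ ∧ w ∈ F} i) :
    IsExactAt M Φ i := by
  classical
  intro p hp hc
  obtain ⟨q, hq, hpq⟩ := hdel (fun F => if w ∈ F then 0 else p F) (fun F hF => by
      split_ifs with hw
      · rfl
      · exact hp F fun h => hF ⟨h, hw⟩) fun G hG hGi => by
    refine (Finset.sum_congr rfl fun v hv => ?_).trans (hc G hG.1 hGi)
    dsimp only
    rw [if_neg fun hx => hG.2 (Finset.mem_of_mem_erase hx)]
  have hzero (H : Finset V) (hH : H ∈ Φ) (hw : w ∉ H) (hHi : H.card = i) :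
      p H - signedSum q H = 0 := by
    have := hpq H ⟨hH, hw⟩ hHi
    rw [if_neg hw] at this
    rw [this, sub_self]
  have hzero' (G : Finset V) (hG : G ∈ Φ) (v : V) (hH : G.erase v ∉ Φ) :
      p (G.erase v) - signedSum q (G.erase v) = 0 := by
    rw [hp _ hH, signedSum_eq_zero, sub_zero]
    refine fun u _ => hq _ fun h => hH ?_
    exact hΦ.out h.1 hG ⟨Finset.erase_subset _ _, Finset.erase_subset _ _⟩
  obtain ⟨r, hr, hpr⟩ := hlk
    (fun F => if F ∈ Φ ∧ w ∈ F then p F - signedSum q F else 0) (fun F hF => if_neg hF)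
    fun G hG hGi => by
      have h1 := signedSum_sub p (signedSum q) G
      rw [hc G hG.1 hGi, signedSum_signedSum, sub_zero] at h1
      refine (Finset.sum_congr rfl fun v hv => ?_).trans h1
      congr 1
      dsimp only
      split_ifs with hx
      · rfl
      · symm
        by_cases hH : G.erase v ∈ Φ
        · exact hzero _ hH (fun hw => hx ⟨hH, hw⟩) (by
            rw [Finset.card_erase_of_mem hv, hGi, Nat.add_sub_cancel])
        · exact hzero' G hG.1 v hH
  refine ⟨fun F => q F + r F, fun F hF => ?_, fun F hF hFi => ?_⟩
  · dsimp only
    rw [hq F fun h => hF h.1, hr F fun h => hF h.1, add_zero]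
  · rw [signedSum_add]
    by_cases hw : w ∈ F
    · rw [← hpr F ⟨hF, hw⟩ hFi, if_pos ⟨hF, hw⟩]
      abel
    · rw [signedSum_eq_zero (p := r) fun v _ => hr _ fun h => hw (Finset.mem_of_mem_erase h.2),
        add_zero, sub_eq_zero.1 (hzero F hF hw hFi)]

/-- A complex on `W` whose nonfaces are generated by a family of sets `𝓜`, joined with a simplex on
`N` whose vertices have to be used, is exact below degree `#N + #W - #𝓜`. This reflects the bound
for the projective dimension of an ideal by the number of its generators. -/
theorem isExactAt_of_card_lt (N W : Finset V) (𝓜 : Finset (Finset V)) {i : ℕ} (hNW : Disjoint N W)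
    (hi : i + 𝓜.card < N.card + W.card) :
    IsExactAt M {G | N ⊆ G ∧ G ⊆ N ∪ W ∧ ∀ M ∈ 𝓜, ¬ M ⊆ G} i := by
  induction W using Finset.induction_on generalizing N 𝓜 with
  | empty =>
    intro p _ _
    refine ⟨0, fun _ _ => rfl, fun F hF hFi => ?_⟩
    have h1 : F = N := (Finset.union_empty N ▸ hF.2.1).antisymm hF.1
    rw [Finset.card_empty, ← h1] at hi
    omega
  | insert w W hw ih =>
    rw [Finset.disjoint_insert_right] at hNW
    rw [Finset.card_insert_of_notMem hw] at hi
    by_cases hcone : ∀ M ∈ 𝓜, w ∉ M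
    · refine isExactAt_of_cone (t := w) ?_ i
      refine fun F hF => ⟨⟨?_, ?_, ?_⟩, ?_, ?_, ?_⟩
      · exact hF.1.trans (Finset.subset_insert w F)
      · exact Finset.insert_subset (by simp) hF.2.1
      · exact fun M hM hMF => hF.2.2 M hM ((Finset.subset_insert_iff_of_notMem (hcone M hM)).1 hMF)
      · exact Finset.subset_erase.2 ⟨hF.1, hNW.1⟩
      · exact (Finset.erase_subset w F).trans hF.2.1
      · exact fun M hM hMF => hF.2.2 M hM (hMF.trans (Finset.erase_subset w F))
    · push Not at hcone
      obtain ⟨M₁, hM₁, hwM₁⟩ := hcone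
      have hcard := Finset.card_erase_add_one hM₁
      refine IsExactAt.of_mem_of_notMem ?_ w ?_ ?_
      · exact ⟨fun F hF G hG H hH => ⟨hF.1.trans hH.1, hH.2.trans hG.2.1,
          fun M hM hMH => hG.2.2 M hM (hMH.trans hH.2)⟩⟩
      · convert ih N (𝓜.erase M₁) hNW.2 (by omega) using 1
        ext F
        constructor
        · rintro ⟨⟨h1, h2, h3⟩, h4⟩
          refine ⟨h1, fun u hu => ?_, fun M hM => h3 M (Finset.mem_of_mem_erase hM)⟩
          have := h2 hu
          grind
        · rintro ⟨h1, h2, h3⟩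
          have hwF : w ∉ F := fun hx => by
            have := h2 hx
            grind
          refine ⟨⟨h1, fun u hu => ?_, fun M hM hMF => ?_⟩, hwF⟩
          · have := h2 hu
            grind
          · by_cases he : M = M₁
            · exact hwF (hMF (he ▸ hwM₁))
            · exact h3 M (Finset.mem_erase.2 ⟨he, hM⟩) hMF
      · convert ih (insert w N) 𝓜 (Finset.disjoint_insert_left.2 ⟨hw, hNW.2⟩)
          (by rw [Finset.card_insert_of_notMem hNW.1]; omega) using 1
        ext F
        constructor
        · rintro ⟨⟨h1, h2, h3⟩, h4⟩
          exact ⟨Finset.insert_subset h4 h1, fun u hu => by have := h2 hu; grind, h3⟩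
        · rintro ⟨h1, h2, h3⟩
          exact ⟨⟨(Finset.subset_insert w N).trans h1, fun u hu => by have := h2 hu; grind, h3⟩,
            h1 (Finset.mem_insert_self w N)⟩

end SignedSum

namespace AbstractSimplicialComplex

variable {V : Type*} [LinearOrder V] [Finite V] {Δ : AbstractSimplicialComplex V}
  {M : Type*} [AddCommGroup M] {F N T : Finset V} {i : ℕ}

theorem HasLocallyDisjointNonfaces.isExactAt_of_subset (h : Δ.HasLocallyDisjointNonfaces)
    (hF : F ∈ Δ.faces) (hN : N.Nonempty) (hNF : N ⊆ F) (hi : i < F.card) :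
    IsExactAt M {G | N ⊆ G ∧ G ∈ Δ.faces} i := by
  classical
  have := Fintype.ofFinite V
  obtain ⟨v, hv⟩ := hN
  let 𝓜 : Finset (Finset V) := {M | Δ.IsMinNonfaceAt v M}
  let W : Finset V := ({w | {v, w} ∈ Δ.faces} : Finset V) \ N
  have h𝓜 (M : Finset V) : M ∈ 𝓜 ↔ Δ.IsMinNonfaceAt v M := by simp [𝓜]
  have hW (w : V) : w ∈ W ↔ {v, w} ∈ Δ.faces ∧ w ∉ N := by simp [W]
  have hpair {G : Finset V} (hG : G ∈ Δ.faces) (hvG : v ∈ G) {w : V} (hw : w ∈ G) :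
      {v, w} ∈ Δ.faces := mem_faces_of_subset hG (by grind) (by simp)
  have hNW (w : V) (hw : {v, w} ∈ Δ.faces) : w ∈ N ∪ W := by
    rw [Finset.mem_union, hW]
    tauto
  have hset : {G | N ⊆ G ∧ G ∈ Δ.faces} =
      {G | N ⊆ G ∧ G ⊆ N ∪ W ∧ ∀ M ∈ 𝓜, ¬ M ⊆ G} := by
    ext G
    refine and_congr_right fun hNG => ⟨fun hG => ⟨fun w hw => hNW w (hpair hG (hNG hv) hw),
      fun M hM hMG => ?_⟩, fun ⟨h1, h2⟩ => ?_⟩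
    · exact ((h𝓜 M).1 hM).2.2.2.1
        (mem_faces_of_subset hG (Finset.insert_subset (hNG hv) hMG) (by simp))
    · by_contra hG
      have hadj (w : V) (hw : w ∈ G) : {v, w} ∈ Δ.faces := by
        rcases Finset.mem_union.1 (h1 hw) with hw | hw
        · exact hpair hF (hNF hv) (hNF hw)
        · exact ((hW w).1 hw).1
      obtain ⟨M, hM, hmin⟩ := (Set.toFinite {F : Finset V | insert v F ∉ Δ.faces}).exists_le_minimal
        (a := G.erase v) (by
          change insert v (G.erase v) ∉ Δ.faces
          rwa [Finset.insert_erase (hNG hv)])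
      refine h2 M ((h𝓜 M).2 ⟨?_, fun hx => by simpa using hM hx,
        fun w hw => hadj w (Finset.mem_of_mem_erase (hM hw)), hmin.1, fun G hG => ?_⟩)
        (hM.trans (Finset.erase_subset _ _))
      · rw [Finset.nonempty_iff_ne_empty]
        rintro rfl
        exact hmin.1 (by simpa using Δ.singleton_mem v)
      · by_contra hno
        exact hG.not_subset (hmin.2 hno hG.subset)
  rw [hset]
  -- Each minimal nonface has an element outside `F`, and these elements are distinct.
  have hout (M : Finset V) : ∃ w, M ∈ 𝓜 → w ∈ M ∧ w ∉ F := by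
    by_contra! hno
    have hM := (hno v).1
    have hMF (w : V) (hw : w ∈ M) : w ∈ F := (hno w).2 hw
    exact ((h𝓜 M).1 hM).2.2.2.1
      (mem_faces_of_subset hF (Finset.insert_subset (hNF hv) hMF) (by simp))
  choose f hf' using hout
  have hf (M : Finset V) (hM : M ∈ 𝓜) : f M ∈ M := (hf' M hM).1
  have hfF (M : Finset V) (hM : M ∈ 𝓜) : f M ∉ F := (hf' M hM).2
  have hle : 𝓜.card ≤ (W \ F).card := by
    refine Finset.card_le_card_of_injOn f (fun M hM => ?_) fun M hM M' hM' he => ?_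
    · refine Finset.mem_sdiff.2 ⟨(hW _).2 ⟨((h𝓜 M).1 hM).2.2.1 _ (hf M hM), fun hx => ?_⟩,
        hfF M hM⟩
      exact hfF M hM (hNF hx)
    · refine (h v M M' ((h𝓜 M).1 hM) ((h𝓜 M').1 hM')).resolve_right fun hd => ?_
      exact Finset.disjoint_left.1 hd (hf M hM) (he ▸ hf M' hM')
  have hdisj : Disjoint N W := Finset.disjoint_sdiff
  refine isExactAt_of_card_lt N W 𝓜 hdisj ?_
  have hsub : F ∪ (W \ F) ⊆ N ∪ W := by
    refine Finset.union_subset (fun w hw => hNW w (hpair hF (hNF hv) hw)) ?_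
    exact Finset.sdiff_subset.trans Finset.subset_union_right
  have h1 := Finset.card_le_card hsub
  rw [Finset.card_union_of_disjoint Finset.disjoint_sdiff, Finset.card_union_of_disjoint hdisj]
    at h1
  omega

/-- Exactness of the part of the Čech complex in a degree with negative support `N` and positive
support `T`: for nonempty `T` this is a cone, otherwise the complex of the link of `N`. -/
theorem HasLocallyDisjointNonfaces.isExactAt (h : Δ.HasLocallyDisjointNonfaces)
    (hfac : ∀ F ∈ Δ.faces, ∃ G ∈ Δ.faces, F ⊆ G ∧ i < G.card) (hNT : Disjoint N T)
    (hne : N.Nonempty ∨ T.Nonempty) :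
    IsExactAt M {G | N ⊆ G ∧ (G ∪ T = ∅ ∨ G ∪ T ∈ Δ.faces)} i := by
  rcases T.eq_empty_or_nonempty with rfl | ⟨t, ht⟩
  · have hN : N.Nonempty := hne.resolve_right (by simp)
    have hset : {G | N ⊆ G ∧ (G ∪ ∅ = ∅ ∨ G ∪ ∅ ∈ Δ.faces)} = {G | N ⊆ G ∧ G ∈ Δ.faces} := by
      ext G
      refine and_congr_right fun hNG => ?_
      rw [Finset.union_empty]
      exact or_iff_right (hN.mono hNG).ne_empty
    rw [hset]
    by_cases hNf : N ∈ Δ.faces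
    · obtain ⟨F, hF, hNF, hi⟩ := hfac N hNf
      exact h.isExactAt_of_subset hF hN hNF hi
    · exact fun p _ _ => ⟨0, fun _ _ => rfl, fun F hF _ =>
        absurd (mem_faces_of_subset hF.2 hF.1 hN) hNf⟩
  · refine isExactAt_of_cone (t := t) ?_ i
    refine fun F hF => ⟨⟨?_, ?_⟩, ?_, ?_⟩
    · exact hF.1.trans (Finset.subset_insert t F)
    · have : insert t F ∪ T = F ∪ T := by grind
      rw [this]
      exact hF.2
    · exact Finset.subset_erase.2 ⟨hF.1, fun hx => Finset.disjoint_left.1 hNT hx ht⟩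
    · have : F.erase t ∪ T = F ∪ T := by grind
      rw [this]
      exact hF.2

end AbstractSimplicialComplex

/-! ### Coefficients of polynomials at integral exponents -/

namespace MvPolynomial

variable {K : Type*} [Field K] {V : Type*} [Fintype V]

open Classical in
/-- The coefficient at an exponent vector with integral entries, which is zero if an entry is
negative. -/
noncomputable def intCoeff (K : Type*) [Field K] (b : V → ℤ) : MvPolynomial V K →ₗ[K] K :=
  if ∀ v, 0 ≤ b v then lcoeff K (Finsupp.equivFunOnFinite.symm fun v => (b v).toNat) else 0

theorem intCoeff_of_neg {b : V → ℤ} {v : V} (hv : b v < 0) (f : MvPolynomial V K) :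
    intCoeff K b f = 0 := by
  rw [intCoeff, if_neg fun h => (h v).not_gt hv, LinearMap.zero_apply]

theorem intCoeff_eq_coeff {b : V → ℤ} {n : V →₀ ℕ} (h : ∀ v, b v = n v) (f : MvPolynomial V K) :
    intCoeff K b f = coeff n f := by
  have hn : (Finsupp.equivFunOnFinite.symm fun v => (b v).toNat) = n :=
    Finsupp.ext fun v => by simp [h v]
  rw [intCoeff, if_pos fun v => by rw [h v]; exact Int.natCast_nonneg _, hn]
  rfl

theorem exists_eq_of_intCoeff_ne_zero {b : V → ℤ} {f : MvPolynomial V K}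
    (h : intCoeff K b f ≠ 0) : ∃ n ∈ f.support, ∀ v, b v = n v := by
  have hb (v : V) : 0 ≤ b v := by
    by_contra hv
    exact h (intCoeff_of_neg (not_le.1 hv) f)
  have hn (v : V) :
      b v = (Finsupp.equivFunOnFinite.symm (fun v => (b v).toNat) : V →₀ ℕ) v :=
    (Int.toNat_of_nonneg (hb v)).symm
  rw [intCoeff_eq_coeff hn] at h
  exact ⟨_, mem_support_iff.2 h, hn⟩

theorem intCoeff_monomial_mul (b : V → ℤ) (s : V →₀ ℕ) (f : MvPolynomial V K) :
    intCoeff K b (monomial s 1 * f) = intCoeff K (fun v => b v - s v) f := by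
  by_cases hb : ∀ v, 0 ≤ b v
  · let n : V →₀ ℕ := Finsupp.equivFunOnFinite.symm fun v => (b v).toNat
    have hn (v : V) : b v = n v := (Int.toNat_of_nonneg (hb v)).symm
    rw [intCoeff_eq_coeff hn, coeff_monomial_mul', one_mul]
    split_ifs with hs
    · refine (intCoeff_eq_coeff (fun v => ?_) f).symm
      have := hs v
      rw [hn, Finsupp.tsub_apply]
      omega
    · obtain ⟨v, hv⟩ : ∃ v, n v < s v := by
        by_contra! hno
        exact hs hno
      refine (intCoeff_of_neg (v := v) ?_ f).symm
      rw [hn]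
      omega
  · push Not at hb
    obtain ⟨v, hv⟩ := hb
    rw [intCoeff_of_neg hv, intCoeff_of_neg (v := v) (by omega)]

variable [LinearOrder V]

/-- The exponent vector `a + k 1_F`, which corresponds to the degree `a` after division by the
`k`-th power of the product of the variables in `F`. -/
def shiftExponent (k : ℤ) (a : V → ℤ) (F : Finset V) (v : V) : ℤ := a v + if v ∈ F then k else 0

theorem intCoeff_prod_X_pow_mul (k : ℤ) (j : ℕ) (a : V → ℤ) (F : Finset V)
    (f : MvPolynomial V K) :
    intCoeff K (shiftExponent k a F) ((∏ v ∈ F, X v) ^ j * f) =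
      intCoeff K (shiftExponent (k - j) a F) f := by
  rw [prod_X_eq_monomial, monomial_pow, one_pow, intCoeff_monomial_mul]
  congr 2
  funext v
  simp only [shiftExponent, Finsupp.smul_apply, sqfreeExponent_apply, smul_eq_mul]
  split_ifs <;> push_cast <;> ring

theorem intCoeff_koszulPowSum (k : ℕ) (a : V → ℤ) (p : Finset V → MvPolynomial V K)
    (G : Finset V) :
    intCoeff K (shiftExponent k a G) (koszulPowSum X k p G) =
      signedSum (fun F => intCoeff K (shiftExponent k a F) (p F)) G := by
  rw [koszulPowSum, signedSum, map_sum]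
  refine Finset.sum_congr rfl fun v hv => ?_
  rw [map_zsmul, X_pow_eq_monomial, intCoeff_monomial_mul]
  congr 3
  funext w
  simp only [shiftExponent, Finset.mem_erase, Finsupp.single_apply]
  split_ifs <;> grind

end MvPolynomial

namespace AbstractSimplicialComplex

variable {K : Type*} [Field K] {V : Type*} {Δ : AbstractSimplicialComplex V}

theorem prod_stanleyReisnerVar (F : Finset V) :
    ∏ v ∈ F, Δ.stanleyReisnerVar K v =
      Ideal.Quotient.mk (Δ.stanleyReisnerIdeal K) (∏ v ∈ F, X v) := by
  rw [map_prod]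
  rfl

theorem prod_stanleyReisnerVar_eq_zero {F : Finset V} (hne : F.Nonempty) (hF : F ∉ Δ.faces) :
    ∏ v ∈ F, Δ.stanleyReisnerVar K v = 0 := by
  rw [prod_stanleyReisnerVar, Ideal.Quotient.eq_zero_iff_mem]
  exact Ideal.subset_span ⟨F, hne, hF, rfl⟩

theorem mem_stanleyReisnerIdeal_of_coeff {f : MvPolynomial V K}
    (hf : ∀ n : V →₀ ℕ, n.support = ∅ ∨ n.support ∈ Δ.faces → coeff n f = 0) :
    f ∈ Δ.stanleyReisnerIdeal K := by
  rw [mem_stanleyReisnerIdeal_iff]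
  intro n hn
  by_contra hno
  refine mem_support_iff.1 hn (hf n ?_)
  rw [Finsupp.support_eq_empty]
  tauto

theorem koszulPowSum_stanleyReisnerVar [LinearOrder V] (k : ℕ)
    (p : Finset V → MvPolynomial V K) (G : Finset V) :
    koszulPowSum (Δ.stanleyReisnerVar K) k (fun F => Ideal.Quotient.mk _ (p F)) G =
      Ideal.Quotient.mk (Δ.stanleyReisnerIdeal K) (koszulPowSum X k p G) := by
  rw [koszulPowSum, koszulPowSum, map_sum]
  refine Finset.sum_congr rfl fun v _ => ?_
  rw [map_zsmul, map_mul, map_pow]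
  rfl

variable [Fintype V]

/-- The set of vertices at which `b` is positive. -/
def posSupport (b : V → ℤ) : Finset V := {v | 0 < b v}

/-- The set of vertices at which `b` is negative. -/
def negSupport (b : V → ℤ) : Finset V := {v | b v < 0}

theorem mem_posSupport {b : V → ℤ} {v : V} : v ∈ posSupport b ↔ 0 < b v := by simp [posSupport]

theorem mem_negSupport {b : V → ℤ} {v : V} : v ∈ negSupport b ↔ b v < 0 := by simp [negSupport]

theorem intCoeff_eq_zero_of_mem {f : MvPolynomial V K} (hf : f ∈ Δ.stanleyReisnerIdeal K)
    {b : V → ℤ} (hb : posSupport b = ∅ ∨ posSupport b ∈ Δ.faces) : intCoeff K b f = 0 := by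
  by_contra hne
  obtain ⟨n, hn, hbn⟩ := exists_eq_of_intCoeff_ne_zero hne
  obtain ⟨h0, hns⟩ := mem_stanleyReisnerIdeal_iff.1 hf n hn
  have hsupp : posSupport b = n.support := by
    ext v
    rw [mem_posSupport, hbn, Finsupp.mem_support_iff]
    omega
  rw [hsupp] at hb
  exact hb.elim (fun h => h0 (Finsupp.support_eq_empty.1 h)) hns

/-! ### Buchsbaum complexes are pure -/

variable [LinearOrder V]

/-- The cocycle `1 / x_F ^ 2` does not come from Koszul cohomology, as `x_F ^ (-2)` occurs neither in
multiples of `1 / x_F` nor in elements of the rings `A_{x_G}` with `G ⊂ F`. -/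
theorem not_surjective_of_isFacet {F : Finset V} (hF : Δ.IsFacet F) {i : ℕ}
    (hFi : F.card = i + 1) :
    ¬ Function.Surjective (koszulToLocalCohomology (Δ.stanleyReisnerVar K) (i + 1)) := by
  rw [koszulToLocalCohomology_surjective_iff]
  intro h
  -- The element `1 / x_F ^ 2` is a cocycle since `A_{x_G} = 0` for all larger `G`.
  obtain ⟨b, -, e, he⟩ := h (cechFamily (Δ.stanleyReisnerVar K) 2
    (fun H => if H = F then 1 else 0) (i + 1)) (by
      refine funext fun G => (setCoboundary_cechFamily _ _ _ G).trans ?_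
      by_cases hG : G.1 ∈ Δ.faces
      · rw [koszulPowSum, Finset.sum_eq_zero, map_zero]
        · rfl
        intro v hv
        rw [if_neg, mul_zero, smul_zero]
        intro hGF
        have := hF.2 G.1 hG (hGF ▸ Finset.erase_subset v G.1)
        have := G.2
        grind
      · exact cechModule_eq_of_prod_eq_zero
          (prod_stanleyReisnerVar_eq_zero (Finset.card_pos.1 (by rw [G.2]; omega)) hG) _ _)
  obtain ⟨k, q, rfl⟩ := exists_cechFamily_eq e
  have h1 := congrFun he ⟨F, hFi⟩
  rw [setCoboundary_cechFamily] at h1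
  change _ = koszulToCech _ F (b ⟨F, hFi⟩) - cechFrac _ F 2 (if F = F then 1 else 0) at h1
  rw [if_pos rfl, koszulToCech_eq_cechFrac, ← cechFrac_add 1 (k + 1), ← cechFrac_add 2 k,
    ← cechFrac_add k 2, add_comm 2 k, show 1 + (k + 1) = k + 2 by omega, ← map_sub,
    ← sub_eq_zero, ← map_sub] at h1
  obtain ⟨j, hj⟩ := exists_pow_mul_eq_zero_of_cechFrac_eq_zero h1
  obtain ⟨β, hβ⟩ := Ideal.Quotient.mk_surjective (b ⟨F, hFi⟩)
  choose q' hq' using fun H => Ideal.Quotient.mk_surjective (q H)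
  obtain rfl : (fun H => Ideal.Quotient.mk _ (q' H)) = q := funext hq'
  rw [koszulPowSum_stanleyReisnerVar, ← hβ, prod_stanleyReisnerVar, mul_one, ← map_pow, ← map_pow,
    ← map_pow, ← map_pow, ← map_mul, ← map_mul, ← map_sub, ← map_sub, ← map_mul,
    Ideal.Quotient.eq_zero_iff_mem] at hj
  obtain ⟨u, hu⟩ : F.Nonempty := nonempty_of_mem_faces hF.1
  have hpos : posSupport (shiftExponent ((j + k : ℕ) : ℤ) 0 F) ⊆ F := fun v hv => by
    rw [mem_posSupport, shiftExponent] at hv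
    by_contra hvF
    simp [hvF] at hv
  have h2 := intCoeff_eq_zero_of_mem hj (b := shiftExponent ((j + k : ℕ) : ℤ) 0 F) (by
    rcases Finset.eq_empty_or_nonempty (posSupport (shiftExponent ((j + k : ℕ) : ℤ) 0 F)) with h | h
    · exact Or.inl h
    · exact Or.inr (mem_faces_of_subset hF.1 hpos h))
  have e1 : intCoeff K (shiftExponent (((j + k : ℕ) : ℤ) - j - (k + 1 : ℕ)) 0 F) β = 0 :=
    intCoeff_of_neg (v := u) (by simp [shiftExponent, hu]) β
  have e2 : intCoeff K (shiftExponent (((j + k : ℕ) : ℤ) - j - k) 0 F) (1 : MvPolynomial V K)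
      = 1 := by
    rw [intCoeff_eq_coeff (n := 0) (fun v => by simp [shiftExponent])]
    simp
  have e3 : intCoeff K (shiftExponent (((j + k : ℕ) : ℤ) - j - (2 : ℕ)) 0 F)
      (koszulPowSum X k q' F) = 0 := by
    have : shiftExponent (((j + k : ℕ) : ℤ) - j - (2 : ℕ)) 0 F =
        shiftExponent k (fun v => if v ∈ F then -2 else 0) F := by
      funext v
      simp only [shiftExponent]
      split_ifs
      · push_cast
        simp only [Pi.zero_apply]
        ring
      · simp
    rw [this, intCoeff_koszulPowSum]
    exact signedSum_eq_zero fun v hv => intCoeff_of_neg (v := v) (by simp [shiftExponent, hv]) _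
  rw [intCoeff_prod_X_pow_mul, map_sub, map_sub, intCoeff_prod_X_pow_mul,
    intCoeff_prod_X_pow_mul, e1, e3] at h2
  rw [← mul_one ((∏ v ∈ F, X v) ^ k), intCoeff_prod_X_pow_mul, e2] at h2
  simp at h2

theorem isPure_of_isBuchsbaum (hB : IsBuchsbaum (Δ.stanleyReisnerVar K)) : Δ.IsPure := by
  have hle (F G : Finset V) (hF : Δ.IsFacet F) (hG : Δ.IsFacet G) : G.card ≤ F.card := by
    by_contra! hlt
    obtain ⟨i, hi⟩ := Nat.exists_eq_succ_of_ne_zero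
      (Finset.card_pos.2 (nonempty_of_mem_faces hF.1)).ne'
    refine not_surjective_of_isFacet (K := K) hF hi (hB (i + 1) ?_)
    rw [← Nat.succ_eq_add_one, ← hi]
    exact lt_of_lt_of_le (by exact_mod_cast hlt) (card_le_ringKrullDim_stanleyReisnerRing hG.1)
  exact fun F G hF hG => (hle G F hG hF).antisymm (hle F G hF hG)

end AbstractSimplicialComplex

namespace AbstractSimplicialComplex

variable {K : Type*} [Field K] {V : Type*} [Fintype V] [LinearOrder V]
  {Δ : AbstractSimplicialComplex V}

/-! ### Pure locally complete intersection complexes are Buchsbaum -/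

theorem posSupport_shiftExponent {k : ℕ} {a : V → ℤ} (ha : ∀ v, -(k : ℤ) < a v) (F : Finset V) :
    posSupport (shiftExponent k a F) = F ∪ posSupport a := by
  ext v
  have := ha v
  rw [mem_posSupport, Finset.mem_union, mem_posSupport, shiftExponent]
  split_ifs with hv
  · exact ⟨fun _ => Or.inl hv, fun _ => by omega⟩
  · rw [add_zero]
    exact ⟨Or.inr, fun h => h.resolve_left hv⟩

/-- The faces `F` for which the component of degree `a` of the localization at the variables of `F`
is nonzero. -/
def cechSupport (Δ : AbstractSimplicialComplex V) (a : V → ℤ) : Set (Finset V) :=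
  {F | negSupport a ⊆ F ∧ (F ∪ posSupport a = ∅ ∨ F ∪ posSupport a ∈ Δ.faces)}

theorem mem_cechSupport_of_subset {a : V → ℤ} {F G : Finset V} (hG : G ∈ Δ.cechSupport a)
    (hFG : F ⊆ G) (hF : negSupport a ⊆ F) : F ∈ Δ.cechSupport a := by
  have hsub : F ∪ posSupport a ⊆ G ∪ posSupport a := Finset.union_subset_union_left hFG
  refine ⟨hF, ?_⟩
  rcases (F ∪ posSupport a).eq_empty_or_nonempty with h | h
  · exact Or.inl h
  · refine Or.inr (hG.2.elim (fun h0 => ?_) fun hf => mem_faces_of_subset hf hsub h)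
    rw [h0, Finset.subset_empty] at hsub
    exact absurd hsub h.ne_empty

theorem shiftExponent_neg {k : ℕ} {a : V → ℤ} {F : Finset V} (hF : ¬ negSupport a ⊆ F) :
    ∃ v, shiftExponent k a F v < 0 := by
  obtain ⟨v, hv, hvF⟩ := Finset.not_subset.1 hF
  refine ⟨v, ?_⟩
  rw [shiftExponent, if_neg hvF, add_zero]
  exact mem_negSupport.1 hv

/-- Polynomials with prescribed coefficients, indexed by the degrees after division by the `k`-th
power of the product of the variables in a set. -/
theorem exists_intCoeff_shiftExponent_eq (k : ℕ) {p : Finset V → MvPolynomial V K}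
    {Q : (V → ℤ) → Finset V → K}
    (hsupp : ∀ a F, Q a F ≠ 0 → (∀ v, -(k : ℤ) < a v) ∧ negSupport a ⊆ F)
    (hfin : ∀ a, (∀ F, intCoeff K (shiftExponent k a F) (p F) = 0) → ∀ F, Q a F = 0) :
    ∃ q : Finset V → MvPolynomial V K,
      ∀ a F, intCoeff K (shiftExponent k a F) (q F) = Q a F := by
  have hT (F : Finset V) :
      {n : V →₀ ℕ | Q (shiftExponent (-k) (fun v => n v) F) F ≠ 0}.Finite := by
    let e (G : Finset V) : V →₀ ℕ := Finsupp.equivFunOnFinite.symm fun v => if v ∈ G then k else 0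
    refine Set.Finite.subset (Set.finite_iUnion fun G : Finset V =>
      (p G).support.finite_toSet.image fun m => m + e F - e G) fun n hn => ?_
    obtain ⟨G, hG⟩ : ∃ G, intCoeff K
        (shiftExponent k (shiftExponent (-k) (fun v => n v) F) G) (p G) ≠ 0 := by
      by_contra! hno
      exact hn (hfin _ hno F)
    obtain ⟨m, hm, hmn⟩ := exists_eq_of_intCoeff_ne_zero hG
    refine Set.mem_iUnion.2 ⟨G, m, hm, Finsupp.ext fun v => ?_⟩
    have := hmn v
    simp only [shiftExponent] at this
    simp only [e, Finsupp.tsub_apply, Finsupp.add_apply, Finsupp.equivFunOnFinite_symm_apply_apply]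
    split_ifs at this ⊢ <;> omega
  refine ⟨fun F => ∑ n ∈ (hT F).toFinset,
    monomial n (Q (shiftExponent (-k) (fun v => n v) F) F), fun a F => ?_⟩
  by_cases ha : ∀ v, 0 ≤ shiftExponent k a F v
  · let n : V →₀ ℕ := Finsupp.equivFunOnFinite.symm fun v => (shiftExponent k a F v).toNat
    have hn (v : V) : shiftExponent k a F v = n v := (Int.toNat_of_nonneg (ha v)).symm
    have han : shiftExponent (-k) (fun v => n v) F = a := by
      funext v
      have := hn v
      simp only [shiftExponent] at this ⊢
      split_ifs at this ⊢ <;> omega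
    rw [intCoeff_eq_coeff hn, coeff_sum]
    simp only [coeff_monomial, Finset.sum_ite_eq', Set.Finite.mem_toFinset, Set.mem_ofPred_eq, han,
      ite_eq_left_iff, not_not]
    exact Eq.symm
  · push Not at ha
    obtain ⟨v, hv⟩ := ha
    rw [intCoeff_of_neg hv]
    by_contra hne
    obtain ⟨h1, h2⟩ := hsupp a F (Ne.symm hne)
    have h3 := h1 v
    rw [shiftExponent] at hv
    split_ifs at hv with hvF
    · omega
    · exact hvF (h2 (mem_negSupport.2 (by omega)))

/-- The components of a cocycle in the nonzero degrees are coboundaries, and the component of degree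
zero is `k_F = k_F * x_F / x_F` for constants `k_F`, so it comes from the Koszul complex. -/
theorem HasLocallyDisjointNonfaces.koszulToLocalCohomology_surjective
    (h : Δ.HasLocallyDisjointNonfaces) {i : ℕ}
    (hfac : ∀ F ∈ Δ.faces, ∃ G ∈ Δ.faces, F ⊆ G ∧ i < G.card) :
    Function.Surjective (koszulToLocalCohomology (Δ.stanleyReisnerVar K) i) := by
  classical
  refine _root_.koszulToLocalCohomology_surjective fun k p' hk hdvd hcoc => ?_
  -- Lift the components to multiples of the monomials of the sets that index them.
  have hlift (F : Finset V) : ∃ f : MvPolynomial V K,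
      Ideal.Quotient.mk _ ((∏ v ∈ F, X v) ^ 1 * f) = p' F := by
    obtain ⟨z, hz⟩ := hdvd F
    obtain ⟨f, rfl⟩ := Ideal.Quotient.mk_surjective z
    exact ⟨f, by rw [hz, map_mul, pow_one, prod_stanleyReisnerVar]⟩
  choose f hf using hlift
  obtain ⟨p, hp⟩ : ∃ p : Finset V → MvPolynomial V K, p = fun F => (∏ v ∈ F, X v) ^ 1 * f F :=
    ⟨_, rfl⟩
  obtain rfl : (fun F => Ideal.Quotient.mk _ (p F)) = p' := funext fun F => by rw [hp, ← hf]
  have hlow (a : V → ℤ) (ha : ¬ ∀ v, -(k : ℤ) < a v) (F : Finset V) :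
      intCoeff K (shiftExponent k a F) (p F) = 0 := by
    push Not at ha
    obtain ⟨v, hv⟩ := ha
    rw [hp, intCoeff_prod_X_pow_mul]
    refine intCoeff_of_neg (v := v) ?_ _
    rw [shiftExponent]
    split_ifs <;> push_cast <;> omega
  -- The component of degree `a`.
  let P (a : V → ℤ) (F : Finset V) : K :=
    if F ∈ Δ.cechSupport a then intCoeff K (shiftExponent k a F) (p F) else 0
  have hP (a : V → ℤ) (ha : ∀ v, -(k : ℤ) < a v) (G : Finset V) (hG : G ∈ Δ.cechSupport a)
      (hGi : G.card = i + 1) : signedSum (P a) G = 0 := by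
    have h1 := hcoc G hGi
    rw [koszulPowSum_stanleyReisnerVar, Ideal.Quotient.eq_zero_iff_mem] at h1
    have h2 := intCoeff_eq_zero_of_mem h1 (b := shiftExponent k a G)
      (by rw [posSupport_shiftExponent ha]; exact hG.2)
    rw [intCoeff_koszulPowSum] at h2
    refine (Finset.sum_congr rfl fun v _ => ?_).trans h2
    congr 1
    simp only [P]
    rw [ite_eq_left_iff]
    intro hno
    obtain ⟨w, hw⟩ := shiftExponent_neg (k := k) (a := a) (F := G.erase v)
      fun hx => hno (mem_cechSupport_of_subset hG (Finset.erase_subset v G) hx)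
    exact (intCoeff_of_neg hw _).symm
  have hQ (a : V → ℤ) : ∃ Q : Finset V → K,
      (∀ F, Q F ≠ 0 → (∀ v, -(k : ℤ) < a v) ∧ negSupport a ⊆ F) ∧
      ((∀ F, intCoeff K (shiftExponent k a F) (p F) = 0) → ∀ F, Q F = 0) ∧
      (a = 0 → Q = 0) ∧
      (a ≠ 0 → (∀ v, -(k : ℤ) < a v) → ∀ F ∈ Δ.cechSupport a, F.card = i →
        P a F = signedSum Q F) := by
    by_cases hz : ∀ F, intCoeff K (shiftExponent k a F) (p F) = 0
    · refine ⟨0, fun _ hne => absurd rfl hne, fun _ _ => rfl, fun _ => rfl, fun _ _ F _ _ => ?_⟩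
      rw [signedSum_eq_zero fun _ _ => rfl]
      simp only [P, hz, ite_self]
    by_cases ha : ∀ v, -(k : ℤ) < a v
    · by_cases h0 : a = 0
      · exact ⟨0, fun _ hne => absurd rfl hne, fun _ _ => rfl, fun _ => rfl,
          fun hne => absurd h0 hne⟩
      · have hne : (negSupport a).Nonempty ∨ (posSupport a).Nonempty := by
          obtain ⟨v, hv⟩ := Function.ne_iff.1 h0
          rcases lt_or_gt_of_ne hv with hv | hv
          · exact Or.inl ⟨v, mem_negSupport.2 hv⟩
          · exact Or.inr ⟨v, mem_posSupport.2 hv⟩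
        have hdisj : Disjoint (negSupport a) (posSupport a) :=
          Finset.disjoint_left.2 fun v hv hv' =>
            (mem_negSupport.1 hv).not_gt (mem_posSupport.1 hv')
        obtain ⟨Q, hQ1, hQ2⟩ := h.isExactAt (M := K) hfac hdisj hne (P a)
          (fun F hF => if_neg hF) (hP a ha)
        refine ⟨Q, fun F hF => ⟨ha, ?_⟩, fun hz' => absurd hz' hz, fun h0' => absurd h0' h0,
          fun _ _ => hQ2⟩
        by_contra hno
        exact hF (hQ1 F fun hx => hno hx.1)
    · exact absurd (hlow a ha) hz
  choose Q hQ1 hQ2 hQ3 hQ4 using hQ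
  obtain ⟨q, hq⟩ := exists_intCoeff_shiftExponent_eq k hQ1 hQ2
  refine ⟨fun F => Ideal.Quotient.mk _ (q F),
    fun F => Ideal.Quotient.mk _ (C (P 0 F) * ∏ v ∈ F, X v), fun G hG => ?_, fun F hF => ?_⟩
  · by_cases hGf : G ∈ Δ.faces
    · have h0 : signedSum (P 0) G = 0 := by
        refine hP 0 (fun v => by simpa using hk) G ⟨fun v hv => ?_, Or.inr ?_⟩ hG
        · simp [mem_negSupport] at hv
        · have : posSupport (0 : V → ℤ) = ∅ := by
            ext v
            simp [mem_posSupport]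
          rwa [this, Finset.union_empty]
      rw [koszulPowSum_stanleyReisnerVar]
      have : koszulPowSum X 1 (fun F => C (P 0 F) * ∏ v ∈ F, X v) G =
          C (signedSum (P 0) G) * (∏ v ∈ G, X v : MvPolynomial V K) := by
        rw [koszulPowSum, signedSum, map_sum, Finset.sum_mul]
        refine Finset.sum_congr rfl fun v hv => ?_
        rw [map_zsmul, smul_mul_assoc, ← Finset.mul_prod_erase G _ hv]
        ring_nf
      rw [this, h0, map_zero, zero_mul, map_zero]
    · refine Finset.sum_eq_zero fun v hv => ?_
      have hprod := prod_stanleyReisnerVar_eq_zero (K := K) ⟨v, hv⟩ hGf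
      rw [← Finset.mul_prod_erase G _ hv] at hprod
      dsimp only
      rw [map_mul, ← prod_stanleyReisnerVar, pow_one, mul_left_comm, hprod, mul_zero, smul_zero]
  · rw [koszulPowSum_stanleyReisnerVar, prod_stanleyReisnerVar, ← map_pow, ← map_mul, ← map_add,
      Ideal.Quotient.eq]
    refine mem_stanleyReisnerIdeal_of_coeff fun n hn => ?_
    let a : V → ℤ := shiftExponent (-k) (fun v => n v) F
    have han (v : V) : shiftExponent k a F v = n v := by
      simp only [a, shiftExponent]
      split_ifs <;> omega
    have hpow : (∏ v ∈ F, X v) ^ (k - 1) * (C (P 0 F) * ∏ v ∈ F, X v) =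
        (∏ v ∈ F, X v) ^ k * (C (P 0 F) : MvPolynomial V K) := by
      rw [← Nat.sub_add_cancel hk, Nat.add_sub_cancel, pow_succ]
      ring
    have hconst : intCoeff K (shiftExponent k a F) ((∏ v ∈ F, X v) ^ k * C (P 0 F)) =
        if a = 0 then P 0 F else 0 := by
      rw [intCoeff_prod_X_pow_mul, sub_self]
      have ha : shiftExponent 0 a F = a := by
        funext v
        simp [shiftExponent]
      rw [ha]
      split_ifs with h0
      · rw [h0, intCoeff_eq_coeff (n := 0) (fun v => by simp), coeff_zero_C]
      · by_contra hne
        obtain ⟨m, hm, ham⟩ := exists_eq_of_intCoeff_ne_zero hne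
        rw [mem_support_iff, coeff_C] at hm
        split_ifs at hm with hm0
        · exact h0 (funext fun v => by rw [ham, ← hm0]; rfl)
        · exact hm rfl
    rw [← intCoeff_eq_coeff han, map_sub, map_add, hpow, hconst, intCoeff_koszulPowSum, sub_eq_zero]
    have hqa : (fun G => intCoeff K (shiftExponent k a G) (q G)) = Q a := funext (hq a)
    rw [hqa]
    by_cases ha : ∀ v, -(k : ℤ) < a v
    · have hsupp : posSupport (shiftExponent k a F) = n.support := by
        ext v
        rw [mem_posSupport, han, Finsupp.mem_support_iff]
        omega
      rw [posSupport_shiftExponent ha] at hsupp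
      have hmem : F ∈ Δ.cechSupport a := by
        refine ⟨?_, by rwa [hsupp]⟩
        by_contra hno
        obtain ⟨v, hv⟩ := shiftExponent_neg (k := k) hno
        rw [han] at hv
        omega
      have hPa : intCoeff K (shiftExponent k a F) (p F) = P a F := (if_pos hmem).symm
      rw [hPa]
      split_ifs with h0
      · rw [hQ3 a h0, h0, signedSum_eq_zero fun _ _ => rfl, add_zero]
      · rw [zero_add]
        exact hQ4 a h0 ha F hmem hF
    · have hne : a ≠ 0 := by
        intro h0
        exact ha fun v => by simpa [h0] using hk
      rw [hlow a ha, if_neg hne, zero_add, signedSum_eq_zero]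
      exact fun v _ => hQ2 a (hlow a ha) _

theorem HasLocallyDisjointNonfaces.isBuchsbaum [Nonempty V] (h : Δ.HasLocallyDisjointNonfaces)
    (hpure : Δ.IsPure) : IsBuchsbaum (Δ.stanleyReisnerVar K) := by
  intro i hi
  obtain ⟨F, hF, -⟩ := exists_isFacet_superset (Δ.singleton_mem (Classical.arbitrary V))
  have hdim : ringKrullDim (Δ.StanleyReisnerRing K) ≤ (F.card : ℕ∞) :=
    ringKrullDim_stanleyReisnerRing_le fun G hG => by
      obtain ⟨H, hH, hGH⟩ := exists_isFacet_superset hG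
      exact (Finset.card_le_card hGH).trans (hpure H F hH hF).le
  have hiF : i < F.card := by exact_mod_cast hi.trans_le hdim
  refine h.koszulToLocalCohomology_surjective fun G hG => ?_
  obtain ⟨H, hH, hGH⟩ := exists_isFacet_superset hG
  exact ⟨H, hH.1, hGH, by rwa [hpure H F hH hF]⟩

end AbstractSimplicialComplex

theorem theorem1p11 {K : Type*} [Field K] {V : Type*} [Fintype V] [LinearOrder V] [Nonempty V]
    (Δ : AbstractSimplicialComplex V) :
    (Δ.IsLocallyCompleteIntersection K ↔
      ∃ (r : ℕ) (c : V → Fin r) (Γ : (i : Fin r) → AbstractSimplicialComplex {v : V // c v = i}),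
        Δ.IsDisjointUnion c Γ ∧ ∀ i, (Γ i).IsBuildingBlock K) ∧
    (Δ.IsBuildingBlock K → Δ.IsConnected) ∧
    (Δ.IsLocallyCompleteIntersection K →
      (IsCohenMacaulayRing (Δ.StanleyReisnerRing K) ↔ Δ.dim = 0 ∨ Δ.IsConnected) ∧
      (IsBuchsbaum (Δ.stanleyReisnerVar K) ↔ Δ.IsPure)) := by
  refine ⟨AbstractSimplicialComplex.isLocallyCompleteIntersection_iff_exists_isDisjointUnion,
    fun h => h.isConnected, fun h => ?_⟩
  have h' := AbstractSimplicialComplex.isLocallyCompleteIntersection_iff.1 h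
  exact ⟨⟨AbstractSimplicialComplex.dim_eq_zero_or_isConnected_of_isCohenMacaulayRing,
    h'.isCohenMacaulayRing⟩, ⟨AbstractSimplicialComplex.isPure_of_isBuchsbaum, h'.isBuchsbaum⟩⟩
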